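/- Let $L,\Lambda>0$, let $A(z)=-\tfrac12\Lambda^2z^2+\log(L/z)$ on $z>0$ (the boundary is at $z=0$, the infrared at $z=\infty$), let $d=4$, and let $\varphi_B(z)=\int_0^z\sqrt{-6\,(A''-A'^2)}\,dt$ be the background scalar. For $p^2\in\mathbb R$ put $a=p^2/(6\Lambda^2)$ and $w=\Lambda z$. The tensor Riccati equation is $$E'-e^{A}E^2+4A'E+p^2e^{-A}=0\qquad(z>0),$$ and a solution $E$ on $(0,\infty)$ is called IR-regular if $-\int_{z_0}^{z}e^{A}E\,dz'$ is bounded above as $z\to\infty$. Write $\mathbf E(w)=L\,E(z)\,e^{-\Lambda^2z^2/2}$; the equation becomes $w\,\partial_w\mathbf E-\mathbf E^2-(4+3w^2)\mathbf E+\frac{p^2}{\Lambda^2}w^2=0$. For $c\in\mathbb C$ and $w>0$ set $$j_c(w)=c\,G^{2,0}_{1,2}\!\left(-\tfrac{3w^2}{2}\,\Big|\,{1-a\atop 0,\,2}\right)+w^4\,{}_1F_1\!\left(a+2;3;\tfrac{3w^2}{2}\right),\qquad \mathbf E_c=-\frac{w\,j_c'}{j_c},\qquad c_*=\frac{8}{9\,\Gamma(2+a)}\,e^{-i\pi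 a},$$ where $G^{2,0}_{1,2}$ is the Meijer function, with the principal branch ($\arg=\pi$ on the negative axis). (1) For all real $p^2$ and all $c\in\mathbb C$, $\mathbf E_c$ solves the equation for $\mathbf E$ wherever $j_c\neq0$. (2) For every $p^2\ge0$ there is exactly one IR-regular solution $E$ on $(0,\infty)$. If $a\notin\{1,2,3,\dots\}$ and $c\in\mathbb C$, then "$j_c$ has no zero on $(0,\infty)$ and $\mathbf E=\mathbf E_c$" holds if and only if $c=c_*$. For every $p^2\ge 0$ (including $a\in\{1,2,\dots\}$, where $j_{c_*}\equiv0$), $\mathbf E$ is the pointwise limit of $\mathbf E_{c_*(q)}$ computed at real $q\to p^2$, $q\ne p^2$, in place of $p^2$. (3) Let $p^2\ge0$, $\mu>0$, and let $E$ be the IR-regular solution. Define the renormalized response function $L\hat E_{(4)}$ as the coefficient of $z^4$ that is left at the boundary after subtraction of the local terms: $$L\hat E_{(4)}(p^2)=\lim_{z\to0^+}z^{-4}\Big[L E-\tfrac{p^2L^2}{2}e^{-2A}-\tfrac{p^2L^2}{4}e^{-2A}\Big(\tfrac{p^2L^2}{2}e^{-2A}+\tfrac16\varphi_B^2\Big)\log(z^2\mu^2)\Big].$$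 The limit exists. With $\psi$ the digamma function, $\gamma$ Euler's constant and $$B(s)=\tfrac18\,s\,(s+6\Lambda^2)\Big[\psi\Big(-1-\tfrac{s}{6\Lambda^2}\Big)-\pi\cot\Big(\tfrac{\pi s}{6\Lambda^2}\Big)\Big],\qquad s\in\mathbb C,$$ one has, for $a\notin\{0,1,2,\dots\}$, $$L\hat E_{(4)}(p^2)=B(p^2)+K_\mu(p^2),\qquad K_\mu(s)=\tfrac18 s(s+6\Lambda^2)\Big(2\gamma+\log\tfrac{3\Lambda^2}{2\mu^2}\Big)-\Lambda^2 s ,$$ where $K_\mu$, a polynomial in $p^2$, is a contact term. For every $p^2\ge0$, $L\hat E_{(4)}(p^2)=\lim_{s\to p^2,\,s\ne p^2}\big(B(s)+K_\mu(s)\big)$, so that $B+K_\mu$ is the continuation of $L\hat E_{(4)}$ to complex $s=p^2$. (4) Up to contact terms, this is $-\frac18\sum_{n\ge0}\frac{p^2(p^2+6\Lambda^2)}{n+2+p^2/6\Lambda^2}$: for $s\in\mathbb C$ with $s/(6\Lambda^2)\notin\mathbb Z$, $$B(s)=-\tfrac{\gamma}{8}s(s+6\Lambda^2)+\sum_{n=0}^\infty\left[-\frac18\,\frac{s(s+6\Lambda^2)}{n+2+\frac{s}{6\Lambda^2}}+\frac18\,\frac{s(s+6\Lambda^2)}{n+1}\right],$$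 with a convergent series; and the same series expression equals $L\hat E_{(4)}(p^2)-K_\mu(p^2)$ for every $p^2\ge0$. (5) The spin-2 spectrum is linear: for every polynomial $Q$ (that is, for every choice of contact terms), $B+Q$ is meromorphic on $\mathbb C$, and its singularities are, apart from removable ones, simple poles at exactly the points $s=p^2=-6\Lambda^2m$, $m=2,3,4,\dots$ -/

import Mathlib

open Set Filter Topology MeasureTheory

noncomputable section

namespace IHQCD

/-! ## The background -/

/-- Warp factor `A(z) = -Λ²z²/2 + log (L/z)` of the domain wall
`ds² = e^{2A(z)} (dz² + dx²)`; the boundary (UV) is at `z = 0`, the IR at `z = ∞`. -/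
def warpFactor (L Λ : ℝ) (z : ℝ) : ℝ := -(1 / 2) * Λ ^ 2 * z ^ 2 + Real.log (L / z)

/-- The background scalar of a `(d+1)`-dimensional domain wall with warp factor `A`, normalised to
vanish at the boundary (its overall sign is immaterial):
`φ' = √(-2 (d-1) (A'' - A'²))`. -/
def backgroundScalar (d : ℕ) (A : ℝ → ℝ) (z : ℝ) : ℝ :=
  ∫ t in (0 : ℝ)..z, Real.sqrt (-2 * ((d : ℝ) - 1) * (deriv (deriv A) t - deriv A t ^ 2))

/-! ## The tensor Riccati equation and infrared regularity -/

/-- `E` solves `E' - e^A E² + d A' E + p² e^{-A} = 0` for all `z > 0`; here `psq` stands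
for `p²`. -/
def SolvesTensorRiccati (d : ℕ) (A : ℝ → ℝ) (psq : ℝ) (E : ℝ → ℝ) : Prop :=
  ∀ z : ℝ, 0 < z → DifferentiableAt ℝ E z ∧
    deriv E z - Real.exp (A z) * E z ^ 2 + (d : ℝ) * deriv A z * E z
      + psq * Real.exp (-(A z)) = 0

/-- Infrared regularity of the fluctuation `e = exp (-∫^z e^A E)`, that is `ė = E e`: the
integral `∫^r E dr' = -∫^z e^{A} E dz'` stays bounded above as `z → ∞`. -/
def IRRegular (A : ℝ → ℝ) (E : ℝ → ℝ) : Prop :=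
  ∃ z₀ : ℝ, 0 < z₀ ∧ ∃ C : ℝ, ∀ z : ℝ, z₀ ≤ z →
    -(∫ t in z₀..z, Real.exp (A t) * E t) ≤ C

/-- An infrared-regular tensor response function. -/
def IsIRRegularResponse (d : ℕ) (A : ℝ → ℝ) (psq : ℝ) (E : ℝ → ℝ) : Prop :=
  SolvesTensorRiccati d A psq E ∧ IRRegular A E

/-! ## Special functions -/

/-- Kummer's confluent hypergeometric function `₁F₁(a; b; x)`. -/
def kummer (a b x : ℂ) : ℂ :=
  ∑' n : ℕ, (ascPochhammer ℂ n).eval a / (ascPochhammer ℂ n).eval b * x ^ n / (n.factorial : ℂ)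

/-- The Mellin-Barnes integrand of `G^{2,0}_{1,2}`:
`Γ(b₁-s) Γ(b₂-s) / Γ(a₁-s) * z^s`, with the principal branch of `z^s`. -/
def meijerIntegrand (a₁ b₁ b₂ z s : ℂ) : ℂ :=
  Complex.Gamma (b₁ - s) * Complex.Gamma (b₂ - s) * (Complex.Gamma (a₁ - s))⁻¹ * z ^ s

/-- Real part of the left edge of the loop: left of all poles of `Γ(b₁-s) Γ(b₂-s)`. -/
def meijerLeft (b₁ b₂ : ℂ) : ℝ := min b₁.re b₂.re - 1

/-- Half-height of the loop. -/
def meijerHeight (b₁ b₂ : ℂ) : ℝ := max |b₁.im| |b₂.im| + 1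

/-- The Meijer function `G^{2,0}_{1,2}(z | a₁ ; b₁, b₂)`, for `z ≠ 0`: `1/(2πi)` times the integral
of the Mellin-Barnes integrand along the loop that comes in from `+∞` on the line `Im s = -τ`,
goes up the segment `Re s = σ`, `|Im s| ≤ τ`, and returns to `+∞` on the line `Im s = τ`. It
encircles all the poles of `Γ(b₁-s) Γ(b₂-s)` once in the negative sense. -/
def meijerG2012 (a₁ b₁ b₂ z : ℂ) : ℂ :=
  (2 * (Real.pi : ℂ) * Complex.I)⁻¹ *
    ((∫ t in Ioi (meijerLeft b₁ b₂),
        (meijerIntegrand a₁ b₁ b₂ z ((t : ℂ) + Complex.I * (meijerHeight b₁ b₂ : ℂ))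
          - meijerIntegrand a₁ b₁ b₂ z ((t : ℂ) - Complex.I * (meijerHeight b₁ b₂ : ℂ))))
      + Complex.I * ∫ y in (-meijerHeight b₁ b₂)..(meijerHeight b₁ b₂),
          meijerIntegrand a₁ b₁ b₂ z ((meijerLeft b₁ b₂ : ℂ) + Complex.I * (y : ℂ)))

/-! ## The explicit solution -/

/-- `j_c(w) = c G^{2,0}_{1,2}(-3w²/2 | 1 - p²/6Λ² ; 0, 2) + w⁴ ₁F₁(p²/6Λ² + 2; 3; 3w²/2)`. -/
def jFun (Λ psq : ℝ) (c : ℂ) (w : ℝ) : ℂ :=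
  c * meijerG2012 (1 - (psq / (6 * Λ ^ 2) : ℝ)) 0 2 ((-(3 * w ^ 2 / 2) : ℝ) : ℂ)
    + (w : ℂ) ^ 4 * kummer ((psq / (6 * Λ ^ 2) : ℝ) + 2) 3 ((3 * w ^ 2 / 2 : ℝ) : ℂ)

/-- `𝐄_c(w) = - w j_c'(w) / j_c(w)`. -/
def explicitE (Λ psq : ℝ) (c : ℂ) (w : ℝ) : ℂ :=
  -((w : ℂ) * deriv (jFun Λ psq c) w / jFun Λ psq c w)

/-- `c = 8 / (9 Γ(2 + p²/6Λ²)) * e^{-iπ p²/6Λ²}`. -/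
def cIR (Λ psq : ℝ) : ℂ :=
  8 / (9 * Complex.Gamma (2 + (psq / (6 * Λ ^ 2) : ℝ))) *
    Complex.exp (-(Complex.I * (Real.pi : ℂ) * (psq / (6 * Λ ^ 2) : ℝ)))

/-! ## The renormalized response function, `d = 4` -/

/-- The local (divergent) part of `L E` at the boundary,
`(p²L²/2) e^{-2A} + (p²L²/4) e^{-2A} ((p²L²/2) e^{-2A} + φ²/6) log (z²μ²)`. -/
def uvLocalPart (L μ psq : ℝ) (A φ : ℝ → ℝ) (z : ℝ) : ℝ :=
  psq * L ^ 2 / 2 * Real.exp (-2 * A z)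
    + psq * L ^ 2 / 4 * Real.exp (-2 * A z) *
        (psq * L ^ 2 / 2 * Real.exp (-2 * A z) + φ z ^ 2 / 6) * Real.log (z ^ 2 * μ ^ 2)

/-- `Ehat` is `L Ê₍₄₎`, the coefficient of `z⁴` left in `L E` at the boundary after the local
part has been subtracted. -/
def IsRenormalizedResponse (L μ psq : ℝ) (A φ E : ℝ → ℝ) (Ehat : ℝ) : Prop :=
  Tendsto (fun z : ℝ => (L * E z - uvLocalPart L μ psq A φ z) / z ^ 4) (𝓝[>] 0) (𝓝 Ehat)

/-- `(1/8) s (s + 6Λ²) [ψ(-1 - s/6Λ²) - π cot (π s/6Λ²)]`, as a function of complex `s = p²`. -/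
def boxedResponse (Λ : ℝ) (s : ℂ) : ℂ :=
  1 / 8 * s * (s + 6 * (Λ : ℂ) ^ 2) *
    (Complex.digamma (-1 - s / (6 * (Λ : ℂ) ^ 2))
      - (Real.pi : ℂ) * Complex.cot ((Real.pi : ℂ) * s / (6 * (Λ : ℂ) ^ 2)))

/-- Contact terms (a polynomial in `s = p²`) in the subtraction scheme with scale `μ`:
`(1/8) s (s + 6Λ²) (2γ + log (3Λ²/2μ²)) - Λ² s`. -/
def contactTerms (Λ μ : ℝ) (s : ℂ) : ℂ :=
  1 / 8 * s * (s + 6 * (Λ : ℂ) ^ 2) *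
      ((2 * Real.eulerMascheroniConstant + Real.log (3 * Λ ^ 2 / (2 * μ ^ 2)) : ℝ) : ℂ)
    - (Λ : ℂ) ^ 2 * s

/-- The `n`-th term of the pole expansion, `-(1/8) s (s + 6Λ²) / (n + 2 + s/6Λ²)`. -/
def poleTerm (Λ : ℝ) (n : ℕ) (s : ℂ) : ℂ :=
  -(1 / 8 * s * (s + 6 * (Λ : ℂ) ^ 2) / ((n : ℂ) + 2 + s / (6 * (Λ : ℂ) ^ 2)))

/-- The contact term that accompanies the `n`-th pole term, `(1/8) s (s + 6Λ²) / (n + 1)`. -/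
def poleContact (Λ : ℝ) (n : ℕ) (s : ℂ) : ℂ :=
  1 / 8 * s * (s + 6 * (Λ : ℂ) ^ 2) / ((n : ℂ) + 1)

/-- The overall contact term of the pole expansion, `-(γ/8) s (s + 6Λ²)`. -/
def gammaContact (Λ : ℝ) (s : ℂ) : ℂ :=
  -(1 / 8 * s * (s + 6 * (Λ : ℂ) ^ 2) * (Real.eulerMascheroniConstant : ℂ))

end IHQCD

end

/-!
With `a = p²/6Λ²` and `x = 3w²/2 = (3/2) Λ² z²`, the substitution `𝐄 = -w j'/j` turns the Riccati
equation into Kummer's equation `x f'' = (1 + x) f' + a f`, whose exponents at the boundary `x = 0`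
are `0` and `2` (`KummerSol`). Three solutions matter.

* `S(x) = x² ₁F₁(a+2; 3; x)` is regular at the boundary (`kummerSol_solS`).
* The Meijer function `G(-x)` is a loop integral over `Γ(-s) Γ(2-s) / Γ(1-a-s) e^{ζs}` with
  `ζ = log x + iπ`. The recurrence of the integrand, together with a shift of the loop by one, is the
  differential equation (`kummerSol_meijerX`). The integrand decays faster than every exponential
  along the loop, because consecutive values have ratio `O(1/t)`. Moving the left edge of the loop
  past the double poles at `0, 1, 2` gives `G` up to `o(x²)` at the boundary (`tendsto_meijerX`).
* `A(x) = ∫₀^∞ e^{-u} u^{a+1} (x+u)^{-a} du` is the solution that stays tame in the infrared. It is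
  positive, and `A' = -a B` with `B(x) = ∫₀^∞ e^{-u} (u/(x+u))^{a+1} du` (`kummerSol_irA`). An
  integration by parts and Gauss' integral for the digamma function give its boundary expansion to
  order `x²`, including `x² log x` (`tendsto_irA_second`).

By Abel's formula a solution that is `o(x²)` at the boundary vanishes
(`KummerSol.eq_zero_of_isLittleO`). Comparison of the two expansions therefore proves the connection
formula `G(-x) = -e^{iπa} Γ(a+2)/2 · S + A/Γ(1-a)` (`meijerX_eq_solS_add_irA`). So `c = c_*` is the one
value for which `S` drops out of `j_c`; then `j_c` is a multiple of `A`, which is zero exactly when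
`a = 1, 2, …`, and `𝐄_{c_*} = 2 a x B/A` (`explicitE_cIR`). The right side makes sense and is
continuous in `a` also at the excluded values.

For `a ≥ 0` this response is nonnegative, hence infrared regular. It is the only one: with the warp
factor `α` and `Fᵢ = -∫ e^α Eᵢ`, the difference of two solutions is `K e^{-4α - F₁ - F₂}`, and if `F₂`
is bounded above, then `K > 0` would drive `e^{F₁ - F₂}` below zero (`le_of_irRegular`).

The boundary expansion of `2 a x B/A` together with `φ_B² = 18 Λ² z² + O(z⁴)` produces the renormalized
response `(1/8) p² (p² + 6Λ²) ψ(2 + a)` plus contact terms (`isRenormalizedResponse_irResponse`). The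
reflection formula identifies `ψ(2 + a)` with `ψ(-1-a) - π cot πa` off the integers. The series
`ψ(s) + γ = ∑ (1/(n+1) - 1/(n+s))`, obtained from Euler's limit for `Γ`, gives the pole expansion
(`hasSum_poleTerm_add_poleContact`). The recurrence of `ψ` exhibits the poles of `ψ(2 + a)` at
`a = -2, -3, …`, where the factor `p² (p² + 6Λ²)` does not vanish (`meromorphicAt_boxedResponse_add`).
-/

noncomputable section

namespace IHQCD

/-! ### The digamma series -/

/-- The truncated Euler integrals satisfy `|Γ_n(s)| ≤ Γ(Re s)`, which bounds them uniformly in `n`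
on compact subsets of the right half plane. -/
lemma norm_GammaSeq_le {s : ℂ} (hs : 0 < s.re) {n : ℕ} (hn : n ≠ 0) :
    ‖Complex.GammaSeq s n‖ ≤ Real.Gamma s.re := by
  rw [Complex.GammaSeq_eq_approx_Gamma_integral hs hn, Real.Gamma_eq_integral hs]
  have hint := Real.GammaIntegral_convergent hs
  have hn0 : (0 : ℝ) ≤ n := Nat.cast_nonneg n
  have hint' : IntervalIntegrable (fun x : ℝ => Real.exp (-x) * x ^ (s.re - 1)) volume 0 n :=
    (intervalIntegrable_iff_integrableOn_Ioc_of_le hn0).2 (hint.mono_set Ioc_subset_Ioi_self)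
  refine (intervalIntegral.norm_integral_le_of_norm_le hn0 ?_ hint').trans ?_
  · refine Eventually.of_forall fun x hx => ?_
    rw [norm_mul, Complex.norm_cpow_eq_rpow_re_of_pos hx.1, Complex.norm_real]
    have h1 : 0 ≤ (1 - x / n) ^ n := by
      apply pow_nonneg
      rw [sub_nonneg]
      exact div_le_one_of_le₀ hx.2 hn0
    rw [Real.norm_of_nonneg h1]
    have := Real.one_sub_div_pow_le_exp_neg hx.2
    simp only [Complex.sub_re, Complex.one_re]
    exact mul_le_mul_of_nonneg_right this (Real.rpow_nonneg hx.1.le _)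
  · rw [intervalIntegral.integral_of_le hn0]
    refine setIntegral_mono_set hint ?_ (Ioc_subset_Ioi_self.eventuallyLE)
    filter_upwards [ae_restrict_mem measurableSet_Ioi] with x hx
    exact mul_nonneg (Real.exp_pos _).le (Real.rpow_nonneg (le_of_lt hx) _)

lemma differentiableAt_GammaSeq {s : ℂ} (hs : 0 < s.re) {n : ℕ} (hn : n ≠ 0) :
    DifferentiableAt ℂ (fun s => Complex.GammaSeq s n) s := by
  unfold Complex.GammaSeq
  refine DifferentiableAt.div ?_ ?_ ?_
  · refine DifferentiableAt.mul_const ?_ _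
    exact DifferentiableAt.const_cpow differentiableAt_id (Or.inl (by exact_mod_cast hn))
  · fun_prop
  · rw [Finset.prod_ne_zero_iff]
    intro j _ h
    have := congrArg Complex.re h
    simp at this
    have : (0 : ℝ) ≤ j := Nat.cast_nonneg j
    linarith

/-- Derivatives of Euler's approximations converge to `Γ'`: by Cauchy's formula on a circle the
pointwise convergence passes to derivatives, by dominated convergence. -/
lemma tendsto_deriv_GammaSeq {s : ℂ} (hs : 0 < s.re) :
    Tendsto (fun n => deriv (fun s => Complex.GammaSeq s n) s) atTop
      (𝓝 (deriv Complex.Gamma s)) := by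
  set R : ℝ := s.re / 2 with hR
  have hR0 : 0 < R := by positivity
  have hU : IsOpen {z : ℂ | 0 < z.re} := isOpen_lt continuous_const Complex.continuous_re
  have hsub : Metric.closedBall s R ⊆ {z : ℂ | 0 < z.re} := by
    intro z hz
    have h1 : |(z - s).re| ≤ R := (Complex.abs_re_le_norm _).trans (by simpa [dist_eq_norm] using hz)
    rw [Complex.sub_re] at h1
    have := (abs_le.1 h1).1
    simp only [mem_ofPred_eq]
    linarith
  have hΓ : DifferentiableOn ℂ Complex.Gamma {z : ℂ | 0 < z.re} := fun z hz =>
    (Complex.differentiableAt_Gamma z (fun m h => by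
      rw [h] at hz; simp at hz
      exact absurd hz (not_lt.2 (Nat.cast_nonneg m)))).differentiableWithinAt
  have hmem : s ∈ Metric.ball s R := Metric.mem_ball_self hR0
  have e0 := Complex.two_pi_I_inv_smul_circleIntegral_sub_sq_inv_smul_of_differentiable hU hsub hΓ
    hmem
  rw [← e0]
  have e1 : (fun n => deriv (fun s => Complex.GammaSeq s n) s) =ᶠ[atTop] fun n =>
      (2 * ↑Real.pi * Complex.I)⁻¹ •
        ∮ (z : ℂ) in C(s, R), ((z - s) ^ 2)⁻¹ • Complex.GammaSeq z n := by
    filter_upwards [eventually_ne_atTop 0] with n hn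
    exact (Complex.two_pi_I_inv_smul_circleIntegral_sub_sq_inv_smul_of_differentiable hU hsub
      (fun z hz => (differentiableAt_GammaSeq hz hn).differentiableWithinAt) hmem).symm
  refine Tendsto.congr' e1.symm (Tendsto.const_smul ?_ _)
  have hmem' : ∀ θ : ℝ, circleMap s R θ ∈ Metric.closedBall s R :=
    fun θ => circleMap_mem_closedBall s hR0.le θ
  have hre : ∀ θ, 0 < (circleMap s R θ).re := fun θ => hsub (hmem' θ)
  -- a bound for `Γ` on the real trace of the disc
  have hcont : Continuous fun θ : ℝ => Real.Gamma (circleMap s R θ).re := by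
    refine continuous_iff_continuousAt.2 fun θ => ?_
    refine ContinuousAt.comp (g := Real.Gamma) ?_
      (Complex.continuous_re.comp (continuous_circleMap s R)).continuousAt
    refine (Real.differentiableAt_Gamma fun m h => ?_).continuousAt
    have := hre θ
    rw [h] at this
    exact absurd this (by simp)
  unfold circleIntegral
  refine intervalIntegral.tendsto_integral_filter_of_dominated_convergence
    (fun θ => R⁻¹ * Real.Gamma (circleMap s R θ).re) ?_ ?_ ?_ ?_
  · filter_upwards [eventually_ne_atTop 0] with n hn
    refine Continuous.aestronglyMeasurable ?_
    refine continuous_iff_continuousAt.2 fun θ => ?_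
    have h1 : ContinuousAt (fun θ => Complex.GammaSeq (circleMap s R θ) n) θ :=
      ContinuousAt.comp (g := fun z => Complex.GammaSeq z n)
        (differentiableAt_GammaSeq (hre θ) hn).continuousAt (continuous_circleMap s R).continuousAt
    have h2 : circleMap s R θ - s ≠ 0 := by
      rw [circleMap_sub_center]; exact circleMap_ne_center hR0.ne'
    have h3 : ContinuousAt (circleMap s R) θ := (continuous_circleMap s R).continuousAt
    have h4 : ContinuousAt (fun θ => ((circleMap s R θ - s) ^ 2)⁻¹) θ :=
      ContinuousAt.inv₀ (by fun_prop) (pow_ne_zero _ h2)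
    have h5 : ContinuousAt (deriv (circleMap s R)) θ := by
      have : deriv (circleMap s R) = fun θ => circleMap 0 R θ * Complex.I := by
        ext θ; exact deriv_circleMap s R θ
      rw [this]
      exact ((continuous_circleMap 0 R).mul continuous_const).continuousAt
    exact h5.smul (h4.smul h1)
  · filter_upwards [eventually_ne_atTop 0] with n hn
    refine Eventually.of_forall fun θ _ => ?_
    rw [norm_smul, norm_smul, deriv_circleMap, circleMap_sub_center, norm_mul, Complex.norm_I,
      norm_inv, norm_pow, norm_circleMap_zero, abs_of_pos hR0, mul_one, ← mul_assoc]
    have h0 : R * (R ^ 2)⁻¹ = R⁻¹ := by field_simp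
    rw [h0]
    exact mul_le_mul_of_nonneg_left (norm_GammaSeq_le (hre θ) hn) (by positivity)
  · exact (continuous_const.mul hcont).intervalIntegrable _ _
  · refine Eventually.of_forall fun θ _ => ?_
    exact ((Complex.GammaSeq_tendsto_Gamma _).const_smul _).const_smul _

lemma logDeriv_GammaSeq {s : ℂ} (hs : 0 < s.re) {n : ℕ} (hn : n ≠ 0) :
    logDeriv (fun s => Complex.GammaSeq s n) s
      = Complex.log n - ∑ j ∈ Finset.range (n + 1), 1 / (s + j) := by
  have hne : ∀ j : ℕ, s + j ≠ 0 := by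
    intro j h
    have := congrArg Complex.re h
    simp at this
    have : (0 : ℝ) ≤ j := Nat.cast_nonneg j
    linarith
  have hn' : (n : ℂ) ≠ 0 := by exact_mod_cast hn
  unfold Complex.GammaSeq
  have hcp : HasDerivAt (fun s : ℂ => (n : ℂ) ^ s * (n.factorial : ℂ))
      ((n : ℂ) ^ s * Complex.log n * 1 * (n.factorial : ℂ)) s :=
    (HasDerivAt.const_cpow (hasDerivAt_id s) (Or.inl hn')).mul_const _
  have hf : (n.factorial : ℂ) ≠ 0 := by exact_mod_cast n.factorial_ne_zero
  have hp : (n : ℂ) ^ s ≠ 0 := by simp [Complex.cpow_eq_zero_iff, hn']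
  rw [logDeriv_div (f := fun s : ℂ => (n : ℂ) ^ s * (n.factorial : ℂ)) s (mul_ne_zero hp hf)
    (Finset.prod_ne_zero_iff.2 fun j _ => hne j) hcp.differentiableAt (by fun_prop),
    logDeriv_prod (fun j _ => hne j) (fun j _ => by fun_prop), logDeriv_apply, hcp.deriv]
  congr 1
  · field_simp
  · refine Finset.sum_congr rfl fun j _ => ?_
    rw [logDeriv_apply]
    simp

lemma summable_digamma (s : ℂ) :
    Summable fun n : ℕ => 1 / ((n : ℂ) + 1) - 1 / ((n : ℂ) + s) := by
  have hO : (fun n : ℕ => 1 / ((n : ℂ) + 1) - 1 / ((n : ℂ) + s)) =O[atTop]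
      fun n : ℕ => 1 / (n : ℝ) ^ 2 := by
    refine Asymptotics.IsBigO.of_bound (2 * ‖s - 1‖) ?_
    filter_upwards [eventually_ge_atTop 1, eventually_ge_atTop ⌈2 * ‖s‖⌉₊] with n hn1 hn
    have hn' : 2 * ‖s‖ ≤ n := Nat.ceil_le.1 hn
    have hn0 : (1 : ℝ) ≤ n := by exact_mod_cast hn1
    have h1 : (n : ℝ) / 2 ≤ ‖(n : ℂ) + s‖ := by
      have := norm_sub_le ((n : ℂ) + s) s
      simp only [add_sub_cancel_right, Complex.norm_natCast] at this
      linarith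
    have h2 : (n : ℝ) ≤ ‖(n : ℂ) + 1‖ := by
      have : ((n : ℂ) + 1) = ((n + 1 : ℕ) : ℂ) := by push_cast; ring
      rw [this, Complex.norm_natCast]; push_cast; linarith
    have h3 : (n : ℂ) + s ≠ 0 := norm_pos_iff.1 (by linarith)
    have h4 : (n : ℂ) + 1 ≠ 0 := norm_pos_iff.1 (by linarith)
    rw [div_sub_div _ _ h4 h3, norm_div, norm_mul]
    have : (1 * ((n : ℂ) + s) - ((n : ℂ) + 1) * 1) = s - 1 := by ring
    rw [this, norm_div, norm_one, norm_pow, Real.norm_natCast]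
    rw [mul_one_div, div_le_div_iff₀ (by nlinarith) (by positivity)]
    have : (n : ℝ) ^ 2 ≤ 2 * (‖(n : ℂ) + 1‖ * ‖(n : ℂ) + s‖) := by nlinarith
    nlinarith [norm_nonneg (s - 1)]
  exact summable_of_isBigO_nat (Real.summable_one_div_nat_pow.2 (by norm_num)) hO

lemma tendsto_one_div_add_natCast (s : ℂ) :
    Tendsto (fun n : ℕ => 1 / (s + n)) atTop (𝓝 0) := by
  simp only [one_div]
  refine tendsto_inv₀_cobounded.comp (tendsto_norm_atTop_iff_cobounded.1 ?_)
  refine tendsto_atTop_mono (f := fun n : ℕ => (n : ℝ) - ‖s‖) (fun n => ?_)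
    (tendsto_atTop_add_const_right _ _ tendsto_natCast_atTop_atTop)
  have := norm_sub_le (s + n) s
  simp only [add_sub_cancel_left, Complex.norm_natCast] at this
  linarith

/-- The series is the limit of the logarithmic derivatives of Euler's approximations to `Γ`. -/
lemma hasSum_digamma_of_re_pos {s : ℂ} (hs : 0 < s.re) :
    HasSum (fun n : ℕ => 1 / ((n : ℂ) + 1) - 1 / ((n : ℂ) + s))
      (Complex.digamma s + Real.eulerMascheroniConstant) := by
  refine (summable_digamma s).hasSum_iff_tendsto_nat.2 ?_
  have hΓ : Complex.Gamma s ≠ 0 := Complex.Gamma_ne_zero_of_re_pos hs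
  have h1 : Tendsto (fun n => logDeriv (fun s => Complex.GammaSeq s n) s) atTop
      (𝓝 (Complex.digamma s)) := by
    rw [Complex.digamma_def, logDeriv_apply]
    exact (tendsto_deriv_GammaSeq hs).div (Complex.GammaSeq_tendsto_Gamma s) hΓ
  have h2 : Tendsto (fun n : ℕ => ((harmonic n - Real.log n : ℝ) : ℂ)) atTop
      (𝓝 (Real.eulerMascheroniConstant : ℂ)) :=
    (Complex.continuous_ofReal.tendsto _).comp Real.tendsto_harmonic_sub_log
  have h3 := tendsto_one_div_add_natCast s
  have := (h1.add h2).add h3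
  rw [add_zero] at this
  refine this.congr' ?_
  filter_upwards [eventually_ne_atTop 0] with n hn
  rw [logDeriv_GammaSeq hs hn, Finset.sum_range_succ, Finset.sum_sub_distrib, harmonic]
  have : ∑ x ∈ Finset.range n, 1 / (s + (x : ℂ)) = ∑ x ∈ Finset.range n, 1 / ((x : ℂ) + s) :=
    Finset.sum_congr rfl fun j _ => by rw [add_comm]
  rw [this]
  push_cast
  simp only [one_div]
  ring

/-- `ψ(s) + γ = ∑ (1/(n+1) - 1/(n+s))` away from the poles. -/
lemma hasSum_digamma {s : ℂ} (hs : ∀ m : ℕ, s ≠ -m) :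
    HasSum (fun n : ℕ => 1 / ((n : ℂ) + 1) - 1 / ((n : ℂ) + s))
      (Complex.digamma s + Real.eulerMascheroniConstant) := by
  obtain ⟨k, hk⟩ : ∃ k : ℕ, 0 < s.re + k := by
    obtain ⟨k, hk⟩ := exists_nat_gt (-s.re)
    exact ⟨k, by linarith⟩
  induction k generalizing s with
  | zero => exact hasSum_digamma_of_re_pos (by simpa using hk)
  | succ k ih =>
    have hs0 : s ≠ 0 := by simpa using hs 0
    have hs1 : ∀ m : ℕ, s + 1 ≠ -m := by
      intro m h
      apply hs (m + 1)
      push_cast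
      linear_combination h
    have h1 := ih hs1 (by simp at hk ⊢; linarith)
    rw [Complex.digamma_apply_add_one s hs] at h1
    refine (summable_digamma s).hasSum_iff_tendsto_nat.2 ?_
    have h3 := tendsto_one_div_add_natCast s
    have h2 := (h1.tendsto_sum_nat.add h3).add_const (-s⁻¹)
    have e : Complex.digamma s + s⁻¹ + Real.eulerMascheroniConstant + 0 + -s⁻¹
        = Complex.digamma s + Real.eulerMascheroniConstant := by ring
    rw [e] at h2
    refine h2.congr fun n => ?_
    simp only [Finset.sum_sub_distrib]
    have e1 : ∑ j ∈ Finset.range n, 1 / ((j : ℂ) + (s + 1))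
        = ∑ j ∈ Finset.range n, 1 / ((j : ℂ) + s) + 1 / (s + n) - s⁻¹ := by
      have := Finset.sum_range_succ' (fun j : ℕ => 1 / ((j : ℂ) + s)) n
      rw [Finset.sum_range_succ] at this
      have e2 : ∀ j : ℕ, 1 / (((j + 1 : ℕ) : ℂ) + s) = 1 / ((j : ℂ) + (s + 1)) := by
        intro j; push_cast; congr 1; ring
      simp only [e2] at this
      rw [add_comm s (n : ℂ), eq_sub_iff_add_eq, this]
      simp
    rw [e1]
    ring

lemma digamma_eq_digamma_add_natCast_sub {z : ℂ} (hz : ∀ m : ℕ, z ≠ -m) (n : ℕ) :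
    Complex.digamma z = Complex.digamma (z + n) - ∑ j ∈ Finset.range n, 1 / (z + j) := by
  induction n with
  | zero => simp
  | succ n ih =>
    have h : ∀ m : ℕ, z + n ≠ -m := by
      intro m h
      apply hz (n + m)
      push_cast
      linear_combination h
    rw [ih, Finset.sum_range_succ, Nat.cast_succ, ← add_assoc, Complex.digamma_apply_add_one _ h]
    simp only [one_div]
    ring

lemma analyticAt_Gamma {z : ℂ} (hz : ∀ m : ℕ, z ≠ -m) : AnalyticAt ℂ Complex.Gamma z := by
  have hz' : (Complex.Gamma z)⁻¹ ≠ 0 := inv_ne_zero (Complex.Gamma_ne_zero hz)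
  have h : AnalyticAt ℂ (fun s => (Complex.Gamma s)⁻¹) z :=
    Complex.differentiable_one_div_Gamma.analyticAt z
  simpa using h.fun_inv hz'

lemma analyticAt_digamma {z : ℂ} (hz : ∀ m : ℕ, z ≠ -m) : AnalyticAt ℂ Complex.digamma z :=
  (analyticAt_Gamma hz).deriv.div (analyticAt_Gamma hz) (Complex.Gamma_ne_zero hz)

/-- Logarithmic derivative of Euler's reflection formula: `ψ(1 - z) - ψ(z) = π cot(πz)`. -/
lemma digamma_reflection {z : ℂ} (hz : ∀ k : ℤ, z ≠ k) :
    Complex.digamma z = Complex.digamma (1 - z) - Real.pi * Complex.cot (Real.pi * z) := by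
  have h1 : ∀ m : ℕ, z ≠ -m := fun m h => hz (-m) (by simpa using h)
  have h2 : ∀ m : ℕ, 1 - z ≠ -m := fun m h => hz (m + 1) (by
    push_cast; linear_combination -h)
  have hsin : Complex.sin (Real.pi * z) ≠ 0 := by
    intro h
    obtain ⟨k, hk⟩ := Complex.sin_eq_zero_iff.1 h
    have hpi : (Real.pi : ℂ) ≠ 0 := by exact_mod_cast Real.pi_ne_zero
    exact hz k (mul_left_cancel₀ hpi (by rw [hk]; ring))
  have d1 := (analyticAt_Gamma h1).differentiableAt.hasDerivAt
  have d2 := (analyticAt_Gamma h2).differentiableAt.hasDerivAt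
  have d2' : HasDerivAt (fun s => Complex.Gamma (1 - s)) (deriv Complex.Gamma (1 - z) * -1) z := by
    have : HasDerivAt (fun s : ℂ => 1 - s) (-1) z := by
      simpa using (hasDerivAt_id z).const_sub 1
    exact HasDerivAt.comp z d2 this
  have d3 := d1.mul d2'
  have d4 : HasDerivAt (fun s : ℂ => (Real.pi : ℂ) / Complex.sin (Real.pi * s))
      (-(Real.pi * (Complex.cos (Real.pi * z) * Real.pi)) / Complex.sin (Real.pi * z) ^ 2) z := by
    have h5 : HasDerivAt (fun s : ℂ => Complex.sin (Real.pi * s))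
        (Complex.cos (Real.pi * z) * Real.pi) z := by
      have : HasDerivAt (fun s : ℂ => (Real.pi : ℂ) * s) Real.pi z := by
        simpa using (hasDerivAt_id z).const_mul (Real.pi : ℂ)
      exact this.csin
    refine ((hasDerivAt_const z (Real.pi : ℂ)).fun_div h5 hsin).congr_deriv ?_
    ring
  have e : (fun s => Complex.Gamma s * Complex.Gamma (1 - s))
      = fun s : ℂ => (Real.pi : ℂ) / Complex.sin (Real.pi * s) :=
    funext Complex.Gamma_mul_Gamma_one_sub
  have d3' : HasDerivAt (fun s : ℂ => (Real.pi : ℂ) / Complex.sin (Real.pi * s))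
      (deriv Complex.Gamma z * Complex.Gamma (1 - z) +
        Complex.Gamma z * (deriv Complex.Gamma (1 - z) * -1)) z := by
    rw [← e]; exact d3
  have e2 := d3'.unique d4
  have hΓ1 := Complex.Gamma_ne_zero h1
  have hΓ2 := Complex.Gamma_ne_zero h2
  have hm := Complex.Gamma_mul_Gamma_one_sub z
  rw [Complex.digamma_def, logDeriv_apply, logDeriv_apply, Complex.cot_eq_cos_div_sin]
  have hpi : (Real.pi : ℂ) / Complex.sin (Real.pi * z) ≠ 0 := by
    rw [← hm]; exact mul_ne_zero hΓ1 hΓ2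
  have e3 : deriv Complex.Gamma z / Complex.Gamma z
      - deriv Complex.Gamma (1 - z) / Complex.Gamma (1 - z)
      = (deriv Complex.Gamma z * Complex.Gamma (1 - z) +
        Complex.Gamma z * (deriv Complex.Gamma (1 - z) * -1)) /
        (Complex.Gamma z * Complex.Gamma (1 - z)) := by
    field_simp
    ring
  rw [e2, hm] at e3
  have e4 : -(Real.pi * (Complex.cos (Real.pi * z) * Real.pi)) / Complex.sin (Real.pi * z) ^ 2 /
      ((Real.pi : ℂ) / Complex.sin (Real.pi * z))
      = -(Real.pi * (Complex.cos (Real.pi * z) / Complex.sin (Real.pi * z))) := by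
    have hpi0 : (Real.pi : ℂ) ≠ 0 := by exact_mod_cast Real.pi_ne_zero
    field_simp
  rw [e4] at e3
  linear_combination e3

/-! ### The boxed response function -/

/-- The meromorphic function `(1/8) s (s + 6Λ²) ψ(2 + s/6Λ²)`; the reflection formula identifies it
with `boxedResponse` off the integer points. -/
def digammaResponse (Λ : ℝ) (s : ℂ) : ℂ :=
  1 / 8 * s * (s + 6 * (Λ : ℂ) ^ 2) * Complex.digamma (2 + s / (6 * (Λ : ℂ) ^ 2))

lemma boxedResponse_eq_digammaResponse {Λ : ℝ} {s : ℂ}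
    (hs : ∀ k : ℤ, s / (6 * (Λ : ℂ) ^ 2) ≠ k) :
    boxedResponse Λ s = digammaResponse Λ s := by
  set a := s / (6 * (Λ : ℂ) ^ 2) with ha
  have h := digamma_reflection (z := -1 - a) (fun k h => hs (-1 - k) (by
    push_cast; linear_combination -h))
  have hcot : Complex.cot (Real.pi * (-1 - a)) = -Complex.cot (Real.pi * a) := by
    rw [Complex.cot_eq_cos_div_sin, Complex.cot_eq_cos_div_sin]
    have e : (Real.pi : ℂ) * (-1 - a) = -(Real.pi * a + Real.pi) := by ring
    rw [e, Complex.cos_neg, Complex.sin_neg, Complex.cos_add_pi, Complex.sin_add_pi, neg_neg,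
      neg_div]
  rw [hcot] at h
  have e2 : (1 : ℂ) - (-1 - a) = 2 + a := by ring
  rw [e2] at h
  unfold boxedResponse digammaResponse
  rw [mul_div_assoc, ← ha, h]
  ring

lemma hasSum_poleTerm_add_poleContact {Λ : ℝ} {s : ℂ}
    (hs : ∀ m : ℕ, 2 + s / (6 * (Λ : ℂ) ^ 2) ≠ -m) :
    HasSum (fun n : ℕ => poleTerm Λ n s + poleContact Λ n s)
      (digammaResponse Λ s - gammaContact Λ s) := by
  have h := (hasSum_digamma hs).mul_left (1 / 8 * s * (s + 6 * (Λ : ℂ) ^ 2))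
  have e : 1 / 8 * s * (s + 6 * (Λ : ℂ) ^ 2) * (Complex.digamma (2 + s / (6 * (Λ : ℂ) ^ 2))
      + Real.eulerMascheroniConstant) = digammaResponse Λ s - gammaContact Λ s := by
    unfold digammaResponse gammaContact; ring
  rw [← e]
  refine h.congr_fun fun n => ?_
  unfold poleTerm poleContact
  rw [← add_assoc (n : ℂ) 2]
  ring

lemma eventually_div_ne_intCast {Λ : ℝ} (hΛ : 0 < Λ) (s₀ : ℂ) :
    ∀ᶠ s in 𝓝[≠] s₀, ∀ k : ℤ, s / (6 * (Λ : ℂ) ^ 2) ≠ k := by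
  have hΛ' : (6 * (Λ : ℂ) ^ 2) ≠ 0 := by
    have : (Λ : ℂ) ≠ 0 := by exact_mod_cast hΛ.ne'
    simp [this]
  have hd : ∀ᶠ z in 𝓝[≠] (s₀ / (6 * (Λ : ℂ) ^ 2)), z ∉ Set.range ((↑) : ℤ → ℂ) := by
    have hcl : IsClosed (Set.range ((↑) : ℤ → ℂ) \ {s₀ / (6 * (Λ : ℂ) ^ 2)}) := by
      have : IsClosedMap ((↑) : ℤ → ℂ) := Complex.isClosedEmbedding_intCast.isClosedMap
      have h2 := this (((↑) : ℤ → ℂ) ⁻¹' {s₀ / (6 * (Λ : ℂ) ^ 2)}ᶜ) (isClosed_discrete _)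
      rw [image_preimage_eq_inter_range] at h2
      rwa [inter_comm, ← sdiff_eq] at h2
    have h3 := hcl.isOpen_compl.mem_nhds
      (show s₀ / (6 * (Λ : ℂ) ^ 2) ∈ (Set.range ((↑) : ℤ → ℂ) \ {s₀ / (6 * (Λ : ℂ) ^ 2)})ᶜ by simp)
    filter_upwards [nhdsWithin_le_nhds h3, self_mem_nhdsWithin] with z hz hz' hz2
    exact hz ⟨hz2, hz'⟩
  have ht : Tendsto (fun s : ℂ => s / (6 * (Λ : ℂ) ^ 2)) (𝓝[≠] s₀)
      (𝓝[≠] (s₀ / (6 * (Λ : ℂ) ^ 2))) := by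
    refine tendsto_nhdsWithin_iff.2 ⟨?_, ?_⟩
    · exact ((continuous_id.div_const _).tendsto s₀).mono_left nhdsWithin_le_nhds
    · filter_upwards [self_mem_nhdsWithin] with s hs h
      exact hs ((div_left_inj' hΛ').1 h)
  filter_upwards [ht.eventually hd] with s hs k hk
  exact hs ⟨k, hk.symm⟩

lemma boxedResponse_eventuallyEq {Λ : ℝ} (hΛ : 0 < Λ) (s₀ : ℂ) :
    boxedResponse Λ =ᶠ[𝓝[≠] s₀] digammaResponse Λ := by
  filter_upwards [eventually_div_ne_intCast hΛ s₀] with s hs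
  exact boxedResponse_eq_digammaResponse hs

lemma analyticAt_digammaResponse {Λ : ℝ} {s : ℂ}
    (hs : ∀ m : ℕ, 2 + s / (6 * (Λ : ℂ) ^ 2) ≠ -m) : AnalyticAt ℂ (digammaResponse Λ) s := by
  unfold digammaResponse
  have h1 : AnalyticAt ℂ (fun s : ℂ => 1 / 8 * s * (s + 6 * (Λ : ℂ) ^ 2)) s := by fun_prop
  have h2 : AnalyticAt ℂ (fun s : ℂ => 2 + s / (6 * (Λ : ℂ) ^ 2)) s := by
    simp only [div_eq_mul_inv]; fun_prop
  exact h1.mul ((analyticAt_digamma hs).comp_of_eq h2 rfl)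

/-- At `s₀ = -6Λ²(n+2)` the recurrence of `ψ` isolates the polar part `-1/(2 + n + s/6Λ²)`, whose
coefficient does not vanish because `s₀ (s₀ + 6Λ²) ≠ 0`. -/
lemma boxedResponse_add_pole {Λ : ℝ} (hΛ : 0 < Λ) (Q : Polynomial ℂ) (n : ℕ) {s₀ : ℂ}
    (hs : s₀ = -(6 * (Λ : ℂ) ^ 2 * ((n + 2 : ℕ) : ℂ))) :
    ∃ g : ℂ → ℂ, AnalyticAt ℂ g s₀ ∧ g s₀ ≠ 0 ∧
      ∀ᶠ s in 𝓝[≠] s₀, boxedResponse Λ s + Q.eval s = (s - s₀) ^ (-1 : ℤ) • g s := by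
  have hΛ0 : (Λ : ℂ) ≠ 0 := by exact_mod_cast hΛ.ne'
  have hΛ' : (6 * (Λ : ℂ) ^ 2) ≠ 0 := by simp [hΛ0]
  have hz0 : 2 + s₀ / (6 * (Λ : ℂ) ^ 2) = -n := by
    rw [hs]; push_cast; field_simp; ring
  refine ⟨fun s => 1 / 8 * s * (s + 6 * (Λ : ℂ) ^ 2) * ((s - s₀) *
      (Complex.digamma (2 + s / (6 * (Λ : ℂ) ^ 2) + (n + 1 : ℕ)) -
        ∑ j ∈ Finset.range n, 1 / (2 + s / (6 * (Λ : ℂ) ^ 2) + j)) - 6 * (Λ : ℂ) ^ 2)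
      + (s - s₀) * Q.eval s, ?_, ?_, ?_⟩
  · have h2 : AnalyticAt ℂ (fun s : ℂ => 2 + s / (6 * (Λ : ℂ) ^ 2)) s₀ := by
      simp only [div_eq_mul_inv]; fun_prop
    have h3 : AnalyticAt ℂ (fun s => Complex.digamma (2 + s / (6 * (Λ : ℂ) ^ 2) + (n + 1 : ℕ)))
        s₀ := by
      refine AnalyticAt.fun_comp (g := Complex.digamma)
        (f := fun s : ℂ => 2 + s / (6 * (Λ : ℂ) ^ 2) + (n + 1 : ℕ))
        (analyticAt_digamma fun m h => ?_) (h2.add analyticAt_const)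
      rw [hz0] at h
      have h' : ((1 + m : ℕ) : ℂ) = 0 := by push_cast at h ⊢; linear_combination h
      have := Nat.cast_eq_zero.1 h'
      omega
    have h4 : AnalyticAt ℂ
        (fun s : ℂ => ∑ j ∈ Finset.range n, 1 / (2 + s / (6 * (Λ : ℂ) ^ 2) + j)) s₀ := by
      refine Finset.analyticAt_fun_sum _ fun j hj => ?_
      refine AnalyticAt.div analyticAt_const (h2.add analyticAt_const) ?_
      rw [hz0]
      intro h
      have h' : (j : ℂ) = n := by linear_combination h
      have := Nat.cast_injective h'
      have := Finset.mem_range.1 hj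
      omega
    have h5 : AnalyticAt ℂ (fun s => Q.eval s) s₀ :=
      Polynomial.differentiable Q |>.analyticAt s₀
    have h6 : AnalyticAt ℂ (fun s : ℂ => s - s₀) s₀ := by fun_prop
    have h1 : AnalyticAt ℂ (fun s : ℂ => 1 / 8 * s * (s + 6 * (Λ : ℂ) ^ 2)) s₀ := by fun_prop
    exact (h1.mul ((h6.mul (h3.sub h4)).sub analyticAt_const)).add (h6.mul h5)
  · simp only [sub_self, zero_mul, zero_sub, add_zero]
    have e : s₀ + 6 * (Λ : ℂ) ^ 2 = -(6 * (Λ : ℂ) ^ 2 * ((n + 1 : ℕ) : ℂ)) := by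
      rw [hs]; push_cast; ring
    rw [e, hs]
    have h1 : ((n + 1 : ℕ) : ℂ) ≠ 0 := by exact_mod_cast n.succ_ne_zero
    have h2 : ((n + 2 : ℕ) : ℂ) ≠ 0 := by exact_mod_cast (n + 1).succ_ne_zero
    simp only [ne_eq, mul_eq_zero, neg_eq_zero, not_or]
    refine ⟨⟨⟨by norm_num, ⟨⟨by norm_num, by simp [hΛ0]⟩, h2⟩⟩, ⟨⟨by norm_num, by simp [hΛ0]⟩, h1⟩⟩,
      by norm_num, by simp [hΛ0]⟩
  · filter_upwards [eventually_div_ne_intCast hΛ s₀, self_mem_nhdsWithin] with s hk hne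
    have hss : s - s₀ ≠ 0 := sub_ne_zero.2 hne
    rw [boxedResponse_eq_digammaResponse hk, digammaResponse,
      digamma_eq_digamma_add_natCast_sub (z := 2 + s / (6 * (Λ : ℂ) ^ 2)) (fun m h =>
        hk (-m - 2) (by push_cast; linear_combination h)) (n + 1), Finset.sum_range_succ]
    have e : 2 + s / (6 * (Λ : ℂ) ^ 2) + n = (s - s₀) / (6 * (Λ : ℂ) ^ 2) := by
      rw [sub_div]; linear_combination hz0
    rw [e, one_div_div, zpow_neg_one, smul_eq_mul]
    field_simp
    ring

lemma meromorphicAt_boxedResponse_add {Λ : ℝ} (hΛ : 0 < Λ) (Q : Polynomial ℂ) (s : ℂ) :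
    MeromorphicAt (fun s : ℂ => boxedResponse Λ s + Q.eval s) s ∧
      ((∃ m : ℕ, 2 ≤ m ∧ s = -(6 * (Λ : ℂ) ^ 2 * (m : ℂ))) →
        meromorphicOrderAt (fun s : ℂ => boxedResponse Λ s + Q.eval s) s = -1) ∧
      ((¬ ∃ m : ℕ, 2 ≤ m ∧ s = -(6 * (Λ : ℂ) ^ 2 * (m : ℂ))) →
        0 ≤ meromorphicOrderAt (fun s : ℂ => boxedResponse Λ s + Q.eval s) s) := by
  have hΛ0 : (Λ : ℂ) ≠ 0 := by exact_mod_cast hΛ.ne'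
  by_cases h : ∃ m : ℕ, 2 ≤ m ∧ s = -(6 * (Λ : ℂ) ^ 2 * (m : ℂ))
  · obtain ⟨m, hm, hs⟩ := id h
    obtain ⟨n, rfl⟩ := Nat.exists_eq_add_of_le' hm
    obtain ⟨g, hg, hg0, he⟩ := boxedResponse_add_pole hΛ Q n hs
    have hmer : MeromorphicAt (fun s : ℂ => boxedResponse Λ s + Q.eval s) s := by
      refine MeromorphicAt.congr ?_ (EventuallyEq.symm he)
      have : MeromorphicAt (fun z => z - s) s := by fun_prop
      exact (this.zpow (-1)).smul hg.meromorphicAt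
    exact ⟨hmer, fun _ => (meromorphicOrderAt_eq_int_iff hmer).2 ⟨g, hg, hg0, he⟩,
      fun h' => absurd h h'⟩
  · have ha : ∀ m : ℕ, 2 + s / (6 * (Λ : ℂ) ^ 2) ≠ -m := by
      intro m hm
      refine h ⟨m + 2, by omega, ?_⟩
      have : s / (6 * (Λ : ℂ) ^ 2) = -((m : ℂ) + 2) := by linear_combination hm
      rw [div_eq_iff (by simp [hΛ0])] at this
      rw [this]; push_cast; ring
    have h1 : AnalyticAt ℂ (fun s => digammaResponse Λ s + Q.eval s) s :=
      (analyticAt_digammaResponse ha).add (Polynomial.differentiable Q |>.analyticAt s)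
    have he : (fun s => digammaResponse Λ s + Q.eval s) =ᶠ[𝓝[≠] s]
        fun s : ℂ => boxedResponse Λ s + Q.eval s := by
      filter_upwards [boxedResponse_eventuallyEq hΛ s] with z hz
      rw [hz]
    refine ⟨h1.meromorphicAt.congr he, fun h' => absurd h' h, fun _ => ?_⟩
    rw [← meromorphicOrderAt_congr he]
    exact h1.meromorphicOrderAt_nonneg

/-! ### Everywhere convergent power series -/

/-- The real power series with coefficients `c` converges everywhere. -/
def EntireCoeff (c : ℕ → ℝ) : Prop := ∀ r : ℝ, 0 ≤ r → Summable fun n => |c n| * r ^ n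

lemma EntireCoeff.summable {c : ℕ → ℝ} (hc : EntireCoeff c) (x : ℝ) :
    Summable fun n => c n * x ^ n := by
  refine Summable.of_norm ?_
  simpa [abs_mul, abs_pow] using hc |x| (abs_nonneg x)

lemma EntireCoeff.deriv {c : ℕ → ℝ} (hc : EntireCoeff c) :
    EntireCoeff fun n => ((n : ℝ) + 1) * c (n + 1) := by
  intro r hr
  have h := (summable_nat_add_iff 1).2 (hc (2 * (r + 1)) (by positivity))
  refine Summable.of_nonneg_of_le (fun n => by positivity) (fun n => ?_) h
  have h1 : ((n : ℝ) + 1) ≤ 2 ^ (n + 1) := by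
    have := (Nat.lt_two_pow_self (n := n + 1)).le
    exact_mod_cast this
  have h2 : r ^ n ≤ (r + 1) ^ (n + 1) := by
    calc r ^ n ≤ (r + 1) ^ n := by gcongr; linarith
      _ ≤ (r + 1) ^ (n + 1) := pow_le_pow_right₀ (by linarith) (by omega)
  rw [abs_mul, abs_of_nonneg (by positivity : (0 : ℝ) ≤ (n : ℝ) + 1), mul_pow]
  calc ((n : ℝ) + 1) * |c (n + 1)| * r ^ n = |c (n + 1)| * (((n : ℝ) + 1) * r ^ n) := by ring
    _ ≤ |c (n + 1)| * (2 ^ (n + 1) * (r + 1) ^ (n + 1)) := by gcongr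

lemma EntireCoeff.hasDerivAt {c : ℕ → ℝ} (hc : EntireCoeff c) (x : ℝ) :
    HasDerivAt (fun x => ∑' n, c n * x ^ n) (∑' n : ℕ, ((n : ℝ) + 1) * c (n + 1) * x ^ n) x := by
  set r : ℝ := |x| + 1 with hr
  have hr0 : 0 < r := by positivity
  have hu : Summable fun n : ℕ => |(n : ℝ) * c n| * r ^ (n - 1) := by
    rw [← summable_nat_add_iff 1]
    simpa using hc.deriv r hr0.le
  have hx : x ∈ Ioo (-r) r := abs_lt.1 (by rw [hr]; linarith)
  have h := hasDerivAt_tsum_of_isPreconnected (g := fun n x => c n * x ^ n)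
    (g' := fun n x => c n * (n * x ^ (n - 1))) (t := Ioo (-r) r) (y₀ := x) (y := x) hu isOpen_Ioo
    isPreconnected_Ioo (fun n y _ => (hasDerivAt_pow n y).const_mul _) (fun n y hy => ?_) hx
    (hc.summable x) hx
  · refine h.congr_deriv ?_
    have hs : Summable fun n : ℕ => c n * (n * x ^ (n - 1)) := by
      rw [← summable_nat_add_iff 1]
      refine (hc.deriv.summable x).congr fun n => ?_
      simp only [Nat.add_sub_cancel, Nat.cast_add, Nat.cast_one]; ring
    rw [hs.tsum_eq_zero_add]
    simp only [Nat.cast_zero, zero_mul, mul_zero, zero_add]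
    refine tsum_congr fun n => ?_
    simp only [Nat.add_sub_cancel, Nat.cast_add, Nat.cast_one]; ring
  · have : |y| ≤ r := (abs_lt.2 hy).le
    rw [Real.norm_eq_abs, abs_mul, abs_mul, abs_mul, abs_pow]
    calc |c n| * (|(n : ℝ)| * |y| ^ (n - 1)) = |(n : ℝ)| * |c n| * |y| ^ (n - 1) := by ring
      _ ≤ |(n : ℝ)| * |c n| * r ^ (n - 1) := by gcongr

/-! ### Kummer's function -/

/-- The Taylor coefficients of `₁F₁(a+2; 3; x)`. -/
def kummerCoeff (a : ℝ) (n : ℕ) : ℝ :=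
  (ascPochhammer ℝ n).eval (a + 2) / (ascPochhammer ℝ n).eval 3 / n.factorial

lemma ascPochhammer_three_pos (n : ℕ) : 0 < (ascPochhammer ℝ n).eval 3 :=
  ascPochhammer_pos n 3 (by norm_num)

lemma kummerCoeff_succ (a : ℝ) (n : ℕ) :
    ((n : ℝ) + 1) * ((n : ℝ) + 3) * kummerCoeff a (n + 1) = (n + a + 2) * kummerCoeff a n := by
  have h := ascPochhammer_three_pos n
  have h3 : (0 : ℝ) < 3 + n := by positivity
  have hf : (0 : ℝ) < n.factorial := by exact_mod_cast n.factorial_pos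
  unfold kummerCoeff
  rw [ascPochhammer_succ_eval, ascPochhammer_succ_eval, Nat.factorial_succ]
  push_cast
  field_simp
  ring

lemma entireCoeff_kummerCoeff (a : ℝ) : EntireCoeff (kummerCoeff a) := by
  intro r hr
  refine summable_of_ratio_norm_eventually_le (r := 1 / 2) (by norm_num) ?_
  filter_upwards [eventually_ge_atTop ⌈2 * r * (1 + |a + 2|)⌉₊] with n hn
  have hn' : 2 * r * (1 + |a + 2|) ≤ n := Nat.ceil_le.1 hn
  have h1 := kummerCoeff_succ a n
  have h2 : |kummerCoeff a (n + 1)| * (((n : ℝ) + 1) * ((n : ℝ) + 3))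
      = |n + a + 2| * |kummerCoeff a n| := by
    rw [← abs_mul, ← h1, abs_mul, mul_comm,
      abs_of_nonneg (by positivity : (0 : ℝ) ≤ ((n : ℝ) + 1) * ((n : ℝ) + 3))]
  have h3 : |n + a + 2| ≤ (n + 1) * (1 + |a + 2|) := by
    have := abs_add_le (n : ℝ) (a + 2)
    rw [← add_assoc, Nat.abs_cast] at this
    nlinarith [abs_nonneg (a + 2), (Nat.cast_nonneg n : (0 : ℝ) ≤ n)]
  have hn0 : (0 : ℝ) ≤ n := Nat.cast_nonneg n
  simp only [norm_mul, norm_pow, Real.norm_eq_abs, abs_abs, abs_of_nonneg hr, pow_succ]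
  have key : |kummerCoeff a (n + 1)| * r ≤ 1 / 2 * |kummerCoeff a n| := by
    have hpos : (0 : ℝ) < ((n : ℝ) + 1) * ((n : ℝ) + 3) := by positivity
    refine le_of_mul_le_mul_right ?_ hpos
    calc |kummerCoeff a (n + 1)| * r * (((n : ℝ) + 1) * ((n : ℝ) + 3))
        = |n + a + 2| * |kummerCoeff a n| * r := by rw [← h2]; ring
      _ ≤ (n + 1) * (1 + |a + 2|) * |kummerCoeff a n| * r := by gcongr
      _ = |kummerCoeff a n| * ((n + 1) * (r * (1 + |a + 2|))) := by ring
      _ ≤ |kummerCoeff a n| * ((n + 1) * ((n + 3) / 2)) := by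
          gcongr; linarith
      _ = 1 / 2 * |kummerCoeff a n| * (((n : ℝ) + 1) * ((n : ℝ) + 3)) := by ring
  calc |kummerCoeff a (n + 1)| * (r ^ n * r) = |kummerCoeff a (n + 1)| * r * r ^ n := by ring
    _ ≤ 1 / 2 * |kummerCoeff a n| * r ^ n := by gcongr
    _ = 1 / 2 * (|kummerCoeff a n| * r ^ n) := by ring

/-- `₁F₁(a+2; 3; x)` at real arguments. -/
def kummerR (a x : ℝ) : ℝ := ∑' n, kummerCoeff a n * x ^ n

/-- The derivative of `kummerR a`. -/
def kummerR' (a x : ℝ) : ℝ := ∑' n : ℕ, ((n : ℝ) + 1) * kummerCoeff a (n + 1) * x ^ n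

lemma kummer_ofReal (a x : ℝ) : kummer ((a : ℂ) + 2) 3 x = kummerR a x := by
  unfold kummer kummerR
  rw [Complex.ofReal_tsum]
  refine tsum_congr fun n => ?_
  have e1 : (ascPochhammer ℂ n).eval ((a : ℂ) + 2) = (((ascPochhammer ℝ n).eval (a + 2) : ℝ) : ℂ) := by
    rw [← ascPochhammer_map Complex.ofRealHom, Polynomial.eval_map,
      show ((a : ℂ) + 2) = Complex.ofRealHom (a + 2) by simp, Polynomial.eval₂_at_apply]
    rfl
  have e2 : (ascPochhammer ℂ n).eval (3 : ℂ) = (((ascPochhammer ℝ n).eval 3 : ℝ) : ℂ) := by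
    rw [← ascPochhammer_map Complex.ofRealHom, Polynomial.eval_map,
      show (3 : ℂ) = Complex.ofRealHom 3 by simp, Polynomial.eval₂_at_apply]
    rfl
  rw [e1, e2, kummerCoeff]
  push_cast
  ring

lemma hasDerivAt_kummerR (a x : ℝ) : HasDerivAt (kummerR a) (kummerR' a x) x :=
  (entireCoeff_kummerCoeff a).hasDerivAt x

/-- Kummer's equation `x M'' = (x - 3) M' + (a + 2) M` for `M = ₁F₁(a+2; 3; x)`. -/
lemma hasDerivAt_kummerR' (a : ℝ) {x : ℝ} (hx : 0 < x) :
    HasDerivAt (kummerR' a) (((x - 3) * kummerR' a x + (a + 2) * kummerR a x) / x) x := by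
  have hc := entireCoeff_kummerCoeff a
  have h := hc.deriv.hasDerivAt x
  refine h.congr_deriv ?_
  rw [eq_div_iff hx.ne']
  unfold kummerR kummerR'
  have s0 := hc.summable x
  have s1 := hc.deriv.summable x
  have s2 := hc.deriv.deriv.summable x
  -- the series of `x M''` and of `x M'`, with the powers of `x` aligned
  have e2 : HasSum (fun n : ℕ => (n : ℝ) * (((n : ℝ) + 1) * kummerCoeff a (n + 1)) * x ^ n)
      ((∑' n : ℕ, ((n : ℝ) + 1) * ((((n + 1 : ℕ) : ℝ) + 1) * kummerCoeff a (n + 1 + 1)) * x ^ n)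
        * x) := by
    rw [← hasSum_nat_add_iff' 1]
    simp only [Finset.range_one, Finset.sum_singleton, Nat.cast_zero, zero_mul, sub_zero]
    refine (s2.hasSum.mul_right x).congr_fun fun n => ?_
    push_cast; ring
  have e1 : HasSum (fun n : ℕ => (n : ℝ) * kummerCoeff a n * x ^ n)
      ((∑' n : ℕ, ((n : ℝ) + 1) * kummerCoeff a (n + 1) * x ^ n) * x) := by
    rw [← hasSum_nat_add_iff' 1]
    simp only [Finset.range_one, Finset.sum_singleton, Nat.cast_zero, zero_mul, sub_zero]
    refine (s1.hasSum.mul_right x).congr_fun fun n => ?_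
    push_cast; ring
  have t := ((e1.add (s1.hasSum.mul_left (-3))).add (s0.hasSum.mul_left (a + 2)))
  have e3 := e2.unique (t.congr_fun fun n => by
    linear_combination (x ^ n) * kummerCoeff_succ a n)
  rw [e3]
  ring

lemma kummerCoeff_pos {a : ℝ} (ha : -2 < a) (n : ℕ) : 0 < kummerCoeff a n := by
  unfold kummerCoeff
  have h1 := ascPochhammer_pos (S := ℝ) n (a + 2) (by linarith)
  have h2 := ascPochhammer_three_pos n
  have hf : (0 : ℝ) < n.factorial := by exact_mod_cast n.factorial_pos
  positivity

lemma kummerR_pos {a : ℝ} (ha : -2 < a) {x : ℝ} (hx : 0 ≤ x) : 0 < kummerR a x := by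
  refine ((entireCoeff_kummerCoeff a).summable x).tsum_pos
    (fun n => mul_nonneg (kummerCoeff_pos ha n).le (pow_nonneg hx n)) 0 ?_
  simpa using kummerCoeff_pos ha 0

lemma kummerR_zero (a : ℝ) : kummerR a 0 = 1 := by
  unfold kummerR
  rw [tsum_eq_single 0 fun n hn => by simp [hn]]
  simp [kummerCoeff]

lemma continuous_kummerR (a : ℝ) : Continuous (kummerR a) :=
  continuous_iff_continuousAt.2 fun x => (hasDerivAt_kummerR a x).continuousAt

/-! ### The linear equation -/

/-- `f` solves Kummer's equation `x f'' = (1 + x) f' + a f` (second parameter `b = -1`) on the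
positive half line, and `f'` is its derivative. -/
structure KummerSol (a : ℝ) (f f' : ℝ → ℂ) : Prop where
  hd : ∀ x : ℝ, 0 < x → HasDerivAt f (f' x) x
  hd' : ∀ x : ℝ, 0 < x → HasDerivAt f' (((1 + x) * f' x + a * f x) / x) x

lemma KummerSol.add {a : ℝ} {f f' g g' : ℝ → ℂ} (hf : KummerSol a f f') (hg : KummerSol a g g') :
    KummerSol a (fun x => f x + g x) (fun x => f' x + g' x) where
  hd x hx := (hf.hd x hx).add (hg.hd x hx)
  hd' x hx := ((hf.hd' x hx).add (hg.hd' x hx)).congr_deriv (by ring)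

lemma KummerSol.const_mul {a : ℝ} {f f' : ℝ → ℂ} (hf : KummerSol a f f') (c : ℂ) :
    KummerSol a (fun x => c * f x) (fun x => c * f' x) where
  hd x hx := (hf.hd x hx).const_mul c
  hd' x hx := ((hf.hd' x hx).const_mul c).congr_deriv (by ring)

lemma KummerSol.ofReal {a : ℝ} {f f' : ℝ → ℝ} (h : ∀ x : ℝ, 0 < x → HasDerivAt f (f' x) x)
    (h' : ∀ x : ℝ, 0 < x → HasDerivAt f' (((1 + x) * f' x + a * f x) / x) x) :
    KummerSol a (fun x => (f x : ℂ)) (fun x => (f' x : ℂ)) where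
  hd x hx := (h x hx).ofReal_comp
  hd' x hx := (h' x hx).ofReal_comp.congr_deriv (by push_cast; ring)

/-- `S(x) = x² ₁F₁(a+2; 3; x)`, the solution with exponent `2` at the origin. -/
def solS (a x : ℝ) : ℝ := x ^ 2 * kummerR a x

/-- The derivative of `solS a`. -/
def solS' (a x : ℝ) : ℝ := 2 * x * kummerR a x + x ^ 2 * kummerR' a x

lemma hasDerivAt_solS (a x : ℝ) : HasDerivAt (solS a) (solS' a x) x :=
  ((hasDerivAt_pow 2 x).mul (hasDerivAt_kummerR a x)).congr_deriv (by simp [solS'])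

lemma hasDerivAt_solS' (a : ℝ) {x : ℝ} (hx : 0 < x) :
    HasDerivAt (solS' a) (((1 + x) * solS' a x + a * solS a x) / x) x := by
  have h1 := (((hasDerivAt_id x).const_mul 2).mul (hasDerivAt_kummerR a x)).add
    ((hasDerivAt_pow 2 x).mul (hasDerivAt_kummerR' a hx))
  refine h1.congr_deriv ?_
  simp only [solS', solS, id]
  field_simp
  ring

lemma kummerSol_solS (a : ℝ) : KummerSol a (fun x => (solS a x : ℂ)) (fun x => (solS' a x : ℂ)) :=
  KummerSol.ofReal (fun x _ => hasDerivAt_solS a x) fun _ hx => hasDerivAt_solS' a hx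

lemma solS_pos {a : ℝ} (ha : -2 < a) {x : ℝ} (hx : 0 < x) : 0 < solS a x :=
  mul_pos (by positivity) (kummerR_pos ha hx.le)

lemma exists_eq_const_of_hasDerivAt_zero {f : ℝ → ℂ} (h : ∀ x : ℝ, 0 < x → HasDerivAt f 0 x) :
    ∃ c, ∀ x : ℝ, 0 < x → f x = c :=
  isOpen_Ioi.exists_is_const_of_deriv_eq_zero (isPreconnected_Ioi (a := (0 : ℝ)))
    (fun x hx => (h x hx).differentiableAt.differentiableWithinAt) fun x hx => (h x hx).deriv

/-- Abel's formula: the Wronskian of two solutions is a multiple of `x eˣ`. -/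
lemma KummerSol.wronskian {a : ℝ} {f f' g g' : ℝ → ℂ} (hf : KummerSol a f f')
    (hg : KummerSol a g g') :
    ∃ C : ℂ, ∀ x : ℝ, 0 < x → f x * g' x - f' x * g x = C * (x * Real.exp x : ℝ) := by
  obtain ⟨C, hC⟩ := exists_eq_const_of_hasDerivAt_zero
    (f := fun x => (f x * g' x - f' x * g x) / (x * Real.exp x : ℝ)) fun x hx => by
      have hE : HasDerivAt (fun x : ℝ => ((x * Real.exp x : ℝ) : ℂ))
          ((1 * Real.exp x + x * Real.exp x : ℝ) : ℂ) x :=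
        ((hasDerivAt_id x).mul (Real.hasDerivAt_exp x)).ofReal_comp
      have hne : ((x * Real.exp x : ℝ) : ℂ) ≠ 0 := by
        exact_mod_cast (mul_pos hx (Real.exp_pos x)).ne'
      have h := (((hf.hd x hx).mul (hg.hd' x hx)).sub ((hf.hd' x hx).mul (hg.hd x hx))).fun_div hE hne
      refine h.congr_deriv ?_
      have hx' : (x : ℂ) ≠ 0 := by exact_mod_cast hx.ne'
      have he : (Real.exp x : ℂ) ≠ 0 := by exact_mod_cast (Real.exp_pos x).ne'
      simp only [Pi.mul_apply, Pi.sub_apply]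
      push_cast at *
      field_simp
      ring
  refine ⟨C, fun x hx => ?_⟩
  have hne : ((x * Real.exp x : ℝ) : ℂ) ≠ 0 := by
    exact_mod_cast (mul_pos hx (Real.exp_pos x)).ne'
  exact (div_eq_iff hne).1 (hC x hx)

/-- A solution that is `o(x²)` at the origin vanishes. For `h = F / S` Abel's formula gives
`h' = C x eˣ / S² ∼ C x⁻³`, so `h` is unbounded at `0` unless `C = 0`. -/
lemma KummerSol.eq_zero_of_isLittleO {a : ℝ} (ha : -2 < a) {F F' : ℝ → ℂ} (hF : KummerSol a F F')
    (h0 : Tendsto (fun x : ℝ => F x / (x : ℂ) ^ 2) (𝓝[>] 0) (𝓝 0)) {x : ℝ} (hx : 0 < x) :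
    F x = 0 := by
  obtain ⟨C, hC⟩ := (kummerSol_solS a).wronskian hF
  have hSne : ∀ {x : ℝ}, 0 < x → (solS a x : ℂ) ≠ 0 := fun hx => by
    exact_mod_cast (solS_pos ha hx).ne'
  have hh : ∀ x : ℝ, 0 < x → HasDerivAt (fun x => F x / (solS a x : ℂ))
      (C * (x * Real.exp x / solS a x ^ 2 : ℝ)) x := fun x hx => by
    refine ((hF.hd x hx).fun_div (hasDerivAt_solS a x).ofReal_comp (hSne hx)).congr_deriv ?_
    have := hC x hx
    push_cast at this ⊢
    rw [← mul_div_assoc, ← this]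
    ring
  have hlim : Tendsto (fun x => F x / (solS a x : ℂ)) (𝓝[>] 0) (𝓝 0) := by
    have hM : Tendsto (fun x : ℝ => (kummerR a x : ℂ)) (𝓝[>] 0) (𝓝 1) := by
      have := (continuous_kummerR a).tendsto 0
      rw [kummerR_zero] at this
      have h2 := (Complex.continuous_ofReal.tendsto 1).comp this
      rw [Complex.ofReal_one] at h2
      exact h2.mono_left nhdsWithin_le_nhds
    have := h0.div hM one_ne_zero
    rw [zero_div] at this
    refine this.congr fun x => ?_
    simp [solS, div_div]
  have hC0 : C = 0 := by
    by_contra hC0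
    obtain ⟨B, hB⟩ := (isCompact_Icc (a := (0 : ℝ)) (b := 1)).bddAbove_image
      (continuous_kummerR a).continuousOn
    have hB' : ∀ x ∈ Icc (0 : ℝ) 1, kummerR a x ≤ B := fun x hx => hB (mem_image_of_mem _ hx)
    have hB0 : 0 < B := (kummerR_pos ha le_rfl).trans_le (hB' 0 (by simp))
    set k : ℝ := Complex.normSq C / B ^ 2 with hk
    have hk0 : 0 < k := div_pos (Complex.normSq_pos.2 hC0) (by positivity)
    -- the component of `h` along `C` has slope at least `k x⁻³`, hence tends to `-∞` at the origin
    set φ : ℝ → ℝ := fun x => ((starRingEnd ℂ C) * (F x / (solS a x : ℂ))).re with hφ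
    have hφd : ∀ x : ℝ, 0 < x → HasDerivAt φ
        (Complex.normSq C * (x * Real.exp x / solS a x ^ 2)) x := fun x hx => by
      have h1 := (hh x hx).const_mul (starRingEnd ℂ C)
      have h2 := Complex.reCLM.hasFDerivAt.comp_hasDerivAt x h1
      refine h2.congr_deriv ?_
      rw [← mul_assoc, mul_comm (starRingEnd ℂ C) C, Complex.mul_conj]
      rw [← Complex.ofReal_mul, Complex.reCLM_apply, Complex.ofReal_re]
    have hφlim : Tendsto φ (𝓝[>] 0) (𝓝 0) := by
      have := (Complex.continuous_re.tendsto _).comp (hlim.const_mul (starRingEnd ℂ C))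
      rwa [mul_zero, Complex.zero_re] at this
    -- the monotone function is `φ + (k/2) x⁻²`
    have hmono : MonotoneOn (fun x => φ x - k / 2 * (x ^ 2)⁻¹ * (-1)) (Ioc 0 1) := by
      refine monotoneOn_of_hasDerivWithinAt_nonneg (f' := fun x =>
        Complex.normSq C * (x * Real.exp x / solS a x ^ 2) -
          k / 2 * (-(2 * x) / (x ^ 2) ^ 2) * (-1)) (convex_Ioc 0 1) ?_ ?_ ?_
      · intro x hx
        have hx2 : x ^ 2 ≠ 0 := pow_ne_zero _ hx.1.ne'
        exact ((hφd x hx.1).continuousAt.sub (by fun_prop (disch := assumption))).continuousWithinAt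
      · intro x hx
        rw [interior_Ioc] at hx
        have h3 : HasDerivAt (fun x : ℝ => (x ^ 2)⁻¹) (-(2 * x) / (x ^ 2) ^ 2) x := by
          simpa using (hasDerivAt_pow 2 x).fun_inv (pow_ne_zero _ hx.1.ne')
        exact ((hφd x hx.1).sub ((h3.const_mul (k / 2)).mul_const (-1))).hasDerivWithinAt
      · intro x hx
        rw [interior_Ioc] at hx
        have hx0 := hx.1
        have hMp := kummerR_pos ha hx0.le
        have hMB := hB' x ⟨hx0.le, hx.2.le⟩
        have e1 : k / 2 * (-(2 * x) / (x ^ 2) ^ 2) * (-1) = Complex.normSq C * (x / (x ^ 2 * B) ^ 2) := by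
          rw [hk]; field_simp
        have e2 : x / (x ^ 2 * B) ^ 2 ≤ x * Real.exp x / solS a x ^ 2 := by
          have h1 : x ≤ x * Real.exp x := by nlinarith [Real.add_one_le_exp x]
          have h2 : solS a x ≤ x ^ 2 * B := mul_le_mul_of_nonneg_left hMB (by positivity)
          have h3 := solS_pos ha hx0
          gcongr
        rw [e1, sub_nonneg]
        exact mul_le_mul_of_nonneg_left e2 (Complex.normSq_nonneg _)
    have hinv : Tendsto (fun x : ℝ => (x ^ 2)⁻¹) (𝓝[>] 0) atTop := by
      have h1 : Tendsto (fun x : ℝ => x ^ 2) (𝓝[>] 0) (𝓝[>] 0) := by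
        refine tendsto_nhdsWithin_iff.2 ⟨?_, ?_⟩
        · have : Tendsto (fun x : ℝ => x ^ 2) (𝓝 0) (𝓝 (0 ^ 2)) := (continuous_pow 2).tendsto 0
          rw [zero_pow two_ne_zero] at this
          exact this.mono_left nhdsWithin_le_nhds
        · filter_upwards [self_mem_nhdsWithin] with x hx
          exact pow_pos (mem_Ioi.1 hx) 2
      exact tendsto_inv_nhdsGT_zero.comp h1
    have hbig : Tendsto (fun x => φ x - k / 2 * (x ^ 2)⁻¹ * (-1)) (𝓝[>] 0) atTop := by
      have : Tendsto (fun x : ℝ => k / 2 * (x ^ 2)⁻¹) (𝓝[>] 0) atTop :=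
        hinv.const_mul_atTop (by positivity)
      refine (hφlim.add_atTop this).congr fun x => by ring
    have h1 := hbig.eventually_gt_atTop (φ 1 - k / 2 * ((1 : ℝ) ^ 2)⁻¹ * (-1))
    have h2 : Ioc (0 : ℝ) 1 ∈ 𝓝[>] (0 : ℝ) := Ioc_mem_nhdsGT one_pos
    obtain ⟨y, hy, hy'⟩ := (h1.and h2).exists
    exact absurd (hmono hy' (by simp) hy'.2) (not_le.2 hy)
  obtain ⟨c, hc⟩ := exists_eq_const_of_hasDerivAt_zero fun x hx => by
    simpa [hC0] using hh x hx
  have hc0 : c = 0 := by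
    refine tendsto_nhds_unique ?_ hlim
    refine tendsto_const_nhds.congr' ?_
    filter_upwards [self_mem_nhdsWithin] with x hx
    exact (hc x hx).symm
  have := hc x hx
  rw [hc0, div_eq_zero_iff] at this
  exact this.resolve_right (hSne hx)

/-! ### Loop integrals -/

/-- The integral along the loop that comes in from `+∞` on `Im s = -1`, goes up the segment
`Re s = σ` and returns to `+∞` on `Im s = 1`. -/
def loopInt (σ : ℝ) (f : ℂ → ℂ) : ℂ :=
  (∫ t in Ioi σ, (f ((t : ℂ) + Complex.I) - f ((t : ℂ) - Complex.I)))
    + Complex.I * ∫ y in (-1 : ℝ)..1, f ((σ : ℂ) + Complex.I * y)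

/-- The integral of `f` around the boundary of `[σ₁, σ₂] × [-1, 1]`, counterclockwise. -/
def rectInt (σ₁ σ₂ : ℝ) (f : ℂ → ℂ) : ℂ :=
  (∫ t in σ₁..σ₂, (f ((t : ℂ) - Complex.I) - f ((t : ℂ) + Complex.I)))
    + Complex.I * ((∫ y in (-1 : ℝ)..1, f ((σ₂ : ℂ) + Complex.I * y))
      - ∫ y in (-1 : ℝ)..1, f ((σ₁ : ℂ) + Complex.I * y))

/-- Moving the left edge of the loop costs a rectangle. -/
lemma loopInt_sub_loopInt {f : ℂ → ℂ} {σ₁ σ₂ : ℝ} (h : σ₁ ≤ σ₂)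
    (hf : IntegrableOn (fun t : ℝ => f ((t : ℂ) + Complex.I) - f ((t : ℂ) - Complex.I)) (Ioi σ₁)) :
    loopInt σ₁ f - loopInt σ₂ f = -rectInt σ₁ σ₂ f := by
  have h1 := intervalIntegral.integral_interval_add_Ioi
    (f := fun t : ℝ => f ((t : ℂ) + Complex.I) - f ((t : ℂ) - Complex.I)) (b := σ₂) hf
    (hf.mono_set (Ioi_subset_Ioi h))
  have h2 : ∫ t in σ₁..σ₂, (f ((t : ℂ) - Complex.I) - f ((t : ℂ) + Complex.I))
      = -∫ t in σ₁..σ₂, (f ((t : ℂ) + Complex.I) - f ((t : ℂ) - Complex.I)) := by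
    rw [← intervalIntegral.integral_neg]
    refine intervalIntegral.integral_congr fun t _ => ?_
    ring
  unfold loopInt rectInt
  rw [← h1, h2]
  ring

lemma rectInt_eq_zero {f : ℂ → ℂ} {σ₁ σ₂ : ℝ} (h : σ₁ ≤ σ₂)
    (hf : DifferentiableOn ℂ f (Icc σ₁ σ₂ ×ℂ Icc (-1) 1)) : rectInt σ₁ σ₂ f = 0 := by
  have h1 := Complex.integral_boundary_rect_eq_zero_of_differentiableOn f
    ⟨σ₁, -1⟩ ⟨σ₂, 1⟩ (by simpa [uIcc_of_le h] using hf)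
  simp only [Complex.ofReal_neg, Complex.ofReal_one, one_mul, neg_mul, smul_eq_mul] at h1
  have hc : ∀ (x : ℝ), |x| = 1 → IntervalIntegrable (fun t : ℝ => f ((t : ℂ) + x * Complex.I))
      volume σ₁ σ₂ := by
    intro x hx
    refine ContinuousOn.intervalIntegrable ?_
    rw [uIcc_of_le h]
    refine hf.continuousOn.comp (by fun_prop) fun t ht => ?_
    rw [Complex.mem_reProdIm]
    simp only [Complex.add_re, Complex.add_im, Complex.ofReal_re, Complex.ofReal_im,
      Complex.mul_re, Complex.mul_im, Complex.I_re, Complex.I_im, mul_zero, mul_one,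
      add_zero, zero_add, sub_zero]
    exact ⟨ht, abs_le.1 hx.le⟩
  have i1 := hc 1 (by simp)
  have i2 := hc (-1) (by simp)
  simp only [Complex.ofReal_neg, Complex.ofReal_one, one_mul, neg_mul] at i1 i2
  unfold rectInt
  simp only [sub_eq_add_neg] at h1 ⊢
  have e : ∫ t in σ₁..σ₂, (f ((t : ℂ) + -Complex.I) + -f ((t : ℂ) + Complex.I))
      = (∫ t in σ₁..σ₂, f ((t : ℂ) + -Complex.I)) + -∫ t in σ₁..σ₂, f ((t : ℂ) + Complex.I) := by
    simpa only [sub_eq_add_neg] using intervalIntegral.integral_sub i2 i1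
  rw [e]
  simp only [mul_comm Complex.I ((_ : ℝ) : ℂ)]
  linear_combination h1

lemma setIntegral_Ioi_comp_add (f : ℝ → ℂ) (σ m : ℝ) :
    ∫ t in Ioi σ, f (t + m) = ∫ t in Ioi (σ + m), f t := by
  have h := (measurePreserving_add_right volume m).setIntegral_preimage_emb
    (measurableEmbedding_addRight m) f (Ioi (σ + m))
  rw [← h]
  congr 2
  ext t
  simp

lemma loopInt_comp_add (f : ℂ → ℂ) (σ m : ℝ) :
    loopInt σ (fun s => f (s + m)) = loopInt (σ + m) f := by
  unfold loopInt
  have h := setIntegral_Ioi_comp_add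
    (fun t : ℝ => f ((t : ℂ) + Complex.I) - f ((t : ℂ) - Complex.I)) σ m
  rw [← h]
  congr 1
  · refine integral_congr_ae (Eventually.of_forall fun t => ?_)
    simp only [Complex.ofReal_add]
    congr 2 <;> ring
  · congr 1
    refine intervalIntegral.integral_congr fun y _ => ?_
    simp only [Complex.ofReal_add]
    congr 1; ring

lemma loopInt_const_mul (c : ℂ) (σ : ℝ) (f : ℂ → ℂ) :
    loopInt σ (fun s => c * f s) = c * loopInt σ f := by
  unfold loopInt
  simp only [← mul_sub]
  rw [integral_const_mul, intervalIntegral.integral_const_mul]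
  ring

lemma rectInt_comp_add (f : ℂ → ℂ) (σ₁ σ₂ m : ℝ) :
    rectInt σ₁ σ₂ (fun s => f (s + m)) = rectInt (σ₁ + m) (σ₂ + m) f := by
  unfold rectInt
  rw [← intervalIntegral.integral_comp_add_right
    (fun t : ℝ => f ((t : ℂ) - Complex.I) - f ((t : ℂ) + Complex.I)) m]
  congr 1
  · refine intervalIntegral.integral_congr fun t _ => ?_
    simp only [Complex.ofReal_add]
    congr 2 <;> ring
  · congr 2 <;>
    · refine intervalIntegral.integral_congr fun y _ => ?_
      simp only [Complex.ofReal_add]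
      congr 1; ring

/-! ### The residue of a double pole -/

lemma rectInt_inv_sq : rectInt (-1 / 2) (1 / 2) (fun s => (s ^ 2)⁻¹) = 0 := by
  unfold rectInt
  have i : ∀ c : ℂ, c = Complex.I ∨ c = -Complex.I →
      IntervalIntegrable (fun t : ℝ => (((t : ℂ) + c) ^ 2)⁻¹) volume (-1 / 2) (1 / 2) := by
    intro c hc
    refine Continuous.intervalIntegrable (continuous_iff_continuousAt.2 fun t => ?_) _ _
    refine ContinuousAt.inv₀ (by fun_prop) (pow_ne_zero _ fun h => ?_)
    have := congrArg Complex.im h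
    rcases hc with rfl | rfl <;> simp at this
  have e1 : ∫ t in (-1 / 2 : ℝ)..1 / 2, (((t : ℂ) + -Complex.I) ^ 2)⁻¹
      = ∫ t in (-1 / 2 : ℝ)..1 / 2, (((t : ℂ) + Complex.I) ^ 2)⁻¹ := by
    have := intervalIntegral.integral_comp_neg (a := (-1 / 2 : ℝ)) (b := 1 / 2)
      (fun t : ℝ => (((t : ℂ) + Complex.I) ^ 2)⁻¹)
    rw [show -(1 / 2 : ℝ) = -1 / 2 by norm_num, show -(-1 / 2 : ℝ) = 1 / 2 by norm_num] at this
    rw [← this]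
    refine intervalIntegral.integral_congr fun t _ => ?_
    push_cast
    congr 1; ring
  have e2 : ∫ y in (-1 : ℝ)..1, ((((-1 / 2 : ℝ) : ℂ) + Complex.I * y) ^ 2)⁻¹
      = ∫ y in (-1 : ℝ)..1, ((((1 / 2 : ℝ) : ℂ) + Complex.I * y) ^ 2)⁻¹ := by
    have := intervalIntegral.integral_comp_neg (a := (-1 : ℝ)) (b := 1)
      (fun y : ℝ => ((((1 / 2 : ℝ) : ℂ) + Complex.I * y) ^ 2)⁻¹)
    rw [neg_neg] at this
    rw [← this]
    refine intervalIntegral.integral_congr fun t _ => ?_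
    push_cast
    congr 1; ring
  simp only [sub_eq_add_neg]
  rw [e2, add_neg_cancel, mul_zero, add_zero]
  have := intervalIntegral.integral_sub (i _ (Or.inr rfl)) (i _ (Or.inl rfl))
  simp only [sub_eq_add_neg] at this
  rw [this, e1, add_neg_cancel]

/-- The residue of `1/s`; the horizontal and vertical edges contribute multiples of `arctan (1/2)`
and `arctan 2`, which add up to `π/2`. -/
lemma rectInt_inv : rectInt (-1 / 2) (1 / 2) (fun s => s⁻¹) = 2 * Real.pi * Complex.I := by
  unfold rectInt
  have e1 : ∫ t in (-1 / 2 : ℝ)..1 / 2, (((t : ℂ) - Complex.I)⁻¹ - ((t : ℂ) + Complex.I)⁻¹)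
      = 2 * Complex.I * (2 * Real.arctan (1 / 2) : ℝ) := by
    have : ∫ t in (-1 / 2 : ℝ)..1 / 2, (((t : ℂ) - Complex.I)⁻¹ - ((t : ℂ) + Complex.I)⁻¹)
        = ∫ t in (-1 / 2 : ℝ)..1 / 2, 2 * Complex.I * (((1 + t ^ 2)⁻¹ : ℝ) : ℂ) := by
      refine intervalIntegral.integral_congr fun t _ => ?_
      have h1 : (t : ℂ) - Complex.I ≠ 0 := fun h => by simpa using congrArg Complex.im h
      have h2 : (t : ℂ) + Complex.I ≠ 0 := fun h => by simpa using congrArg Complex.im h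
      have h3 : ((t : ℂ) - Complex.I) * (t + Complex.I) = 1 + t ^ 2 := by
        ring_nf; simp; ring
      have h4 : (1 : ℂ) + t ^ 2 ≠ 0 := by rw [← h3]; exact mul_ne_zero h1 h2
      push_cast
      rw [inv_sub_inv h1 h2, h3]
      ring
    rw [this, intervalIntegral.integral_const_mul, intervalIntegral.integral_ofReal,
      integral_inv_one_add_sq]
    congr 2
    rw [show (-1 / 2 : ℝ) = -(1 / 2) by norm_num, Real.arctan_neg]
    ring
  have e2 : (∫ y in (-1 : ℝ)..1, (((1 / 2 : ℝ) : ℂ) + Complex.I * y)⁻¹)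
      - ∫ y in (-1 : ℝ)..1, (((-1 / 2 : ℝ) : ℂ) + Complex.I * y)⁻¹
      = (4 * Real.arctan 2 : ℝ) := by
    have i : ∀ c : ℝ, c ≠ 0 →
        IntervalIntegrable (fun y : ℝ => ((c : ℂ) + Complex.I * y)⁻¹) volume (-1) 1 := by
      intro c hc
      refine Continuous.intervalIntegrable (continuous_iff_continuousAt.2 fun t => ?_) _ _
      refine ContinuousAt.inv₀ (by fun_prop) fun h => hc ?_
      simpa using congrArg Complex.re h
    rw [← intervalIntegral.integral_sub (i _ (by norm_num)) (i _ (by norm_num))]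
    have : ∫ y in (-1 : ℝ)..1, ((((1 / 2 : ℝ) : ℂ) + Complex.I * y)⁻¹
          - (((-1 / 2 : ℝ) : ℂ) + Complex.I * y)⁻¹)
        = ∫ y in (-1 : ℝ)..1, ((4 * (1 + (2 * y) ^ 2)⁻¹ : ℝ) : ℂ) := by
      refine intervalIntegral.integral_congr fun y _ => ?_
      have h1 : ((1 / 2 : ℝ) : ℂ) + Complex.I * y ≠ 0 := fun h => by
        simpa using congrArg Complex.re h
      have h2 : ((-1 / 2 : ℝ) : ℂ) + Complex.I * y ≠ 0 := fun h => by
        simpa using congrArg Complex.re h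
      have h3 : (((1 / 2 : ℝ) : ℂ) + Complex.I * y) * (((-1 / 2 : ℝ) : ℂ) + Complex.I * y)
          = -(1 + (2 * y) ^ 2) / 4 := by
        push_cast; ring_nf; simp; ring
      have h4 : (1 : ℂ) + (2 * y) ^ 2 ≠ 0 := by
        intro h
        rw [h] at h3
        simp only [neg_zero, zero_div] at h3
        exact mul_ne_zero h1 h2 h3
      rw [inv_sub_inv h1 h2, h3]
      push_cast
      field_simp
      ring
    rw [this, intervalIntegral.integral_ofReal, intervalIntegral.integral_const_mul,
      intervalIntegral.integral_comp_mul_left (fun u : ℝ => (1 + u ^ 2)⁻¹) two_ne_zero,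
      integral_inv_one_add_sq]
    congr 1
    rw [show (2 * -1 : ℝ) = -2 by norm_num, Real.arctan_neg, smul_eq_mul, mul_one]
    ring
  rw [e1, e2]
  have h := Real.arctan_inv_of_pos (two_pos (α := ℝ))
  rw [one_div, h]
  push_cast
  ring

lemma intervalIntegrable_horizontal {f : ℂ → ℂ} {σ₁ σ₂ : ℝ} {c : ℂ}
    (hc : ∀ t ∈ uIcc σ₁ σ₂, ContinuousAt f ((t : ℂ) + c)) :
    IntervalIntegrable (fun t : ℝ => f ((t : ℂ) + c)) volume σ₁ σ₂ :=
  ContinuousOn.intervalIntegrable fun t ht =>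
    (ContinuousAt.comp (f := fun t : ℝ => (t : ℂ) + c) (hc t ht) (by fun_prop)).continuousWithinAt

/-- The rectangle `[-1/2, 1/2] × [-1, 1]` punctured at the origin. -/
def puncturedRect : Set ℂ := {s | |s.re| ≤ 1 / 2 ∧ |s.im| ≤ 1 ∧ s ≠ 0}

lemma rectInt_add {f g : ℂ → ℂ} (hf : ∀ s ∈ puncturedRect, ContinuousAt f s)
    (hg : ∀ s ∈ puncturedRect, ContinuousAt g s) :
    rectInt (-1 / 2) (1 / 2) (fun s => f s + g s)
      = rectInt (-1 / 2) (1 / 2) f + rectInt (-1 / 2) (1 / 2) g := by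
  have hH : ∀ {f : ℂ → ℂ}, (∀ s ∈ puncturedRect, ContinuousAt f s) →
      IntervalIntegrable (fun t : ℝ => f ((t : ℂ) - Complex.I) - f ((t : ℂ) + Complex.I)) volume
        (-1 / 2) (1 / 2) := by
    intro f hf
    have ha : ∀ t : ℝ, t ∈ uIcc (-1 / 2 : ℝ) (1 / 2) → |t| ≤ 1 / 2 := fun t ht => by
      rw [uIcc_of_le (by norm_num)] at ht
      exact abs_le.2 ⟨by linarith [ht.1], ht.2⟩
    refine IntervalIntegrable.sub ?_ ?_
    · simp only [sub_eq_add_neg]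
      exact intervalIntegrable_horizontal fun t ht => hf _ ⟨by simpa using ha t ht, by simp,
        fun h => by simpa using congrArg Complex.im h⟩
    · exact intervalIntegrable_horizontal fun t ht => hf _ ⟨by simpa using ha t ht, by simp,
        fun h => by simpa using congrArg Complex.im h⟩
  have hV : ∀ {f : ℂ → ℂ} (c : ℝ), |c| = 1 / 2 → (∀ s ∈ puncturedRect, ContinuousAt f s) →
      IntervalIntegrable (fun y : ℝ => f ((c : ℂ) + Complex.I * y)) volume (-1) 1 := by
    intro f c hc hf
    refine ContinuousOn.intervalIntegrable fun y hy => ?_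
    rw [uIcc_of_le (by norm_num)] at hy
    refine (ContinuousAt.comp (f := fun y : ℝ => (c : ℂ) + Complex.I * y) (hf _ ⟨?_, ?_, ?_⟩)
      (by fun_prop)).continuousWithinAt
    · simp [hc]
    · simpa using abs_le.2 ⟨hy.1, hy.2⟩
    · intro h
      have : c = 0 := by simpa using congrArg Complex.re h
      rw [this] at hc; norm_num at hc
  unfold rectInt
  have e : ∀ t : ℝ, f ((t : ℂ) - Complex.I) + g ((t : ℂ) - Complex.I)
      - (f ((t : ℂ) + Complex.I) + g ((t : ℂ) + Complex.I))
      = (f ((t : ℂ) - Complex.I) - f ((t : ℂ) + Complex.I))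
        + (g ((t : ℂ) - Complex.I) - g ((t : ℂ) + Complex.I)) := fun t => by ring
  simp only [e]
  rw [intervalIntegral.integral_add (hH hf) (hH hg),
    intervalIntegral.integral_add (hV (1 / 2) (by norm_num) hf) (hV (1 / 2) (by norm_num) hg),
    intervalIntegral.integral_add (hV (-1 / 2) (by rw [abs_of_neg] <;> norm_num) hf)
      (hV (-1 / 2) (by rw [abs_of_neg] <;> norm_num) hg)]
  ring

lemma rectInt_const_mul (c : ℂ) (f : ℂ → ℂ) (σ₁ σ₂ : ℝ) :
    rectInt σ₁ σ₂ (fun s => c * f s) = c * rectInt σ₁ σ₂ f := by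
  unfold rectInt
  simp only [← mul_sub, intervalIntegral.integral_const_mul]
  ring

lemma rectInt_congr {f g : ℂ → ℂ} (h : ∀ s ∈ puncturedRect, f s = g s) :
    rectInt (-1 / 2) (1 / 2) f = rectInt (-1 / 2) (1 / 2) g := by
  have ha : ∀ t : ℝ, t ∈ uIcc (-1 / 2 : ℝ) (1 / 2) → |t| ≤ 1 / 2 := fun t ht => by
    rw [uIcc_of_le (by norm_num)] at ht
    exact abs_le.2 ⟨by linarith [ht.1], ht.2⟩
  have hv : ∀ c : ℝ, |c| = 1 / 2 → ∀ y ∈ uIcc (-1 : ℝ) 1,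
      f ((c : ℂ) + Complex.I * y) = g ((c : ℂ) + Complex.I * y) := by
    intro c hc y hy
    rw [uIcc_of_le (by norm_num)] at hy
    refine h _ ⟨?_, ?_, ?_⟩
    · simp [hc]
    · simpa using abs_le.2 ⟨hy.1, hy.2⟩
    · intro h
      have : c = 0 := by simpa using congrArg Complex.re h
      rw [this] at hc; norm_num at hc
  unfold rectInt
  rw [intervalIntegral.integral_congr (hv (1 / 2) (by norm_num)),
    intervalIntegral.integral_congr (hv (-1 / 2) (by rw [abs_of_neg] <;> norm_num))]
  congr 1
  refine intervalIntegral.integral_congr fun t ht => ?_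
  rw [h _ ⟨by simpa using ha t ht, by simp, fun h => by simpa using congrArg Complex.im h⟩,
    h _ ⟨by simpa using ha t ht, by simp, fun h => by simpa using congrArg Complex.im h⟩]

/-- The open strip `|Re s| < 1`. -/
def strip : Set ℂ := {s | |s.re| < 1}

lemma isOpen_strip : IsOpen strip := isOpen_lt (by fun_prop) continuous_const

/-- Cauchy's formula for a double pole, from the expansion `ψ(s) = ψ(0) + ψ'(0) s + s² r(s)`. -/
lemma rectInt_div_sq {ψ : ℂ → ℂ} (hψ : DifferentiableOn ℂ ψ strip) :
    rectInt (-1 / 2) (1 / 2) (fun s => ψ s * (s ^ 2)⁻¹) = 2 * Real.pi * Complex.I * deriv ψ 0 := by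
  have h0 : strip ∈ 𝓝 (0 : ℂ) := isOpen_strip.mem_nhds (by simp [strip])
  set r := dslope (dslope ψ 0) 0 with hr
  have hrd : DifferentiableOn ℂ r strip :=
    (Complex.differentiableOn_dslope h0).2 ((Complex.differentiableOn_dslope h0).2 hψ)
  have hse : puncturedRect ⊆ strip := fun s hs => lt_of_le_of_lt hs.1 (by norm_num)
  have e : ∀ s ∈ puncturedRect, ψ s * (s ^ 2)⁻¹ = (ψ 0 * (s ^ 2)⁻¹ + deriv ψ 0 * s⁻¹) + r s := by
    intro s hs
    have hs0 : s ≠ 0 := hs.2.2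
    have h1 : s * dslope ψ 0 s = ψ s - ψ 0 := by
      simpa using sub_smul_dslope ψ 0 s
    have h2 : s * r s = dslope ψ 0 s - deriv ψ 0 := by
      have := sub_smul_dslope (dslope ψ 0) 0 s
      rw [dslope_same] at this
      simpa using this
    field_simp
    linear_combination (-1) * h1 - s * h2
  have c1 : ∀ s ∈ puncturedRect, ContinuousAt (fun s : ℂ => ψ 0 * (s ^ 2)⁻¹) s := fun s hs => by
    have := hs.2.2
    exact continuousAt_const.mul (ContinuousAt.inv₀ (by fun_prop) (pow_ne_zero _ this))
  have c2 : ∀ s ∈ puncturedRect, ContinuousAt (fun s : ℂ => deriv ψ 0 * s⁻¹) s := fun s hs =>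
    continuousAt_const.mul (continuousAt_inv₀ hs.2.2)
  have c3 : ∀ s ∈ puncturedRect, ContinuousAt r s := fun s hs =>
    (hrd.differentiableAt (isOpen_strip.mem_nhds (hse hs))).continuousAt
  rw [rectInt_congr e, rectInt_add (fun s hs => (c1 s hs).fun_add (c2 s hs)) c3, rectInt_add c1 c2,
    rectInt_const_mul, rectInt_const_mul, rectInt_inv, rectInt_inv_sq,
    rectInt_eq_zero (by norm_num) (hrd.mono fun s hs => ?_)]
  · ring
  · rw [Complex.mem_reProdIm] at hs
    obtain ⟨⟨h1, h2⟩, -⟩ := hs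
    change |s.re| < 1
    exact abs_lt.2 ⟨by linarith, by linarith⟩

/-- The kernel `(π / sin πs)²` has the principal part `1/s²` at the origin, with no residue since it
is even; so it picks out the derivative of what it multiplies. -/
lemma rectInt_sin_kernel {k : ℂ → ℂ} (hk : Differentiable ℂ k) :
    rectInt (-1 / 2) (1 / 2) (fun s => (Real.pi / Complex.sin (Real.pi * s)) ^ 2 * k s)
      = 2 * Real.pi * Complex.I * deriv k 0 := by
  have hpi : (Real.pi : ℂ) ≠ 0 := by exact_mod_cast Real.pi_ne_zero
  have h0 : strip ∈ 𝓝 (0 : ℂ) := isOpen_strip.mem_nhds (by simp [strip])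
  have hsd : Differentiable ℂ fun s : ℂ => Complex.sin (Real.pi * s) := by fun_prop
  set d := dslope (fun s : ℂ => Complex.sin (Real.pi * s)) 0 with hd
  have hdd : DifferentiableOn ℂ d strip :=
    (Complex.differentiableOn_dslope h0).2 hsd.differentiableOn
  have hds : ∀ s, s * d s = Complex.sin (Real.pi * s) := fun s => by
    simpa using sub_smul_dslope (fun s : ℂ => Complex.sin (Real.pi * s)) 0 s
  have hd0 : d 0 = Real.pi := by
    rw [hd, dslope_same]
    have h1 : HasDerivAt (fun s : ℂ => (Real.pi : ℂ) * s) Real.pi 0 := by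
      simpa using (hasDerivAt_id (0 : ℂ)).const_mul (Real.pi : ℂ)
    simpa using h1.csin.deriv
  have hdne : ∀ s ∈ strip, d s ≠ 0 := by
    intro s hs h
    have h1 := hds s
    rw [h, mul_zero] at h1
    obtain ⟨n, hn⟩ := Complex.sin_eq_zero_iff.1 h1.symm
    have hsn : s = n := mul_left_cancel₀ hpi (by rw [hn]; ring)
    have : |(n : ℝ)| < 1 := by
      have : |s.re| < 1 := hs
      rwa [hsn, Complex.intCast_re] at this
    have hn0 : n = 0 := Int.abs_lt_one_iff.1 (by exact_mod_cast this)
    rw [hsn, hn0, Int.cast_zero, hd0] at h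
    exact hpi h
  set φ : ℂ → ℂ := fun s => (Real.pi / d s) ^ 2 with hφ
  have hφd : DifferentiableOn ℂ φ strip :=
    ((differentiableOn_const _).div hdd hdne).pow 2
  have hφ0 : φ 0 = 1 := by simp [hφ, hd0, hpi]
  have heven : ∀ s, φ (-s) = φ s := by
    intro s
    rcases eq_or_ne s 0 with rfl | hs
    · simp
    · have h1 : d (-s) = d s := by
        refine mul_left_cancel₀ (neg_ne_zero.2 hs) ?_
        rw [hds, neg_mul, hds, mul_neg, Complex.sin_neg]
      simp only [hφ, h1]
  have hφ' : HasDerivAt φ (deriv φ 0) 0 := (hφd.differentiableAt h0).hasDerivAt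
  have hφ'0 : deriv φ 0 = 0 := by
    have h1 : HasDerivAt (fun s => φ (-s)) (deriv φ 0 * -1) 0 := by
      refine HasDerivAt.comp (h₂ := φ) 0 ?_ (hasDerivAt_neg 0)
      simpa using hφ'
    have h2 := h1.unique (by simpa only [heven] using hφ')
    have h3 : (2 : ℂ) * deriv φ 0 = 0 := by linear_combination -h2
    simpa using h3
  have e : ∀ s ∈ puncturedRect, (Real.pi / Complex.sin (Real.pi * s)) ^ 2 * k s
      = (φ s * k s) * (s ^ 2)⁻¹ := by
    intro s hs
    rw [← hds]
    simp only [hφ, div_pow, mul_pow]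
    field_simp
  rw [rectInt_congr e, rectInt_div_sq (hφd.fun_mul hk.differentiableOn)]
  congr 1
  have := (hφ'.fun_mul (hk 0).hasDerivAt).deriv
  rw [this, hφ'0, hφ0]
  ring

/-! ### Rapidly decaying integrands -/

/-- The complement of the poles `0, 1, 2, …` of `Γ(-s)`. -/
def poleFree : Set ℂ := {s | ∀ n : ℕ, s ≠ n}

lemma mem_poleFree_of_im_ne_zero {s : ℂ} (hs : s.im ≠ 0) : s ∈ poleFree := fun n h =>
  hs (by rw [h]; simp)

lemma mem_poleFree_of_re_ne {s : ℂ} (hs : ∀ n : ℕ, s.re ≠ n) : s ∈ poleFree := fun n h =>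
  hs n (by rw [h]; simp)

lemma mem_poleFree_line {c : ℂ} (hc : c = Complex.I ∨ c = -Complex.I) (t : ℝ) :
    (t : ℂ) + c ∈ poleFree :=
  mem_poleFree_of_im_ne_zero (by rcases hc with rfl | rfl <;> simp)

lemma mem_poleFree_edge {σ : ℝ} (hσ : ∀ n : ℕ, σ ≠ n) (y : ℝ) :
    (σ : ℂ) + Complex.I * y ∈ poleFree :=
  mem_poleFree_of_re_ne fun n => by simpa using hσ n

/-- Continuity off the poles together with decay faster than every exponential along the two
horizontal lines of the loop. -/
structure RapidDecay (h : ℂ → ℂ) : Prop where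
  cont : ContinuousOn h poleFree
  decay : ∀ c : ℂ, c = Complex.I ∨ c = -Complex.I → ∀ R : ℝ, ∃ C : ℝ, ∀ t : ℝ, -2 ≤ t →
    ‖h ((t : ℂ) + c)‖ ≤ C * Real.exp (-(R * t))

lemma norm_eq_one_of_eq_I {c : ℂ} (hc : c = Complex.I ∨ c = -Complex.I) : ‖c‖ = 1 := by
  rcases hc with rfl | rfl <;> simp

lemma re_eq_zero_of_eq_I {c : ℂ} (hc : c = Complex.I ∨ c = -Complex.I) : c.re = 0 := by
  rcases hc with rfl | rfl <;> simp

lemma RapidDecay.add_const_mul {h : ℂ → ℂ} (hh : RapidDecay h) (b : ℂ) :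
    RapidDecay fun s => (s + b) * h s where
  cont := (by fun_prop : Continuous fun s : ℂ => s + b).continuousOn.mul hh.cont
  decay c hc R := by
    obtain ⟨C, hC⟩ := hh.decay c hc (R + 1)
    have hC0 : 0 ≤ C := by
      have h1 := (norm_nonneg _).trans (hC 0 (by norm_num))
      simpa using h1
    refine ⟨C * ((4 + ‖b‖) * Real.exp 2), fun t ht => ?_⟩
    have h1 : ‖(t : ℂ) + c + b‖ ≤ (4 + ‖b‖) * Real.exp 2 * Real.exp t := by
      have h2 : ‖(t : ℂ) + c + b‖ ≤ |t| + 1 + ‖b‖ := by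
        refine (norm_add_le _ _).trans (add_le_add_left ((norm_add_le _ _).trans ?_) _)
        rw [norm_eq_one_of_eq_I hc, Complex.norm_real, Real.norm_eq_abs]
      have h3 : |t| ≤ t + 4 := abs_le.2 ⟨by linarith, by linarith⟩
      have h4 : t + 3 ≤ Real.exp (t + 2) := by linarith [Real.add_one_le_exp (t + 2)]
      have h5 : 1 ≤ Real.exp (t + 2) := Real.one_le_exp (by linarith)
      have h6 : Real.exp 2 * Real.exp t = Real.exp (t + 2) := by rw [← Real.exp_add, add_comm]
      rw [mul_assoc, h6]
      nlinarith [norm_nonneg b]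
    rw [norm_mul]
    calc ‖(t : ℂ) + c + b‖ * ‖h (t + c)‖
        ≤ ((4 + ‖b‖) * Real.exp 2 * Real.exp t) * (C * Real.exp (-((R + 1) * t))) := by
          gcongr; exact hC t ht
      _ = C * ((4 + ‖b‖) * Real.exp 2) * (Real.exp t * Real.exp (-((R + 1) * t))) := by ring
      _ = C * ((4 + ‖b‖) * Real.exp 2) * Real.exp (-(R * t)) := by
          rw [← Real.exp_add]; congr 2; ring

lemma RapidDecay.id_mul {h : ℂ → ℂ} (hh : RapidDecay h) : RapidDecay fun s => s * h s := by
  simpa using hh.add_const_mul 0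

lemma norm_exp_mul_line {c : ℂ} (hc : c = Complex.I ∨ c = -Complex.I) (ζ : ℂ) (t : ℝ) :
    ‖Complex.exp (ζ * (t + c))‖ ≤ Real.exp ‖ζ‖ * Real.exp (ζ.re * t) := by
  rw [Complex.norm_exp, ← Real.exp_add, mul_add, Complex.add_re]
  apply Real.exp_le_exp.2
  have h1 : (ζ * t).re = ζ.re * t := by simp
  have h2 : (ζ * c).re ≤ ‖ζ‖ := (Complex.re_le_norm _).trans (by
    rw [norm_mul, norm_eq_one_of_eq_I hc, mul_one])
  linarith

lemma RapidDecay.mul_exp {h : ℂ → ℂ} (hh : RapidDecay h) (ζ : ℂ) :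
    RapidDecay fun s => h s * Complex.exp (ζ * s) where
  cont := hh.cont.mul (by fun_prop : Continuous fun s : ℂ => Complex.exp (ζ * s)).continuousOn
  decay c hc R := by
    obtain ⟨C, hC⟩ := hh.decay c hc (R + ζ.re)
    refine ⟨C * Real.exp ‖ζ‖, fun t ht => ?_⟩
    rw [norm_mul]
    calc ‖h (t + c)‖ * ‖Complex.exp (ζ * (t + c))‖
        ≤ (C * Real.exp (-((R + ζ.re) * t))) * (Real.exp ‖ζ‖ * Real.exp (ζ.re * t)) :=
          mul_le_mul (hC t ht) (norm_exp_mul_line hc ζ t) (norm_nonneg _)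
            ((norm_nonneg _).trans (hC t ht))
      _ = C * Real.exp ‖ζ‖ * (Real.exp (-((R + ζ.re) * t)) * Real.exp (ζ.re * t)) := by ring
      _ = C * Real.exp ‖ζ‖ * Real.exp (-(R * t)) := by
          rw [← Real.exp_add]; congr 2; ring

lemma RapidDecay.continuous_line {h : ℂ → ℂ} (hh : RapidDecay h) {c : ℂ}
    (hc : c = Complex.I ∨ c = -Complex.I) : Continuous fun t : ℝ => h ((t : ℂ) + c) :=
  hh.cont.comp_continuous (by fun_prop) (mem_poleFree_line hc)

lemma RapidDecay.continuous_edge {h : ℂ → ℂ} (hh : RapidDecay h) {σ : ℝ}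
    (hσ : ∀ n : ℕ, σ ≠ n) : Continuous fun y : ℝ => h ((σ : ℂ) + Complex.I * y) :=
  hh.cont.comp_continuous (by fun_prop) (mem_poleFree_edge hσ)

lemma RapidDecay.integrableOn {h : ℂ → ℂ} (hh : RapidDecay h) {c : ℂ}
    (hc : c = Complex.I ∨ c = -Complex.I) {σ : ℝ} (hσ : -2 ≤ σ) :
    IntegrableOn (fun t : ℝ => h ((t : ℂ) + c)) (Ioi σ) := by
  obtain ⟨C, hC⟩ := hh.decay c hc 1
  have h1 : IntegrableOn (fun t : ℝ => C * Real.exp (-(1 * t))) (Ioi σ) := by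
    simp only [one_mul]
    exact (integrableOn_exp_neg_Ioi σ).const_mul C
  refine Integrable.mono' h1 (hh.continuous_line hc).aestronglyMeasurable ?_
  filter_upwards [ae_restrict_mem measurableSet_Ioi] with t ht
  exact hC t (hσ.trans (le_of_lt ht))

lemma RapidDecay.integrableOn_sub {h : ℂ → ℂ} (hh : RapidDecay h) {σ : ℝ} (hσ : -2 ≤ σ) :
    IntegrableOn (fun t : ℝ => h ((t : ℂ) + Complex.I) - h ((t : ℂ) - Complex.I)) (Ioi σ) := by
  simp only [sub_eq_add_neg _ Complex.I]
  exact (hh.integrableOn (Or.inl rfl) hσ).sub (hh.integrableOn (Or.inr rfl) hσ)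

lemma loopInt_add {f g : ℂ → ℂ} (hf : RapidDecay f) (hg : RapidDecay g) {σ : ℝ} (hσ : -2 ≤ σ)
    (hσ' : ∀ n : ℕ, σ ≠ n) :
    loopInt σ (fun s => f s + g s) = loopInt σ f + loopInt σ g := by
  unfold loopInt
  have e : ∀ t : ℝ, f ((t : ℂ) + Complex.I) + g ((t : ℂ) + Complex.I)
      - (f ((t : ℂ) - Complex.I) + g ((t : ℂ) - Complex.I))
      = (f ((t : ℂ) + Complex.I) - f ((t : ℂ) - Complex.I))
        + (g ((t : ℂ) + Complex.I) - g ((t : ℂ) - Complex.I)) := fun t => by ring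
  simp only [e]
  rw [integral_add (hf.integrableOn_sub hσ) (hg.integrableOn_sub hσ),
    intervalIntegral.integral_add ((hf.continuous_edge hσ').intervalIntegrable _ _)
      ((hg.continuous_edge hσ').intervalIntegrable _ _)]
  ring

lemma loopInt_congr {f g : ℂ → ℂ} {σ : ℝ} (hσ : ∀ n : ℕ, σ ≠ n)
    (h : ∀ s ∈ poleFree, s.im ≠ 0 ∨ s.re = σ → f s = g s) :
    loopInt σ f = loopInt σ g := by
  unfold loopInt
  congr 1
  · refine integral_congr_ae (Eventually.of_forall fun t => ?_)
    simp only
    rw [h _ (mem_poleFree_line (Or.inl rfl) t) (by simp), sub_eq_add_neg (t : ℂ),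
      h _ (mem_poleFree_line (Or.inr rfl) t) (by simp)]
  · congr 1
    exact intervalIntegral.integral_congr fun y _ => h _ (mem_poleFree_edge hσ y)
      (by simp)

lemma RapidDecay.const_mul {h : ℂ → ℂ} (hh : RapidDecay h) (b : ℂ) :
    RapidDecay fun s => b * h s where
  cont := continuousOn_const.mul hh.cont
  decay c hc R := by
    obtain ⟨C, hC⟩ := hh.decay c hc R
    refine ⟨‖b‖ * C, fun t ht => ?_⟩
    rw [norm_mul, mul_assoc]
    exact mul_le_mul_of_nonneg_left (hC t ht) (norm_nonneg _)

/-! ### Dependence on the parameter -/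

/-- Differentiation under the integral sign for `ζ ↦ ∫ h e^{ζp}`. -/
lemma hasDerivAt_integral_exp {ν : Measure ℝ} {h p : ℝ → ℂ} (hh : AEStronglyMeasurable h ν)
    (hp : AEStronglyMeasurable p ν)
    (hi : ∀ R : ℝ, Integrable (fun t => ‖h t‖ * Real.exp (R * ‖p t‖)) ν) (ζ : ℂ) :
    HasDerivAt (fun ζ => ∫ t, h t * Complex.exp (ζ * p t) ∂ν)
      (∫ t, p t * h t * Complex.exp (ζ * p t) ∂ν) ζ := by
  have hm : ∀ z : ℂ, AEStronglyMeasurable (fun t => h t * Complex.exp (z * p t)) ν := fun z =>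
    hh.mul (Complex.continuous_exp.comp_aestronglyMeasurable (hp.const_mul z))
  have hb : ∀ (z : ℂ) (t : ℝ), ‖Complex.exp (z * p t)‖ ≤ Real.exp (‖z‖ * ‖p t‖) := fun z t => by
    rw [Complex.norm_exp, ← norm_mul]
    exact Real.exp_le_exp.2 (Complex.re_le_norm _)
  refine (hasDerivAt_integral_of_dominated_loc_of_deriv_le
    (F := fun ζ t => h t * Complex.exp (ζ * p t))
    (F' := fun ζ t => p t * h t * Complex.exp (ζ * p t))
    (bound := fun t => ‖h t‖ * Real.exp ((‖ζ‖ + 2) * ‖p t‖)) (Metric.ball_mem_nhds ζ one_pos)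
    (Eventually.of_forall hm) ?_ ?_ ?_ (hi _) ?_).2
  · refine Integrable.mono' (hi ‖ζ‖) (hm ζ) (Eventually.of_forall fun t => ?_)
    rw [norm_mul]
    exact mul_le_mul_of_nonneg_left (hb ζ t) (norm_nonneg _)
  · have := hp.mul (hm ζ)
    refine this.congr (Eventually.of_forall fun t => ?_)
    simp only [Pi.mul_apply, mul_assoc]
  · refine Eventually.of_forall fun t z hz => ?_
    have hz1 : ‖z‖ ≤ ‖ζ‖ + 1 := by
      have := norm_sub_norm_le z ζ
      rw [mem_ball_iff_norm] at hz
      linarith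
    have h1 : ‖p t‖ ≤ Real.exp ‖p t‖ := by linarith [Real.add_one_le_exp ‖p t‖]
    have h2 : ‖Complex.exp (z * p t)‖ ≤ Real.exp ((‖ζ‖ + 1) * ‖p t‖) :=
      (hb z t).trans (Real.exp_le_exp.2 (mul_le_mul_of_nonneg_right hz1 (norm_nonneg _)))
    rw [norm_mul, norm_mul]
    calc ‖p t‖ * ‖h t‖ * ‖Complex.exp (z * p t)‖
        ≤ Real.exp ‖p t‖ * ‖h t‖ * Real.exp ((‖ζ‖ + 1) * ‖p t‖) := by gcongr
      _ = ‖h t‖ * (Real.exp ‖p t‖ * Real.exp ((‖ζ‖ + 1) * ‖p t‖)) := by ring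
      _ = ‖h t‖ * Real.exp ((‖ζ‖ + 2) * ‖p t‖) := by rw [← Real.exp_add]; congr 2; ring
  · refine Eventually.of_forall fun t z _ => ?_
    have h1 : HasDerivAt (fun z : ℂ => z * p t) (p t) z := by
      simpa using (hasDerivAt_id z).mul_const (p t)
    exact (h1.cexp.const_mul (h t)).congr_deriv (by ring)

lemma RapidDecay.integrableOn_norm_mul_exp {h : ℂ → ℂ} (hh : RapidDecay h) {c : ℂ}
    (hc : c = Complex.I ∨ c = -Complex.I) (R : ℝ) :
    IntegrableOn (fun t : ℝ => ‖h ((t : ℂ) + c)‖ * Real.exp (R * ‖(t : ℂ) + c‖)) (Ioi (-1)) := by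
  obtain ⟨C, hC⟩ := hh.decay c hc (|R| + 1)
  have h1 : IntegrableOn (fun t : ℝ => C * Real.exp (|R| * 3) * Real.exp (-t)) (Ioi (-1)) :=
    (integrableOn_exp_neg_Ioi (-1)).const_mul _
  refine Integrable.mono' h1 ?_ ?_
  · refine Continuous.aestronglyMeasurable ?_
    have := (hh.continuous_line hc).norm
    fun_prop
  · filter_upwards [ae_restrict_mem measurableSet_Ioi] with t ht
    have ht' : -1 < t := ht
    rw [Real.norm_of_nonneg (by positivity)]
    have h2 : ‖(t : ℂ) + c‖ ≤ t + 3 := by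
      refine (norm_add_le _ _).trans ?_
      rw [norm_eq_one_of_eq_I hc, Complex.norm_real, Real.norm_eq_abs]
      have : |t| ≤ t + 2 := abs_le.2 ⟨by linarith, by linarith⟩
      linarith
    have h3 : R * ‖(t : ℂ) + c‖ ≤ |R| * (t + 3) :=
      (mul_le_mul_of_nonneg_right (le_abs_self R) (norm_nonneg _)).trans
        (mul_le_mul_of_nonneg_left h2 (abs_nonneg R))
    have h4 := hC t (by linarith)
    calc ‖h ((t : ℂ) + c)‖ * Real.exp (R * ‖(t : ℂ) + c‖)
        ≤ (C * Real.exp (-((|R| + 1) * t))) * Real.exp (|R| * (t + 3)) :=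
          mul_le_mul h4 (Real.exp_le_exp.2 h3) (Real.exp_pos _).le ((norm_nonneg _).trans h4)
      _ = C * (Real.exp (-((|R| + 1) * t)) * Real.exp (|R| * (t + 3))) := by ring
      _ = C * Real.exp (|R| * 3) * Real.exp (-t) := by
          rw [← Real.exp_add, mul_assoc, ← Real.exp_add]; congr 2; ring

/-- The loop integral of `h(s) e^{ζs}` along the loop with left edge `Re s = -1`. -/
def loopLaplace (h : ℂ → ℂ) (ζ : ℂ) : ℂ := loopInt (-1) fun s => h s * Complex.exp (ζ * s)

lemma neg_one_ne_natCast (n : ℕ) : (-1 : ℝ) ≠ n := by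
  have : (0 : ℝ) ≤ n := Nat.cast_nonneg n
  linarith

lemma hasDerivAt_loopLaplace {h : ℂ → ℂ} (hh : RapidDecay h) (ζ : ℂ) :
    HasDerivAt (loopLaplace h) (loopLaplace (fun s => s * h s) ζ) ζ := by
  have hline : ∀ c : ℂ, c = Complex.I ∨ c = -Complex.I →
      HasDerivAt (fun ζ => ∫ t in Ioi (-1 : ℝ), h ((t : ℂ) + c) * Complex.exp (ζ * ((t : ℂ) + c)))
        (∫ t in Ioi (-1 : ℝ), ((t : ℂ) + c) * h ((t : ℂ) + c) * Complex.exp (ζ * ((t : ℂ) + c))) ζ :=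
    fun c hc => hasDerivAt_integral_exp (h := fun t : ℝ => h ((t : ℂ) + c))
      (p := fun t : ℝ => (t : ℂ) + c) (hh.continuous_line hc).aestronglyMeasurable
      (by fun_prop : Continuous fun t : ℝ => (t : ℂ) + c).aestronglyMeasurable
      (fun R => hh.integrableOn_norm_mul_exp hc R) ζ
  have hedge := hh.continuous_edge neg_one_ne_natCast
  have hpe : Continuous fun y : ℝ => ((-1 : ℝ) : ℂ) + Complex.I * y := by fun_prop
  have hE : HasDerivAt (fun ζ => ∫ y in Ioc (-1 : ℝ) 1, h (((-1 : ℝ) : ℂ) + Complex.I * y)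
        * Complex.exp (ζ * (((-1 : ℝ) : ℂ) + Complex.I * y)))
      (∫ y in Ioc (-1 : ℝ) 1, (((-1 : ℝ) : ℂ) + Complex.I * y) *
        h (((-1 : ℝ) : ℂ) + Complex.I * y) * Complex.exp (ζ * (((-1 : ℝ) : ℂ) + Complex.I * y)))
      ζ := by
    refine hasDerivAt_integral_exp (h := fun y : ℝ => h (((-1 : ℝ) : ℂ) + Complex.I * y))
      (p := fun y : ℝ => ((-1 : ℝ) : ℂ) + Complex.I * y) hedge.aestronglyMeasurable
      hpe.aestronglyMeasurable (fun R => ?_) ζ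
    have hc : Continuous fun y : ℝ => ‖h (((-1 : ℝ) : ℂ) + Complex.I * y)‖
        * Real.exp (R * ‖((-1 : ℝ) : ℂ) + Complex.I * y‖) :=
      hedge.norm.mul (Real.continuous_exp.comp (continuous_const.mul hpe.norm))
    exact hc.integrableOn_Ioc
  have key : ∀ {k : ℂ → ℂ}, RapidDecay k → ∀ ζ, loopLaplace k ζ
      = ((∫ t in Ioi (-1 : ℝ), k ((t : ℂ) + Complex.I) * Complex.exp (ζ * ((t : ℂ) + Complex.I)))
        - ∫ t in Ioi (-1 : ℝ), k ((t : ℂ) + -Complex.I) * Complex.exp (ζ * ((t : ℂ) + -Complex.I)))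
        + Complex.I * ∫ y in Ioc (-1 : ℝ) 1, k (((-1 : ℝ) : ℂ) + Complex.I * y)
          * Complex.exp (ζ * (((-1 : ℝ) : ℂ) + Complex.I * y)) := by
    intro k hk ζ
    unfold loopLaplace loopInt
    simp only [sub_eq_add_neg _ Complex.I]
    rw [integral_sub ((hk.mul_exp ζ).integrableOn (Or.inl rfl) (by norm_num))
      ((hk.mul_exp ζ).integrableOn (Or.inr rfl) (by norm_num)),
      intervalIntegral.integral_of_le (by norm_num)]
  have := ((hline _ (Or.inl rfl)).sub (hline _ (Or.inr rfl))).add (hE.const_mul Complex.I)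
  rw [key hh.id_mul]
  refine this.congr_of_eventuallyEq (Eventually.of_forall fun ζ => ?_)
  rw [key hh]
  rfl

/-! ### The Mellin–Barnes integrand -/

/-- `Γ(-s) Γ(2-s) / Γ(1-a-s)`. -/
def mbG (a : ℝ) (s : ℂ) : ℂ :=
  Complex.Gamma (-s) * Complex.Gamma (2 - s) * (Complex.Gamma (1 - a - s))⁻¹

lemma differentiableAt_mbG (a : ℝ) {s : ℂ} (hs : s ∈ poleFree) : DifferentiableAt ℂ (mbG a) s := by
  unfold mbG
  have h1 : DifferentiableAt ℂ (fun s : ℂ => Complex.Gamma (-s)) s :=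
    DifferentiableAt.comp (g := Complex.Gamma) s
      (Complex.differentiableAt_Gamma _ fun m h => hs m (by linear_combination -h)) (by fun_prop)
  have h2 : DifferentiableAt ℂ (fun s : ℂ => Complex.Gamma (2 - s)) s :=
    DifferentiableAt.comp (g := Complex.Gamma) (f := fun s : ℂ => 2 - s) s
      (Complex.differentiableAt_Gamma _ fun m h => hs (m + 2) (by
        push_cast; linear_combination -h)) (by fun_prop)
  have h3 : DifferentiableAt ℂ (fun s : ℂ => (Complex.Gamma (1 - a - s))⁻¹) s :=
    DifferentiableAt.comp (g := fun z => (Complex.Gamma z)⁻¹) (f := fun s : ℂ => 1 - a - s) s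
      (Complex.differentiable_one_div_Gamma _) (by fun_prop)
  exact (h1.mul h2).mul h3

lemma mbG_add_one (a : ℝ) {s : ℂ} (h1 : s + 1 ≠ 0) (h2 : s ≠ 1) :
    (s + 1) * (s - 1) * mbG a (s + 1) = -((s + a) * mbG a s) := by
  unfold mbG
  have e1 : Complex.Gamma (-s) = -(s + 1) * Complex.Gamma (-(s + 1)) := by
    rw [← Complex.Gamma_add_one _ (neg_ne_zero.2 h1)]; congr 1; ring
  have e2 : Complex.Gamma (2 - s) = (1 - s) * Complex.Gamma (2 - (s + 1)) := by
    have : (2 : ℂ) - (s + 1) = 1 - s := by ring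
    rw [this, ← Complex.Gamma_add_one _ (sub_ne_zero.2 h2.symm)]; congr 1; ring
  have e3 := Complex.one_div_Gamma_eq_self_mul_one_div_Gamma_add_one (1 - a - (s + 1))
  have e4 : (1 : ℂ) - a - (s + 1) + 1 = 1 - a - s := by ring
  rw [e4] at e3
  rw [e1, e2, e3]
  ring

/-- If the ratio of values one unit apart tends to zero, then the function decays faster than every
exponential. -/
lemma exists_exp_bound {u : ℝ → ℂ} (hu : Continuous u)
    (h : ∀ ε : ℝ, 0 < ε → ∃ T : ℝ, ∀ t ≥ T, ‖u (t + 1)‖ ≤ ε * ‖u t‖) (R : ℝ) :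
    ∃ C : ℝ, ∀ t : ℝ, -2 ≤ t → ‖u t‖ ≤ C * Real.exp (-(R * t)) := by
  obtain ⟨T, hT⟩ := h (Real.exp (-R)) (Real.exp_pos _)
  obtain ⟨C, hC⟩ := (isCompact_Icc (a := (-2 : ℝ)) (b := max T (-2) + 1)).bddAbove_image
    (f := fun t => ‖u t‖ * Real.exp (R * t)) (by fun_prop)
  have key : ∀ n : ℕ, ∀ t : ℝ, -2 ≤ t → t ≤ max T (-2) + 1 + n → ‖u t‖ * Real.exp (R * t) ≤ C := by
    intro n
    induction n with
    | zero => exact fun t h1 h2 => hC (mem_image_of_mem _ ⟨h1, by simpa using h2⟩)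
    | succ n ih =>
      intro t h1 h2
      by_cases h3 : t ≤ max T (-2) + 1 + n
      · exact ih t h1 h3
      · push Not at h3
        push_cast at h2
        have hn : (0 : ℝ) ≤ n := Nat.cast_nonneg n
        have h4 : max T (-2) ≤ t - 1 := by linarith
        have h5 := hT (t - 1) ((le_max_left _ _).trans h4)
        rw [sub_add_cancel] at h5
        refine le_trans ?_ (ih (t - 1) ((le_max_right _ _).trans h4) (by linarith))
        calc ‖u t‖ * Real.exp (R * t) ≤ Real.exp (-R) * ‖u (t - 1)‖ * Real.exp (R * t) := by gcongr
          _ = ‖u (t - 1)‖ * (Real.exp (-R) * Real.exp (R * t)) := by ring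
          _ = ‖u (t - 1)‖ * Real.exp (R * (t - 1)) := by rw [← Real.exp_add]; congr 2; ring
  refine ⟨C, fun t ht => ?_⟩
  obtain ⟨n, hn⟩ := exists_nat_ge (t - (max T (-2) + 1))
  have h1 := key n t ht (by linarith)
  rw [Real.exp_neg, ← div_eq_mul_inv, le_div_iff₀ (Real.exp_pos _)]
  exact h1

/-- The recurrence bounds the ratio of values one unit apart by `(1 + |a|) / (t - 1)`. -/
lemma rapidDecay_mbG (a : ℝ) : RapidDecay (mbG a) where
  cont s hs := (differentiableAt_mbG a hs).continuousAt.continuousWithinAt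
  decay c hc R := by
    refine exists_exp_bound (u := fun t : ℝ => mbG a ((t : ℂ) + c)) ?_ (fun ε hε => ?_) R
    · refine continuous_iff_continuousAt.2 fun t => ?_
      exact ContinuousAt.comp (g := mbG a) (f := fun t : ℝ => (t : ℂ) + c)
        (differentiableAt_mbG a (mem_poleFree_line hc t)).continuousAt (by fun_prop)
    · refine ⟨2 + (1 + |a|) / ε, fun t ht => ?_⟩
      have ht1 : (1 + |a|) / ε ≤ t - 1 := by linarith
      have hq : 0 ≤ (1 + |a|) / ε := by positivity
      have ht2 : 0 < t - 1 := by linarith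
      have him : c.im ≠ 0 := by rcases hc with rfl | rfl <;> simp
      have hs1 : (t : ℂ) + c + 1 ≠ 0 := fun h => him (by simpa using congrArg Complex.im h)
      have hs2 : (t : ℂ) + c ≠ 1 := fun h => him (by simpa using congrArg Complex.im h)
      have e := congrArg (‖·‖) (mbG_add_one a hs1 hs2)
      simp only [norm_mul, norm_neg] at e
      have b1 : t + 1 ≤ ‖(t : ℂ) + c + 1‖ := by
        have := Complex.re_le_norm ((t : ℂ) + c + 1)
        simpa [re_eq_zero_of_eq_I hc] using this
      have b2 : t - 1 ≤ ‖(t : ℂ) + c - 1‖ := by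
        have := Complex.re_le_norm ((t : ℂ) + c - 1)
        simpa [re_eq_zero_of_eq_I hc] using this
      have b3 : ‖(t : ℂ) + c + a‖ ≤ (t + 1) * (1 + |a|) := by
        have h1 : ‖(t : ℂ) + c + a‖ ≤ t + 1 + |a| := by
          refine (norm_add_le _ _).trans ?_
          rw [Complex.norm_real, Real.norm_eq_abs]
          refine add_le_add_left ((norm_add_le _ _).trans ?_) _
          rw [norm_eq_one_of_eq_I hc, Complex.norm_real, Real.norm_of_nonneg (by linarith)]
        nlinarith [abs_nonneg a]
      have e5 : ((t + 1 : ℝ) : ℂ) + c = (t : ℂ) + c + 1 := by push_cast; ring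
      rw [e5]
      have ht3 : 0 ≤ t + 1 := by linarith
      have hpos : 0 < (t + 1) * (t - 1) := by nlinarith
      refine le_of_mul_le_mul_left ?_ hpos
      calc (t + 1) * (t - 1) * ‖mbG a ((t : ℂ) + c + 1)‖
          ≤ ‖(t : ℂ) + c + 1‖ * ‖(t : ℂ) + c - 1‖ * ‖mbG a ((t : ℂ) + c + 1)‖ := by gcongr
        _ = ‖(t : ℂ) + c + a‖ * ‖mbG a ((t : ℂ) + c)‖ := e
        _ ≤ (t + 1) * (1 + |a|) * ‖mbG a ((t : ℂ) + c)‖ := by gcongr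
        _ ≤ (t + 1) * ((t - 1) * ε) * ‖mbG a ((t : ℂ) + c)‖ := by
            have := (div_le_iff₀ hε).1 ht1
            gcongr
        _ = (t + 1) * (t - 1) * (ε * ‖mbG a ((t : ℂ) + c)‖) := by ring

/-! ### The Meijer function solves Kummer's equation -/

/-- Moving the left edge from `-1` to `-2` and then translating by one turns the recurrence of the
integrand into a differential equation in `ζ`, where `z = e^ζ`. -/
lemma loopLaplace_mbG_ode (a : ℝ) (ζ : ℂ) :
    loopLaplace (fun s => s * (s * mbG a s)) ζ - 2 * loopLaplace (fun s => s * mbG a s) ζ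
      = -Complex.exp ζ * (loopLaplace (fun s => s * mbG a s) ζ + a * loopLaplace (mbG a) ζ) := by
  have h0 := rapidDecay_mbG a
  have h2 : ∀ n : ℕ, (-2 : ℝ) ≠ n := fun n => by
    have : (0 : ℝ) ≤ n := Nat.cast_nonneg n
    linarith
  set e : ℂ → ℂ := fun s => Complex.exp (ζ * s) with he
  set f : ℂ → ℂ := fun s => s * (s - 2) * mbG a s * e s with hf
  set h : ℂ → ℂ := fun s => (s + a) * mbG a s * e s with hh
  have hL : loopInt (-1) f = loopLaplace (fun s => s * (s * mbG a s)) ζ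
      - 2 * loopLaplace (fun s => s * mbG a s) ζ := by
    unfold loopLaplace
    rw [sub_eq_add_neg, ← neg_mul, ← loopInt_const_mul, ← loopInt_add (h0.id_mul.id_mul.mul_exp ζ)
      ((h0.id_mul.mul_exp ζ).const_mul _) (by norm_num) neg_one_ne_natCast]
    congr 1
    ext s
    simp only [hf, he]
    ring
  have hR : loopInt (-1) h = loopLaplace (fun s => s * mbG a s) ζ + a * loopLaplace (mbG a) ζ := by
    unfold loopLaplace
    rw [← loopInt_const_mul, ← loopInt_add (h0.id_mul.mul_exp ζ)
      ((h0.mul_exp ζ).const_mul _) (by norm_num) neg_one_ne_natCast]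
    congr 1
    ext s
    simp only [hh, he]
    ring
  have hshift : loopInt (-2) h = loopInt (-1) h := by
    have h1 := loopInt_sub_loopInt (f := h) (σ₁ := -2) (σ₂ := -1) (by norm_num)
      (((h0.add_const_mul a).mul_exp ζ).integrableOn_sub le_rfl)
    rw [rectInt_eq_zero (by norm_num), neg_zero] at h1
    · exact sub_eq_zero.1 h1
    · intro s hs
      rw [Complex.mem_reProdIm] at hs
      have hs' : s ∈ poleFree := mem_poleFree_of_re_ne fun n hn => by
        have : (0 : ℝ) ≤ n := Nat.cast_nonneg n
        linarith [hs.1.2]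
      have := differentiableAt_mbG a hs'
      exact ((by fun_prop : DifferentiableAt ℂ h s)).differentiableWithinAt
  have htr : loopInt (-1) f = loopInt (-2) (fun s => f (s + (1 : ℝ))) := by
    rw [loopInt_comp_add]; norm_num
  have hrec : loopInt (-2) (fun s => f (s + (1 : ℝ))) = -Complex.exp ζ * loopInt (-2) h := by
    rw [← loopInt_const_mul]
    refine loopInt_congr h2 fun s hs hs' => ?_
    have hs1 : s + 1 ≠ 0 := by
      intro h3
      have h4 : s = -1 := by linear_combination h3
      rw [h4] at hs'
      norm_num at hs'
    have := mbG_add_one a hs1 (by simpa using hs 1)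
    simp only [hf, hh, he, Complex.ofReal_one]
    rw [mul_add, mul_one, Complex.exp_add]
    linear_combination (Complex.exp (ζ * s) * Complex.exp ζ) * this
  rw [← hL, htr, hrec, hshift, hR]

/-- The logarithm of `-x`, on the branch `arg = π`. -/
def logNeg (x : ℝ) : ℂ := Real.log x + Real.pi * Complex.I

lemma exp_logNeg {x : ℝ} (hx : 0 < x) : Complex.exp (logNeg x) = -x := by
  rw [logNeg, Complex.exp_add, Complex.exp_pi_mul_I, ← Complex.ofReal_exp, Real.exp_log hx]
  ring

/-- `x ↦ G^{2,0}_{1,2}(-x | 1-a; 0, 2)`. -/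
def meijerX (a x : ℝ) : ℂ := meijerG2012 (1 - a) 0 2 ((-x : ℝ) : ℂ)

/-- The derivative of `meijerX a`. -/
def meijerX' (a x : ℝ) : ℂ :=
  (2 * Real.pi * Complex.I)⁻¹ * loopLaplace (fun s => s * mbG a s) (logNeg x) / x

lemma meijerX_eq (a : ℝ) {x : ℝ} (hx : 0 < x) :
    meijerX a x = (2 * Real.pi * Complex.I)⁻¹ * loopLaplace (mbG a) (logNeg x) := by
  have hne : ((-x : ℝ) : ℂ) ≠ 0 := by exact_mod_cast (neg_neg_of_pos hx).ne
  have hlog : Complex.log ((-x : ℝ) : ℂ) = logNeg x := by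
    unfold Complex.log logNeg
    rw [Complex.arg_ofReal_of_neg (neg_neg_of_pos hx), Complex.norm_real, norm_neg,
      Real.norm_of_nonneg hx.le]
  have hl : meijerLeft 0 2 = -1 := by simp [meijerLeft]
  have hh : meijerHeight 0 2 = 1 := by simp [meijerHeight]
  have hint : ∀ s, meijerIntegrand (1 - a) 0 2 ((-x : ℝ) : ℂ) s
      = mbG a s * Complex.exp (logNeg x * s) := fun s => by
    rw [meijerIntegrand, mbG, Complex.cpow_def_of_ne_zero hne, hlog, zero_sub]
  unfold meijerX meijerG2012 loopLaplace loopInt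
  rw [hl, hh]
  simp only [hint, Complex.ofReal_one, mul_one]

lemma hasDerivAt_logNeg {x : ℝ} (hx : 0 < x) : HasDerivAt logNeg ((x : ℂ)⁻¹) x := by
  have := (Real.hasDerivAt_log hx.ne').ofReal_comp.add_const (Real.pi * Complex.I)
  rw [Complex.ofReal_inv] at this
  exact this

lemma kummerSol_meijerX (a : ℝ) : KummerSol a (meijerX a) (meijerX' a) where
  hd x hx := by
    have h1 := (hasDerivAt_loopLaplace (rapidDecay_mbG a) (logNeg x)).comp x (hasDerivAt_logNeg hx)
    have h2 := h1.const_mul (2 * Real.pi * Complex.I)⁻¹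
    refine (h2.congr_deriv ?_).congr_of_eventuallyEq ?_
    · rw [meijerX']; ring
    · filter_upwards [lt_mem_nhds hx] with y hy
      exact meijerX_eq a hy
  hd' x hx := by
    have hx' : (x : ℂ) ≠ 0 := by exact_mod_cast hx.ne'
    have h1 := (hasDerivAt_loopLaplace (rapidDecay_mbG a).id_mul (logNeg x)).comp x
      (hasDerivAt_logNeg hx)
    have h2 := (h1.const_mul (2 * Real.pi * Complex.I)⁻¹).fun_div
      (hasDerivAt_id x).ofReal_comp hx'
    refine h2.congr_deriv ?_
    have ode := loopLaplace_mbG_ode a (logNeg x)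
    rw [exp_logNeg hx, neg_neg] at ode
    rw [meijerX_eq a hx, meijerX']
    simp only [Function.comp_apply, id, Complex.ofReal_one]
    rw [sub_eq_iff_eq_add] at ode
    rw [ode]
    field_simp
    ring

/-! ### The Meijer function at the origin -/

/-- The entire function `s (s-1) / (Γ(1+s)² Γ(1-a-s))`; the Mellin–Barnes integrand is
`(π / sin πs)²` times it. -/
def mbQ (a : ℝ) (s : ℂ) : ℂ :=
  s * (s - 1) * ((Complex.Gamma (1 + s))⁻¹) ^ 2 * (Complex.Gamma (1 - a - s))⁻¹

lemma differentiable_rGamma_one_add : Differentiable ℂ fun s : ℂ => (Complex.Gamma (1 + s))⁻¹ :=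
  Complex.differentiable_one_div_Gamma.comp (by fun_prop : Differentiable ℂ fun s : ℂ => 1 + s)

lemma differentiable_rGamma_sub (a : ℝ) :
    Differentiable ℂ fun s : ℂ => (Complex.Gamma (1 - a - s))⁻¹ :=
  Complex.differentiable_one_div_Gamma.comp (by fun_prop : Differentiable ℂ fun s : ℂ => 1 - a - s)

lemma differentiable_mbQ (a : ℝ) : Differentiable ℂ (mbQ a) := by
  have h1 := differentiable_rGamma_one_add
  have h2 := differentiable_rGamma_sub a
  exact ((by fun_prop : Differentiable ℂ fun s : ℂ => s * (s - 1)).mul (h1.pow 2)).mul h2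

/-- By the reflection formula `Γ(-s) Γ(1+s) = -π / sin πs`. -/
lemma mbG_eq_mbQ (a : ℝ) {s : ℂ} (hs : ∀ n : ℤ, s ≠ n) :
    mbG a s = (Real.pi / Complex.sin (Real.pi * s)) ^ 2 * mbQ a s := by
  have h0 : s ≠ 0 := by simpa using hs 0
  have h1 : s ≠ 1 := by simpa using hs 1
  have hΓ : Complex.Gamma (1 + s) ≠ 0 := Complex.Gamma_ne_zero fun m h => hs (-m - 1) (by
    push_cast; linear_combination h)
  have e1 : Complex.Gamma (2 - s) = (1 - s) * (-s * Complex.Gamma (-s)) := by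
    rw [← Complex.Gamma_add_one _ (neg_ne_zero.2 h0), show -s + 1 = 1 - s by ring,
      ← Complex.Gamma_add_one _ (sub_ne_zero.2 h1.symm)]
    congr 1; ring
  have e2 : Complex.Gamma (-s) = -(Real.pi / Complex.sin (Real.pi * s)) *
      (Complex.Gamma (1 + s))⁻¹ := by
    rw [eq_mul_inv_iff_mul_eq₀ hΓ]
    have := Complex.Gamma_mul_Gamma_one_sub (-s)
    rw [sub_neg_eq_add, mul_neg, Complex.sin_neg, div_neg] at this
    exact this
  rw [mbG, mbQ, e1, e2]
  ring

/-- One cell of the loop contributes the residue at the double pole inside it. -/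
lemma loopInt_cell (a : ℝ) (ζ : ℂ) (m : ℕ) :
    loopInt (m - 1 / 2) (fun s => mbG a s * Complex.exp (ζ * s))
      - loopInt (m + 1 / 2) (fun s => mbG a s * Complex.exp (ζ * s))
      = -(2 * Real.pi * Complex.I * deriv (fun s => mbQ a s * Complex.exp (ζ * s)) m) := by
  have hm : (0 : ℝ) ≤ m := Nat.cast_nonneg m
  rw [loopInt_sub_loopInt (by linarith)
    (((rapidDecay_mbG a).mul_exp ζ).integrableOn_sub (by linarith))]
  congr 1
  have e1 : rectInt (m - 1 / 2) (m + 1 / 2) (fun s => mbG a s * Complex.exp (ζ * s))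
      = rectInt (-1 / 2) (1 / 2) (fun s => mbG a (s + (m : ℝ)) * Complex.exp (ζ * (s + (m : ℝ)))) := by
    rw [rectInt_comp_add (fun s => mbG a s * Complex.exp (ζ * s))]
    congr 1 <;> ring
  rw [e1]
  have e2 : ∀ s ∈ puncturedRect, mbG a (s + (m : ℝ)) * Complex.exp (ζ * (s + (m : ℝ)))
      = (Real.pi / Complex.sin (Real.pi * s)) ^ 2 *
        (mbQ a (s + m) * Complex.exp (ζ * (s + m))) := by
    intro s hs
    have hns : ∀ n : ℤ, s + m ≠ n := by
      intro n hn
      have h1 : s = ((n - m : ℤ) : ℂ) := by push_cast; linear_combination hn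
      have h2 := hs.1
      rw [h1, Complex.intCast_re] at h2
      have h3 : |n - (m : ℤ)| < 1 := by
        have : |((n - m : ℤ) : ℝ)| < 1 := lt_of_le_of_lt h2 (by norm_num)
        exact_mod_cast this
      rw [Int.abs_lt_one_iff] at h3
      rw [h3, Int.cast_zero] at h1
      exact hs.2.2 h1
    rw [Complex.ofReal_natCast, mbG_eq_mbQ a hns, mul_add, mul_comm (Real.pi : ℂ) (m : ℂ),
      Complex.sin_antiperiodic.add_nat_mul_eq, div_pow, mul_pow, ← pow_mul, mul_comm m 2, pow_mul,
      neg_one_sq, one_pow, one_mul]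
    ring
  rw [rectInt_congr e2, rectInt_sin_kernel (k := fun s => mbQ a (s + m) * Complex.exp (ζ * (s + m)))
    ((by have := differentiable_mbQ a; fun_prop)),
    deriv_comp_add_const (fun s => mbQ a s * Complex.exp (ζ * s)), zero_add]

/-- Moving the left edge from `-1` to `5/2` crosses the double poles at `0`, `1`, `2`. -/
lemma loopLaplace_mbG_eq (a : ℝ) (ζ : ℂ) :
    loopLaplace (mbG a) ζ = loopInt (5 / 2) (fun s => mbG a s * Complex.exp (ζ * s))
      - 2 * Real.pi * Complex.I * ∑ m ∈ Finset.range 3,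
        deriv (fun s => mbQ a s * Complex.exp (ζ * s)) m := by
  have h0 := loopInt_cell a ζ 0
  have h1 := loopInt_cell a ζ 1
  have h2 := loopInt_cell a ζ 2
  norm_num at h0 h1 h2
  have h3 := loopInt_sub_loopInt (f := fun s => mbG a s * Complex.exp (ζ * s)) (σ₁ := -1)
    (σ₂ := -(1 / 2)) (by norm_num) (((rapidDecay_mbG a).mul_exp ζ).integrableOn_sub (by norm_num))
  rw [rectInt_eq_zero (by norm_num)] at h3
  · unfold loopLaplace
    simp only [Finset.sum_range_succ, Finset.range_zero, Finset.sum_empty, Nat.cast_zero,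
      Nat.cast_one, Nat.cast_ofNat]
    linear_combination h0 + h1 + h2 + h3
  · intro s hs
    rw [Complex.mem_reProdIm] at hs
    have hs' : s ∈ poleFree := mem_poleFree_of_re_ne fun n hn => by
      have : (0 : ℝ) ≤ n := Nat.cast_nonneg n
      linarith [hs.1.2]
    have := differentiableAt_mbG a hs'
    exact ((by fun_prop : DifferentiableAt ℂ (fun s => mbG a s * Complex.exp (ζ * s)) s)
      ).differentiableWithinAt

/-- `|e^{ζs}| = x^{Re s} e^{-π Im s}` for `ζ = log x + iπ`. -/
lemma norm_exp_logNeg_mul_le {x : ℝ} (hx : 0 < x) (hx1 : x ≤ 1) {s : ℂ} (h1 : 5 / 2 ≤ s.re)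
    (h2 : -1 ≤ s.im) :
    ‖Complex.exp (logNeg x * s)‖ ≤ Real.exp Real.pi * x ^ (5 / 2 : ℝ) := by
  have e : (logNeg x * s).re = Real.log x * s.re - Real.pi * s.im := by
    simp [logNeg]
  rw [Complex.norm_exp, e, Real.rpow_def_of_pos hx, ← Real.exp_add]
  apply Real.exp_le_exp.2
  have := Real.log_nonpos hx.le hx1
  nlinarith [Real.pi_pos]

/-- Along the loop with left edge `5/2` the integral is `O(x^{5/2})`. -/
lemma exists_norm_loopInt_le (a : ℝ) :
    ∃ C : ℝ, ∀ x : ℝ, 0 < x → x ≤ 1 →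
      ‖loopInt (5 / 2) (fun s => mbG a s * Complex.exp (logNeg x * s))‖ ≤ C * x ^ (5 / 2 : ℝ) := by
  have hr := rapidDecay_mbG a
  have h52 : ∀ n : ℕ, (5 / 2 : ℝ) ≠ n := by
    intro n h
    have : ((5 : ℕ) : ℝ) = ((2 * n : ℕ) : ℝ) := by push_cast; linarith
    have := Nat.cast_injective this
    omega
  obtain ⟨B, hB⟩ := (isCompact_Icc (a := (-1 : ℝ)) (b := 1)).bddAbove_image
    (f := fun y : ℝ => ‖mbG a (((5 / 2 : ℝ) : ℂ) + Complex.I * y)‖)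
    (hr.continuous_edge h52).norm.continuousOn
  set I₁ : ℝ := ∫ t in Ioi (5 / 2 : ℝ), (‖mbG a ((t : ℂ) + Complex.I)‖
    + ‖mbG a ((t : ℂ) + -Complex.I)‖) with hI₁
  refine ⟨(I₁ + 2 * B) * Real.exp Real.pi, fun x hx hx1 => ?_⟩
  set E := Real.exp Real.pi * x ^ (5 / 2 : ℝ) with hE
  have hint : IntegrableOn (fun t : ℝ => ‖mbG a ((t : ℂ) + Complex.I)‖
      + ‖mbG a ((t : ℂ) + -Complex.I)‖) (Ioi (5 / 2)) :=
    (hr.integrableOn (Or.inl rfl) (by norm_num)).norm.add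
      (hr.integrableOn (Or.inr rfl) (by norm_num)).norm
  have b1 : ‖∫ t in Ioi (5 / 2 : ℝ), (mbG a ((t : ℂ) + Complex.I)
      * Complex.exp (logNeg x * ((t : ℂ) + Complex.I)) - mbG a ((t : ℂ) - Complex.I)
      * Complex.exp (logNeg x * ((t : ℂ) - Complex.I)))‖ ≤ I₁ * E := by
    rw [hI₁, ← integral_mul_const]
    refine norm_integral_le_of_norm_le (hint.mul_const E) ?_
    filter_upwards [ae_restrict_mem measurableSet_Ioi] with t ht
    have ht' : 5 / 2 ≤ t := le_of_lt ht
    refine (norm_sub_le _ _).trans ?_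
    rw [norm_mul, norm_mul, add_mul, ← sub_eq_add_neg]
    gcongr
    · exact norm_exp_logNeg_mul_le hx hx1 (by simpa using ht') (by simp)
    · exact norm_exp_logNeg_mul_le hx hx1 (by simpa using ht') (by simp)
  have b2 : ‖∫ y in (-1 : ℝ)..1, mbG a (((5 / 2 : ℝ) : ℂ) + Complex.I * y)
      * Complex.exp (logNeg x * (((5 / 2 : ℝ) : ℂ) + Complex.I * y))‖ ≤ B * E * |1 - (-1)| := by
    refine intervalIntegral.norm_integral_le_of_norm_le_const fun y hy => ?_
    rw [uIoc_of_le (by norm_num)] at hy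
    rw [norm_mul]
    exact mul_le_mul (hB (mem_image_of_mem _ ⟨hy.1.le, hy.2⟩))
      (norm_exp_logNeg_mul_le hx hx1 (by simp) (by simpa using hy.1.le)) (norm_nonneg _)
      ((norm_nonneg _).trans (hB (mem_image_of_mem _ ⟨hy.1.le, hy.2⟩)))
  unfold loopInt
  refine (norm_add_le _ _).trans ?_
  rw [norm_mul, Complex.norm_I, one_mul]
  refine (add_le_add b1 b2).trans (le_of_eq ?_)
  rw [hE]
  norm_num
  ring

lemma mbQ_hasDerivAt_zero (a : ℝ) : HasDerivAt (mbQ a) (-(Complex.Gamma (1 - a))⁻¹) 0 := by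
  have h1 : HasDerivAt (fun s : ℂ => (s - 1) * ((Complex.Gamma (1 + s))⁻¹) ^ 2
      * (Complex.Gamma (1 - a - s))⁻¹) (deriv (fun s : ℂ => (s - 1) *
        ((Complex.Gamma (1 + s))⁻¹) ^ 2 * (Complex.Gamma (1 - a - s))⁻¹) 0) 0 := by
    refine DifferentiableAt.hasDerivAt ?_
    exact ((by fun_prop : DifferentiableAt ℂ (fun s : ℂ => s - 1) 0).mul
      ((differentiable_rGamma_one_add 0).pow 2)).mul (differentiable_rGamma_sub a 0)
  refine (((hasDerivAt_id (0 : ℂ)).fun_mul h1).congr_deriv ?_).congr_of_eventuallyEq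
    (Eventually.of_forall fun s => ?_)
  · simp
  · simp only [mbQ, id]; ring

lemma mbQ_hasDerivAt_one (a : ℝ) : HasDerivAt (mbQ a) ((Complex.Gamma (-a))⁻¹) 1 := by
  have h1 : HasDerivAt (fun s : ℂ => s * ((Complex.Gamma (1 + s))⁻¹) ^ 2
      * (Complex.Gamma (1 - a - s))⁻¹) (deriv (fun s : ℂ => s *
        ((Complex.Gamma (1 + s))⁻¹) ^ 2 * (Complex.Gamma (1 - a - s))⁻¹) 1) 1 := by
    refine DifferentiableAt.hasDerivAt ?_
    exact ((by fun_prop : DifferentiableAt ℂ (fun s : ℂ => s) 1).mul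
      ((differentiable_rGamma_one_add 1).pow 2)).mul (differentiable_rGamma_sub a 1)
  have h2 : HasDerivAt (fun s : ℂ => s - 1) 1 1 := (hasDerivAt_id (1 : ℂ)).sub_const 1
  refine ((h2.fun_mul h1).congr_deriv ?_).congr_of_eventuallyEq
    (Eventually.of_forall fun s => ?_)
  · have : Complex.Gamma (1 + 1) = 1 := by
      simpa using Complex.Gamma_nat_eq_factorial 1
    simp [this]
  · simp only [mbQ]; ring

/-- `1/Γ(1-z) = Γ(z) sin(πz)/π` off the poles of `Γ`, also at the positive integers, where both
sides vanish. -/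
lemma inv_Gamma_one_sub {z : ℂ} (hz : ∀ m : ℕ, z ≠ -m) :
    (Complex.Gamma (1 - z))⁻¹ = Complex.Gamma z * Complex.sin (Real.pi * z) / Real.pi := by
  have hpi : (Real.pi : ℂ) ≠ 0 := by exact_mod_cast Real.pi_ne_zero
  have hΓ := Complex.Gamma_ne_zero hz
  have h := Complex.Gamma_mul_Gamma_one_sub z
  by_cases hs : Complex.sin (Real.pi * z) = 0
  · rw [hs, div_zero] at h
    rw [(mul_eq_zero.1 h).resolve_left hΓ, hs]
    simp
  · have h2 : Complex.Gamma (1 - z) = Real.pi / Complex.sin (Real.pi * z) / Complex.Gamma z := by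
      rw [← h]; field_simp
    rw [h2]
    field_simp

/-- The coefficient `(d/ds)(s(s-1)/Γ(1+s)²)` at `s = 2`, from `ψ(3) = 3/2 - γ`. -/
lemma hasDerivAt_mbU : HasDerivAt (fun s : ℂ => s * (s - 1) * ((Complex.Gamma (1 + s))⁻¹) ^ 2)
    ((Real.eulerMascheroniConstant : ℂ) - 3 / 4) 2 := by
  have hΓ : HasDerivAt Complex.Gamma (2 * (-(Real.eulerMascheroniConstant : ℂ) + 3 / 2)) 3 := by
    have h := Complex.hasDerivAt_Gamma_nat 2
    have e : ((harmonic 2 : ℚ) : ℂ) = 3 / 2 := by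
      norm_num [harmonic, Finset.sum_range_succ]
    rw [e] at h
    norm_num at h ⊢
    exact h
  have hΓ3 : Complex.Gamma 3 = 2 := by
    rw [show (3 : ℂ) = ((2 : ℕ) : ℂ) + 1 by norm_num, Complex.Gamma_nat_eq_factorial]
    norm_num [Nat.factorial]
  have h1 : HasDerivAt (fun s : ℂ => Complex.Gamma (1 + s))
      (2 * (-(Real.eulerMascheroniConstant : ℂ) + 3 / 2)) 2 := by
    refine HasDerivAt.comp_const_add (f := Complex.Gamma) 1 2 ?_
    norm_num at hΓ ⊢
    exact hΓ
  have hne : Complex.Gamma (1 + 2) ≠ 0 := by norm_num [hΓ3]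
  have h2 := (h1.fun_inv hne).fun_pow 2
  have h3 : HasDerivAt (fun s : ℂ => s * (s - 1)) 3 2 := by
    refine ((hasDerivAt_id (2 : ℂ)).fun_mul ((hasDerivAt_id (2 : ℂ)).sub_const 1)).congr_deriv ?_
    simp only [id]; norm_num
  refine (h3.fun_mul h2).congr_deriv ?_
  norm_num [hΓ3]
  ring

lemma mbQ_hasDerivAt_two {a : ℝ} (ha : -2 < a) :
    HasDerivAt (mbQ a) (((Real.eulerMascheroniConstant : ℂ) - 3 / 4) *
        (Complex.Gamma (a + 2) * Complex.sin (Real.pi * a) / Real.pi) +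
      1 / 2 * (deriv Complex.Gamma (a + 2) * Complex.sin (Real.pi * a) / Real.pi
        + Complex.Gamma (a + 2) * Complex.cos (Real.pi * a))) 2 ∧
    mbQ a 2 = 1 / 2 * (Complex.Gamma (a + 2) * Complex.sin (Real.pi * a) / Real.pi) := by
  have hpi : (Real.pi : ℂ) ≠ 0 := by exact_mod_cast Real.pi_ne_zero
  have hpos : ∀ s : ℂ, -a < s.re → ∀ m : ℕ, (a : ℂ) + s ≠ -m := by
    intro s hs m h
    have h1 := congrArg Complex.re h
    simp at h1
    have : (0 : ℝ) ≤ m := Nat.cast_nonneg m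
    linarith
  have hv : ∀ s : ℂ, -a < s.re → (Complex.Gamma (1 - a - s))⁻¹
      = Complex.Gamma (a + s) * Complex.sin (Real.pi * (a + s)) / Real.pi := by
    intro s hs
    rw [← inv_Gamma_one_sub (hpos s hs)]
    congr 2; ring
  have hsin : Complex.sin (Real.pi * (a + 2)) = Complex.sin (Real.pi * a) := by
    rw [mul_add, mul_comm (Real.pi : ℂ) 2, Complex.sin_add_two_pi]
  have hcos : Complex.cos (Real.pi * (a + 2)) = Complex.cos (Real.pi * a) := by
    rw [mul_add, mul_comm (Real.pi : ℂ) 2, Complex.cos_add_two_pi]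
  have h2re : -a < (2 : ℂ).re := by simp; linarith
  have hΓ : HasDerivAt (fun s : ℂ => Complex.Gamma (a + s)) (deriv Complex.Gamma (a + 2)) 2 :=
    HasDerivAt.comp_const_add (f := Complex.Gamma) (a : ℂ) 2
      (Complex.differentiableAt_Gamma _ (hpos 2 h2re)).hasDerivAt
  have hs : HasDerivAt (fun s : ℂ => Complex.sin (Real.pi * (a + s)))
      (Complex.cos (Real.pi * (a + 2)) * Real.pi) 2 := by
    have : HasDerivAt (fun s : ℂ => (Real.pi : ℂ) * (a + s)) Real.pi 2 := by
      simpa using ((hasDerivAt_id (2 : ℂ)).const_add (a : ℂ)).const_mul (Real.pi : ℂ)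
    exact this.csin
  have hV : HasDerivAt (fun s : ℂ => (Complex.Gamma (1 - a - s))⁻¹)
      ((deriv Complex.Gamma (a + 2) * Complex.sin (Real.pi * (a + 2))
        + Complex.Gamma (a + 2) * (Complex.cos (Real.pi * (a + 2)) * Real.pi)) / Real.pi) 2 := by
    refine ((hΓ.fun_mul hs).div_const _).congr_of_eventuallyEq ?_
    have : ∀ᶠ s : ℂ in 𝓝 2, -a < s.re :=
      Complex.continuous_re.continuousAt.eventually (lt_mem_nhds h2re)
    filter_upwards [this] with s hs
    exact hv s hs
  have hΓ3 : Complex.Gamma (1 + 2) = 2 := by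
    rw [show (1 : ℂ) + 2 = ((2 : ℕ) : ℂ) + 1 by norm_num, Complex.Gamma_nat_eq_factorial]
    norm_num [Nat.factorial]
  refine ⟨(hasDerivAt_mbU.fun_mul hV).congr_deriv ?_, ?_⟩
  · rw [hv 2 h2re, hsin, hcos, hΓ3]
    field_simp
    ring
  · rw [mbQ, hv 2 h2re, hsin, hΓ3]
    ring

/-! ### The infrared solution as a Laplace-type integral -/

/-- `r = u / (x + u)`. -/
def ratio (x u : ℝ) : ℝ := u / (x + u)

lemma ratio_pos {x u : ℝ} (hx : 0 ≤ x) (hu : 0 < u) : 0 < ratio x u := by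
  unfold ratio; positivity

lemma ratio_le_one {x u : ℝ} (hx : 0 ≤ x) (hu : 0 < u) : ratio x u ≤ 1 := by
  unfold ratio
  rw [div_le_one (by positivity)]
  linarith

lemma ratio_rpow_le_one {x u p : ℝ} (hx : 0 ≤ x) (hu : 0 < u) (hp : 0 ≤ p) :
    ratio x u ^ p ≤ 1 :=
  Real.rpow_le_one (ratio_pos hx hu).le (ratio_le_one hx hu) hp

/-- `A(x) = ∫₀^∞ e^{-u} (x+u) r^p du` with `r = u/(x+u)` and `p = a + 1`. This is
`∫₀^∞ e^{-u} u^{a+1} (x+u)^{-a} du = Γ(a+2) U(a, -1, x)`, a multiple of Tricomi's function. -/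
def irA (p x : ℝ) : ℝ := ∫ u in Ioi (0 : ℝ), Real.exp (-u) * ((x + u) * ratio x u ^ p)

/-- `B(x) = ∫₀^∞ e^{-u} r^p du`. -/
def irB (p x : ℝ) : ℝ := ∫ u in Ioi (0 : ℝ), Real.exp (-u) * ratio x u ^ p

/-- `C(x) = ∫₀^∞ e^{-u} r^p / (x+u) du`. -/
def irC (p x : ℝ) : ℝ := ∫ u in Ioi (0 : ℝ), Real.exp (-u) * (ratio x u ^ p / (x + u))

lemma measurable_ratio (x : ℝ) : Measurable (ratio x) := by unfold ratio; fun_prop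

lemma aesm_irA (p x : ℝ) : AEStronglyMeasurable
    (fun u : ℝ => Real.exp (-u) * ((x + u) * ratio x u ^ p)) (volume.restrict (Ioi 0)) := by
  have := measurable_ratio x
  exact (by fun_prop : Measurable _).aestronglyMeasurable

lemma aesm_irB (p x : ℝ) : AEStronglyMeasurable
    (fun u : ℝ => Real.exp (-u) * ratio x u ^ p) (volume.restrict (Ioi 0)) := by
  have := measurable_ratio x
  exact (by fun_prop : Measurable _).aestronglyMeasurable

lemma aesm_irC (p x : ℝ) : AEStronglyMeasurable
    (fun u : ℝ => Real.exp (-u) * (ratio x u ^ p / (x + u))) (volume.restrict (Ioi 0)) := by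
  have := measurable_ratio x
  exact (by fun_prop : Measurable _).aestronglyMeasurable

lemma integrableOn_exp_neg : IntegrableOn (fun u : ℝ => Real.exp (-u)) (Ioi 0) :=
  integrableOn_exp_neg_Ioi 0

lemma integrableOn_exp_neg_mul_rpow {q : ℝ} (hq : 0 < q) :
    IntegrableOn (fun u : ℝ => Real.exp (-u) * u ^ (q - 1)) (Ioi 0) :=
  Real.GammaIntegral_convergent hq

lemma integrableOn_exp_neg_mul_id : IntegrableOn (fun u : ℝ => Real.exp (-u) * u) (Ioi 0) := by
  have := integrableOn_exp_neg_mul_rpow (q := 2) (by norm_num)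
  norm_num at this
  exact this

lemma integrableOn_exp_neg_mul_add (x : ℝ) :
    IntegrableOn (fun u : ℝ => Real.exp (-u) * (x + u)) (Ioi 0) := by
  simp only [mul_add]
  exact (integrableOn_exp_neg.mul_const x).add integrableOn_exp_neg_mul_id

lemma integrableOn_irA {p x : ℝ} (hp : 0 ≤ p) (hx : 0 ≤ x) :
    IntegrableOn (fun u : ℝ => Real.exp (-u) * ((x + u) * ratio x u ^ p)) (Ioi 0) := by
  refine Integrable.mono' (integrableOn_exp_neg_mul_add x) (aesm_irA p x) ?_
  filter_upwards [ae_restrict_mem measurableSet_Ioi] with u (hu : 0 < u)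
  have h1 := ratio_rpow_le_one hx hu hp
  have h2 := Real.rpow_nonneg (ratio_pos hx hu).le p
  rw [Real.norm_of_nonneg (by positivity)]
  gcongr
  exact mul_le_of_le_one_right (by positivity) h1

lemma integrableOn_irB {p x : ℝ} (hp : 0 ≤ p) (hx : 0 ≤ x) :
    IntegrableOn (fun u : ℝ => Real.exp (-u) * ratio x u ^ p) (Ioi 0) := by
  refine Integrable.mono' integrableOn_exp_neg (aesm_irB p x) ?_
  filter_upwards [ae_restrict_mem measurableSet_Ioi] with u (hu : 0 < u)
  have h1 := ratio_rpow_le_one hx hu hp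
  have h2 := Real.rpow_nonneg (ratio_pos hx hu).le p
  rw [Real.norm_of_nonneg (by positivity)]
  exact mul_le_of_le_one_right (Real.exp_pos _).le h1

lemma integrableOn_irC {p x : ℝ} (hp : 0 ≤ p) (hx : 0 < x) :
    IntegrableOn (fun u : ℝ => Real.exp (-u) * (ratio x u ^ p / (x + u))) (Ioi 0) := by
  refine Integrable.mono' (integrableOn_exp_neg.mul_const x⁻¹) (aesm_irC p x) ?_
  filter_upwards [ae_restrict_mem measurableSet_Ioi] with u (hu : 0 < u)
  have h1 := ratio_rpow_le_one hx.le hu hp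
  have h2 := Real.rpow_nonneg (ratio_pos hx.le hu).le p
  rw [Real.norm_of_nonneg (by positivity), ← one_div]
  gcongr
  linarith

lemma hasDerivAt_ratio {x u : ℝ} (hx : 0 < x) (hu : 0 < u) :
    HasDerivAt (fun x => ratio x u) (-(ratio x u / (x + u))) x := by
  have hne : x + u ≠ 0 := by positivity
  refine ((hasDerivAt_const x u).fun_div ((hasDerivAt_id x).add_const u) hne).congr_deriv ?_
  simp only [ratio, id]
  field_simp
  ring

lemma hasDerivAt_ratio_rpow {p x u : ℝ} (hx : 0 < x) (hu : 0 < u) :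
    HasDerivAt (fun x => ratio x u ^ p) (-p * (ratio x u ^ p / (x + u))) x := by
  have hr := ratio_pos hx.le hu
  refine ((hasDerivAt_ratio hx hu).rpow_const (p := p) (Or.inl hr.ne')).congr_deriv ?_
  rw [Real.rpow_sub_one hr.ne']
  field_simp

lemma hasDerivAt_irA {p x : ℝ} (hp : 0 ≤ p) (hx : 0 < x) :
    HasDerivAt (irA p) ((1 - p) * irB p x) x := by
  have h := (hasDerivAt_integral_of_dominated_loc_of_deriv_le
    (μ := volume.restrict (Ioi (0 : ℝ)))
    (F := fun x u => Real.exp (-u) * ((x + u) * ratio x u ^ p))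
    (F' := fun x u => Real.exp (-u) * ((1 - p) * ratio x u ^ p))
    (bound := fun u => |1 - p| * Real.exp (-u)) (lt_mem_nhds hx)
    (Eventually.of_forall fun y => aesm_irA p y) (integrableOn_irA hp hx.le) ?_ ?_
    (integrableOn_exp_neg.const_mul _) ?_).2
  · refine h.congr_deriv ?_
    rw [irB, ← integral_const_mul]
    congr 1
    ext u
    ring
  · refine ((aesm_irB p x).const_mul (1 - p)).congr (Eventually.of_forall fun u => ?_)
    simp only; ring
  · filter_upwards [ae_restrict_mem measurableSet_Ioi] with u (hu : 0 < u)
    intro y (hy : 0 < y)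
    have h1 := ratio_rpow_le_one hy.le hu hp
    have h2 := Real.rpow_nonneg (ratio_pos hy.le hu).le p
    rw [norm_mul, norm_mul, Real.norm_of_nonneg h2, Real.norm_of_nonneg (Real.exp_pos _).le,
      Real.norm_eq_abs, mul_comm]
    gcongr
    exact mul_le_of_le_one_right (abs_nonneg _) h1
  · filter_upwards [ae_restrict_mem measurableSet_Ioi] with u (hu : 0 < u)
    intro y (hy : 0 < y)
    have hne : y + u ≠ 0 := by positivity
    refine ((((hasDerivAt_id y).add_const u).fun_mul (hasDerivAt_ratio_rpow hy hu)).const_mul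
      (Real.exp (-u))).congr_deriv ?_
    simp only [id]
    field_simp
    ring

lemma hasDerivAt_irB {p x : ℝ} (hp : 0 ≤ p) (hx : 0 < x) :
    HasDerivAt (irB p) (-p * irC p x) x := by
  have h := (hasDerivAt_integral_of_dominated_loc_of_deriv_le
    (μ := volume.restrict (Ioi (0 : ℝ)))
    (F := fun x u => Real.exp (-u) * ratio x u ^ p)
    (F' := fun x u => Real.exp (-u) * (-p * (ratio x u ^ p / (x + u))))
    (bound := fun u => p * (2 / x) * Real.exp (-u)) (lt_mem_nhds (half_lt_self hx))
    (Eventually.of_forall fun y => aesm_irB p y) (integrableOn_irB hp hx.le) ?_ ?_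
    (integrableOn_exp_neg.const_mul _) ?_).2
  · refine h.congr_deriv ?_
    rw [irC, ← integral_const_mul]
    congr 1
    ext u
    ring
  · refine ((aesm_irC p x).const_mul (-p)).congr (Eventually.of_forall fun u => ?_)
    simp only; ring
  · filter_upwards [ae_restrict_mem measurableSet_Ioi] with u (hu : 0 < u)
    intro y (hy' : x / 2 < y)
    have hy : 0 < y := (half_pos hx).trans hy'
    have h1 := ratio_rpow_le_one hy.le hu hp
    have h2 := Real.rpow_nonneg (ratio_pos hy.le hu).le p
    rw [norm_mul, norm_mul, norm_neg, Real.norm_of_nonneg (by positivity : 0 ≤ ratio y u ^ p / (y + u)),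
      Real.norm_of_nonneg (Real.exp_pos _).le, Real.norm_of_nonneg hp, mul_comm]
    have h3 : ratio y u ^ p / (y + u) ≤ 2 / x := by
      rw [div_le_div_iff₀ (by positivity) hx]
      nlinarith
    gcongr
  · filter_upwards [ae_restrict_mem measurableSet_Ioi] with u (hu : 0 < u)
    intro y (hy' : x / 2 < y)
    have hy : 0 < y := (half_pos hx).trans hy'
    exact (hasDerivAt_ratio_rpow hy hu).const_mul _

/-- Integration by parts: `A - x B = B + p x C`. -/
lemma irA_sub_eq {p x : ℝ} (hp : 0 < p) (hx : 0 < x) :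
    irA p x - x * irB p x = irB p x + p * x * irC p x := by
  have iA := integrableOn_irA hp.le hx.le
  have iB := integrableOn_irB hp.le hx.le
  have iC := integrableOn_irC hp.le hx
  have hcont : ContinuousWithinAt (fun u : ℝ => u * Real.exp (-u) * ratio x u ^ p) (Ici 0) 0 := by
    refine ContinuousAt.continuousWithinAt ?_
    have h1 : ContinuousAt (ratio x) 0 := by
      unfold ratio
      exact continuousAt_id.div (by fun_prop) (by simpa using hx.ne')
    have h2 : ContinuousAt (fun u => ratio x u ^ p) 0 := h1.rpow_const (Or.inr hp.le)
    exact (by fun_prop : ContinuousAt (fun u : ℝ => u * Real.exp (-u)) 0).mul h2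
  have hd : ∀ u ∈ Ioi (0 : ℝ), HasDerivAt (fun u : ℝ => u * Real.exp (-u) * ratio x u ^ p)
      (Real.exp (-u) * ratio x u ^ p + p * x * (Real.exp (-u) * (ratio x u ^ p / (x + u)))
        - (Real.exp (-u) * ((x + u) * ratio x u ^ p) - x * (Real.exp (-u) * ratio x u ^ p))) u := by
    intro u (hu : 0 < u)
    have hr := ratio_pos hx.le hu
    have hne : x + u ≠ 0 := by positivity
    have h1 : HasDerivAt (ratio x) (x / (x + u) ^ 2) u := by
      refine ((hasDerivAt_id u).fun_div ((hasDerivAt_id u).const_add x) hne).congr_deriv ?_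
      simp only [id]; ring
    have h2 : HasDerivAt (fun u : ℝ => Real.exp (-u)) (-Real.exp (-u)) u := by
      simpa using (hasDerivAt_neg u).exp
    refine (((hasDerivAt_id u).fun_mul h2).fun_mul
      (h1.rpow_const (p := p) (Or.inl hr.ne'))).congr_deriv ?_
    rw [Real.rpow_sub_one hr.ne']
    simp only [id]
    have : ratio x u = u / (x + u) := rfl
    rw [show ratio x u ^ p / ratio x u = ratio x u ^ p * ((x + u) / u) by
      rw [this, div_div_eq_mul_div, mul_div_assoc]]
    field_simp
    ring
  have hlim : Tendsto (fun u : ℝ => u * Real.exp (-u) * ratio x u ^ p) atTop (𝓝 0) := by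
    have h1 : Tendsto (fun u : ℝ => u * Real.exp (-u)) atTop (𝓝 0) := by
      simpa using Real.tendsto_pow_mul_exp_neg_atTop_nhds_zero 1
    refine squeeze_zero_norm' ?_ h1
    filter_upwards [eventually_gt_atTop 0] with u hu
    have h3 := ratio_rpow_le_one hx.le hu hp.le
    have h4 := Real.rpow_nonneg (ratio_pos hx.le hu).le p
    rw [Real.norm_of_nonneg (by positivity)]
    exact mul_le_of_le_one_right (by positivity) h3
  have iL : IntegrableOn (fun u : ℝ => Real.exp (-u) * ratio x u ^ p
      + p * x * (Real.exp (-u) * (ratio x u ^ p / (x + u)))) (Ioi 0) := iB.add (iC.const_mul _)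
  have iR : IntegrableOn (fun u : ℝ => Real.exp (-u) * ((x + u) * ratio x u ^ p)
      - x * (Real.exp (-u) * ratio x u ^ p)) (Ioi 0) := iA.sub (iB.const_mul _)
  have h := integral_Ioi_of_hasDerivAt_of_tendsto hcont hd (iL.sub iR) hlim
  rw [integral_sub iL iR, integral_add iB (iC.const_mul _), integral_sub iA (iB.const_mul _),
    integral_const_mul, integral_const_mul] at h
  simp only [zero_mul, sub_zero] at h
  unfold irA irB irC
  linarith

lemma irA_pos {p x : ℝ} (hp : 0 ≤ p) (hx : 0 ≤ x) : 0 < irA p x := by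
  refine (setIntegral_pos_iff_support_of_nonneg_ae ?_ (integrableOn_irA hp hx)).2 ?_
  · filter_upwards [ae_restrict_mem measurableSet_Ioi] with u (hu : 0 < u)
    have h2 := Real.rpow_nonneg (ratio_pos hx hu).le p
    simp only [Pi.zero_apply]
    positivity
  · have : Ioi (0 : ℝ) ⊆ (Function.support fun u : ℝ =>
        Real.exp (-u) * ((x + u) * ratio x u ^ p)) ∩ Ioi 0 := by
      intro u (hu : 0 < u)
      have h2 := Real.rpow_pos_of_pos (ratio_pos hx hu) p
      exact ⟨(by positivity : (0 : ℝ) < Real.exp (-u) * ((x + u) * ratio x u ^ p)).ne', hu⟩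
    exact (by simp : (0 : ENNReal) < volume (Ioi (0 : ℝ))).trans_le (measure_mono this)

lemma irB_nonneg {p x : ℝ} (hx : 0 ≤ x) : 0 ≤ irB p x := by
  refine setIntegral_nonneg measurableSet_Ioi fun u (hu : 0 < u) => ?_
  have h2 := Real.rpow_nonneg (ratio_pos hx hu).le p
  positivity

/-- With `p = a + 1`, `A` solves Kummer's equation, and `A' = -a B`. -/
lemma kummerSol_irA {a : ℝ} (ha : -1 < a) :
    KummerSol a (fun x => (irA (a + 1) x : ℂ)) (fun x => ((-a * irB (a + 1) x : ℝ) : ℂ)) := by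
  have hp : 0 < a + 1 := by linarith
  refine KummerSol.ofReal (fun x hx => (hasDerivAt_irA hp.le hx).congr_deriv (by ring))
    fun x hx => ((hasDerivAt_irB hp.le hx).const_mul (-a)).congr_deriv ?_
  rw [eq_div_iff hx.ne']
  linear_combination (-a) * irA_sub_eq hp hx

lemma continuousAt_irA {p x : ℝ} (hp : 0 < p) (hx : 0 < x) :
    ContinuousAt (fun p => irA p x) p := by
  refine continuousAt_of_dominated (bound := fun u => Real.exp (-u) * (x + u))
    (Eventually.of_forall fun q => aesm_irA q x) ?_ (integrableOn_exp_neg_mul_add x) ?_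
  · filter_upwards [lt_mem_nhds hp] with q hq
    filter_upwards [ae_restrict_mem measurableSet_Ioi] with u (hu : 0 < u)
    have h1 := ratio_rpow_le_one hx.le hu hq.le
    have h2 := Real.rpow_nonneg (ratio_pos hx.le hu).le q
    rw [Real.norm_of_nonneg (by positivity)]
    gcongr
    exact mul_le_of_le_one_right (by positivity) h1
  · filter_upwards [ae_restrict_mem measurableSet_Ioi] with u (hu : 0 < u)
    have hr := (ratio_pos hx.le hu).ne'
    exact continuousAt_const.mul (continuousAt_const.mul (Real.continuousAt_const_rpow hr))

lemma continuousAt_irB {p x : ℝ} (hp : 0 < p) (hx : 0 < x) :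
    ContinuousAt (fun p => irB p x) p := by
  refine continuousAt_of_dominated (bound := fun u => Real.exp (-u))
    (Eventually.of_forall fun q => aesm_irB q x) ?_ integrableOn_exp_neg ?_
  · filter_upwards [lt_mem_nhds hp] with q hq
    filter_upwards [ae_restrict_mem measurableSet_Ioi] with u (hu : 0 < u)
    have h1 := ratio_rpow_le_one hx.le hu hq.le
    have h2 := Real.rpow_nonneg (ratio_pos hx.le hu).le q
    rw [Real.norm_of_nonneg (by positivity)]
    exact mul_le_of_le_one_right (Real.exp_pos _).le h1
  · filter_upwards [ae_restrict_mem measurableSet_Ioi] with u (hu : 0 < u)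
    have hr := (ratio_pos hx.le hu).ne'
    exact continuousAt_const.mul (Real.continuousAt_const_rpow hr)

/-! ### Behaviour of the infrared solution at the boundary -/

lemma tendsto_ratio {u : ℝ} (hu : 0 < u) : Tendsto (fun x => ratio x u) (𝓝[>] 0) (𝓝 1) := by
  have h : ContinuousAt (fun x => ratio x u) 0 := by
    unfold ratio
    exact continuousAt_const.div (by fun_prop) (by simpa using hu.ne')
  have h2 : ratio 0 u = 1 := by rw [ratio, zero_add, div_self hu.ne']
  rw [← h2]
  exact h.tendsto.mono_left nhdsWithin_le_nhds

lemma tendsto_ratio_rpow {p u : ℝ} (hu : 0 < u) :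
    Tendsto (fun x => ratio x u ^ p) (𝓝[>] 0) (𝓝 1) := by
  simpa using (tendsto_ratio hu).rpow_const (p := p) (Or.inl one_ne_zero)

lemma Ioc_zero_one_mem : Ioc (0 : ℝ) 1 ∈ 𝓝[>] (0 : ℝ) := Ioc_mem_nhdsGT one_pos

lemma tendsto_irB {p : ℝ} (hp : 0 ≤ p) : Tendsto (irB p) (𝓝[>] 0) (𝓝 1) := by
  have h1 : ∫ u in Ioi (0 : ℝ), Real.exp (-u) * 1 = 1 := by
    simp only [mul_one]
    exact integral_exp_neg_Ioi_zero
  rw [← h1]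
  refine tendsto_integral_filter_of_dominated_convergence (fun u => Real.exp (-u))
    (Eventually.of_forall fun x => aesm_irB p x) ?_ integrableOn_exp_neg ?_
  · filter_upwards [Ioc_zero_one_mem] with x hx
    filter_upwards [ae_restrict_mem measurableSet_Ioi] with u (hu : 0 < u)
    have h1 := ratio_rpow_le_one hx.1.le hu hp
    have h2 := Real.rpow_nonneg (ratio_pos hx.1.le hu).le p
    rw [Real.norm_of_nonneg (by positivity)]
    exact mul_le_of_le_one_right (Real.exp_pos _).le h1
  · filter_upwards [ae_restrict_mem measurableSet_Ioi] with u (hu : 0 < u)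
    exact (tendsto_ratio_rpow hu).const_mul _

lemma tendsto_irA {p : ℝ} (hp : 0 ≤ p) : Tendsto (irA p) (𝓝[>] 0) (𝓝 1) := by
  have h1 : ∫ u in Ioi (0 : ℝ), Real.exp (-u) * ((0 + u) * 1) = 1 := by
    have := Real.Gamma_eq_integral (s := 2) (by norm_num)
    norm_num [Real.Gamma_two] at this
    simp only [zero_add, mul_one]
    exact this.symm
  rw [← h1]
  refine tendsto_integral_filter_of_dominated_convergence (fun u => Real.exp (-u) * (1 + u))
    (Eventually.of_forall fun x => aesm_irA p x) ?_ (integrableOn_exp_neg_mul_add 1) ?_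
  · filter_upwards [Ioc_zero_one_mem] with x hx
    filter_upwards [ae_restrict_mem measurableSet_Ioi] with u (hu : 0 < u)
    have h1 := ratio_rpow_le_one hx.1.le hu hp
    have h2 := Real.rpow_nonneg (ratio_pos hx.1.le hu).le p
    have h3 := hx.1
    rw [Real.norm_of_nonneg (by positivity)]
    gcongr
    exact (mul_le_of_le_one_right (by positivity) h1).trans (by linarith [hx.2])
  · filter_upwards [ae_restrict_mem measurableSet_Ioi] with u (hu : 0 < u)
    have h4 : Tendsto (fun x : ℝ => x + u) (𝓝[>] 0) (𝓝 (0 + u)) :=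
      ((continuous_id.add continuous_const).tendsto 0).mono_left nhdsWithin_le_nhds
    exact (h4.mul (tendsto_ratio_rpow hu)).const_mul _

/-! ### An integral for the digamma function -/

/-- Gauss' integral `∫₀^∞ (1 - (v/(1+v))^p) / (1+v) dv = ψ(p+1) + γ`. -/
def psiInt (p : ℝ) : ℝ := ∫ v in Ioi (0 : ℝ), (1 - ratio 1 v ^ p) / (1 + v)

lemma integral_ratio_rpow {q : ℝ} (hq : 0 ≤ q) :
    IntegrableOn (fun v : ℝ => ratio 1 v ^ q / (1 + v) ^ 2) (Ioi 0) ∧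
      ∫ v in Ioi (0 : ℝ), ratio 1 v ^ q / (1 + v) ^ 2 = 1 / (q + 1) := by
  have hcont : ContinuousWithinAt (fun v : ℝ => ratio 1 v ^ (q + 1) / (q + 1)) (Ici 0) 0 := by
    refine ContinuousAt.continuousWithinAt ?_
    have h1 : ContinuousAt (ratio 1) 0 := by
      unfold ratio
      exact continuousAt_id.div (by fun_prop) (by norm_num)
    exact (h1.rpow_const (Or.inr (by linarith))).div_const _
  have hd : ∀ v ∈ Ioi (0 : ℝ), HasDerivAt (fun v : ℝ => ratio 1 v ^ (q + 1) / (q + 1))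
      (ratio 1 v ^ q / (1 + v) ^ 2) v := by
    intro v (hv : 0 < v)
    have hne : 1 + v ≠ 0 := by positivity
    have h1 : HasDerivAt (ratio 1) (1 / (1 + v) ^ 2) v := by
      refine ((hasDerivAt_id v).fun_div ((hasDerivAt_id v).const_add 1) hne).congr_deriv ?_
      simp only [id]; ring
    refine ((h1.rpow_const (p := q + 1) (Or.inl (ratio_pos zero_le_one hv).ne')).div_const
      (q + 1)).congr_deriv ?_
    rw [add_sub_cancel_right]
    field_simp
  have hnn : ∀ v ∈ Ioi (0 : ℝ), 0 ≤ ratio 1 v ^ q / (1 + v) ^ 2 := by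
    intro v (hv : 0 < v)
    have := Real.rpow_nonneg (ratio_pos zero_le_one hv).le q
    positivity
  have hlim : Tendsto (fun v : ℝ => ratio 1 v ^ (q + 1) / (q + 1)) atTop (𝓝 (1 / (q + 1))) := by
    have h1 : Tendsto (ratio 1) atTop (𝓝 1) := by
      have h2 : Tendsto (fun v : ℝ => 1 - (1 + v)⁻¹) atTop (𝓝 (1 - 0)) :=
        (tendsto_inv_atTop_zero.comp (tendsto_atTop_add_const_left _ 1 tendsto_id)).const_sub 1
      rw [sub_zero] at h2
      refine h2.congr' ?_
      filter_upwards [eventually_gt_atTop 0] with v hv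
      unfold ratio
      field_simp
      ring
    have h3 := (h1.rpow_const (p := q + 1) (Or.inl one_ne_zero)).div_const (q + 1)
    rwa [Real.one_rpow] at h3
  refine ⟨integrableOn_Ioi_deriv_of_nonneg hcont hd hnn hlim, ?_⟩
  rw [integral_Ioi_of_hasDerivAt_of_nonneg hcont hd hnn hlim]
  simp [ratio, Real.zero_rpow (by linarith : q + 1 ≠ 0)]

/-- Expanding `1 + v = ∑ ρⁿ`, `ρ = v/(1+v)`, gives the series of `psiInt p`. -/
lemma hasSum_psiInt {p : ℝ} (hp : 0 < p) :
    HasSum (fun n : ℕ => 1 / ((n : ℝ) + 1) - 1 / ((n : ℝ) + (p + 1))) (psiInt p) := by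
  set F : ℕ → ℝ → ℝ := fun n v =>
    ratio 1 v ^ (n : ℝ) / (1 + v) ^ 2 - ratio 1 v ^ ((n : ℝ) + p) / (1 + v) ^ 2 with hF
  have hFn : ∀ n v, 0 < v → F n v = (ratio 1 v) ^ n * ((1 - ratio 1 v ^ p) / (1 + v) ^ 2) := by
    intro n v hv
    simp only [hF]
    rw [Real.rpow_add (ratio_pos zero_le_one hv), Real.rpow_natCast]
    ring
  have hFnn : ∀ n v, 0 < v → 0 ≤ F n v := by
    intro n v hv
    rw [hFn n v hv]
    have h1 := ratio_rpow_le_one zero_le_one hv hp.le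
    have h2 := ratio_pos zero_le_one hv
    have h3 : 0 ≤ 1 - ratio 1 v ^ p := by linarith
    positivity
  have hn : ∀ n : ℕ, (0 : ℝ) ≤ n := fun n => Nat.cast_nonneg n
  have hint : ∀ n, IntegrableOn (F n) (Ioi 0) := fun n =>
    (integral_ratio_rpow (hn n)).1.sub (integral_ratio_rpow (add_nonneg (hn n) hp.le)).1
  have hval : ∀ n, ∫ v in Ioi (0 : ℝ), F n v = 1 / ((n : ℝ) + 1) - 1 / ((n : ℝ) + (p + 1)) := by
    intro n
    simp only [hF]
    rw [integral_sub (integral_ratio_rpow (hn n)).1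
      (integral_ratio_rpow (add_nonneg (hn n) hp.le)).1, (integral_ratio_rpow (hn n)).2,
      (integral_ratio_rpow (add_nonneg (hn n) hp.le)).2, add_assoc]
  have hsum : Summable fun n : ℕ => 1 / ((n : ℝ) + 1) - 1 / ((n : ℝ) + (p + 1)) := by
    have h := summable_digamma ((p + 1 : ℝ) : ℂ)
    rw [← Complex.summable_ofReal]
    refine h.congr fun n => ?_
    push_cast
    ring
  have h := hasSum_integral_of_summable_integral_norm (μ := volume.restrict (Ioi (0 : ℝ)))
    (F := F) hint (by
      refine hsum.congr fun n => ?_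
      rw [← hval]
      refine setIntegral_congr_fun measurableSet_Ioi fun v (hv : 0 < v) => ?_
      exact (Real.norm_of_nonneg (hFnn n v hv)).symm)
  simp only [hval] at h
  have e : ∫ v in Ioi (0 : ℝ), ∑' n, F n v = psiInt p := by
    refine setIntegral_congr_fun measurableSet_Ioi fun v (hv : 0 < v) => ?_
    have h2 := ratio_pos zero_le_one hv
    have h3 : ratio 1 v < 1 := by
      rw [ratio, div_lt_one (by positivity)]; linarith
    have h4 : 1 - ratio 1 v = (1 + v)⁻¹ := by unfold ratio; field_simp; ring
    simp only [hFn _ v hv]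
    rw [tsum_mul_right, tsum_geometric_of_lt_one h2.le h3, h4]
    field_simp
  rwa [e] at h

lemma digamma_eq_psiInt {p : ℝ} (hp : 0 < p) :
    Complex.digamma ((p : ℂ) + 1) = ((psiInt p - Real.eulerMascheroniConstant : ℝ) : ℂ) := by
  have h1 := hasSum_digamma_of_re_pos (s := (p : ℂ) + 1) (by simp; linarith)
  have h2 := Complex.hasSum_ofReal.2 (hasSum_psiInt hp)
  have h3 := h1.unique (h2.congr_fun fun n => by push_cast; ring)
  push_cast
  linear_combination h3

lemma one_sub_rpow_le {ρ p : ℝ} (h0 : 0 < ρ) (h1 : ρ ≤ 1) :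
    1 - ρ ^ p ≤ max 1 p * (1 - ρ) := by
  rcases le_total 1 p with h | h
  · have := one_add_mul_self_le_rpow_one_add (s := ρ - 1) (by linarith) h
    rw [add_sub_cancel] at this
    rw [max_eq_right h]
    linarith
  · have := Real.rpow_le_rpow_of_exponent_ge h0 h1 h
    rw [Real.rpow_one] at this
    rw [max_eq_left h]
    linarith

/-- The part of `C` that stays finite at the boundary, after rescaling `u = x v`. -/
lemma tendsto_psiInt {p : ℝ} (hp : 0 < p) :
    Tendsto (fun x => ∫ u in Ioi (0 : ℝ), Real.exp (-u) * ((1 - ratio x u ^ p) / (x + u)))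
      (𝓝[>] 0) (𝓝 (psiInt p)) := by
  have e : ∀ x : ℝ, 0 < x → ∫ u in Ioi (0 : ℝ), Real.exp (-u) * ((1 - ratio x u ^ p) / (x + u))
      = ∫ v in Ioi (0 : ℝ), Real.exp (-(x * v)) * ((1 - ratio 1 v ^ p) / (1 + v)) := by
    intro x hx
    have h := integral_comp_mul_left_Ioi
      (fun u : ℝ => Real.exp (-u) * ((1 - ratio x u ^ p) / (x + u))) 0 hx
    rw [mul_zero, smul_eq_mul, eq_inv_mul_iff_mul_eq₀ hx.ne'] at h
    rw [← h, ← integral_const_mul]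
    refine setIntegral_congr_fun measurableSet_Ioi fun v (hv : 0 < v) => ?_
    have h1 : ratio x (x * v) = ratio 1 v := by unfold ratio; field_simp
    simp only [h1]
    field_simp
  have hm : Measurable (ratio 1) := measurable_ratio 1
  have hlim : Tendsto (fun x => ∫ v in Ioi (0 : ℝ), Real.exp (-(x * v))
      * ((1 - ratio 1 v ^ p) / (1 + v))) (𝓝[>] 0) (𝓝 (psiInt p)) := by
    refine tendsto_integral_filter_of_dominated_convergence
      (fun v => max 1 p * (ratio 1 v ^ (0 : ℝ) / (1 + v) ^ 2)) (Eventually.of_forall fun x =>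
        (by fun_prop : Measurable _).aestronglyMeasurable) ?_
      ((integral_ratio_rpow le_rfl).1.const_mul _) ?_
    · filter_upwards [self_mem_nhdsWithin] with x (hx : 0 < x)
      filter_upwards [ae_restrict_mem measurableSet_Ioi] with v (hv : 0 < v)
      have h1 := ratio_rpow_le_one zero_le_one hv hp.le
      have h2 : 0 ≤ 1 - ratio 1 v ^ p := by linarith
      have h3 := one_sub_rpow_le (p := p) (ratio_pos zero_le_one hv) (ratio_le_one zero_le_one hv)
      have h4 : 1 - ratio 1 v = 1 / (1 + v) := by unfold ratio; field_simp; ring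
      have h5 : Real.exp (-(x * v)) ≤ 1 := Real.exp_le_one_iff.2 (by nlinarith)
      rw [Real.norm_of_nonneg (by positivity), Real.rpow_zero]
      rw [h4] at h3
      calc Real.exp (-(x * v)) * ((1 - ratio 1 v ^ p) / (1 + v))
          ≤ 1 * ((1 - ratio 1 v ^ p) / (1 + v)) := by gcongr
        _ ≤ 1 * ((max 1 p * (1 / (1 + v))) / (1 + v)) := by gcongr
        _ = max 1 p * (1 / (1 + v) ^ 2) := by field_simp
    · filter_upwards [ae_restrict_mem measurableSet_Ioi] with v (hv : 0 < v)
      have h1 : Tendsto (fun x : ℝ => Real.exp (-(x * v))) (𝓝 0) (𝓝 (Real.exp (-(0 * v)))) :=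
        (by fun_prop : Continuous fun x : ℝ => Real.exp (-(x * v))).tendsto 0
      rw [zero_mul, neg_zero, Real.exp_zero] at h1
      simpa using (h1.mono_left nhdsWithin_le_nhds).mul_const ((1 - ratio 1 v ^ p) / (1 + v))
  refine hlim.congr' ?_
  filter_upwards [self_mem_nhdsWithin] with x hx
  exact (e x hx).symm

/-! ### The logarithmic integral -/

lemma integral_exp_neg_mul_log :
    ∫ u in Ioi (0 : ℝ), Real.exp (-u) * Real.log u = -Real.eulerMascheroniConstant := by
  have h1 := Complex.hasDerivAt_GammaIntegral (s := 1) (by simp)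
  have h2 : HasDerivAt Complex.Gamma (∫ t in Ioi (0 : ℝ), (t : ℂ) ^ ((1 : ℂ) - 1)
      * ((Real.log t : ℂ) * (Real.exp (-t) : ℂ))) 1 := by
    refine h1.congr_of_eventuallyEq ?_
    have : ∀ᶠ s : ℂ in 𝓝 1, 0 < s.re :=
      Complex.continuous_re.continuousAt.eventually (lt_mem_nhds (by simp))
    filter_upwards [this] with s hs
    exact Complex.Gamma_eq_integral hs
  have h3 := h2.unique Complex.hasDerivAt_Gamma_one
  have e : ∀ t : ℝ, (t : ℂ) ^ ((1 : ℂ) - 1) * ((Real.log t : ℂ) * (Real.exp (-t) : ℂ))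
      = ((Real.exp (-t) * Real.log t : ℝ) : ℂ) := fun t => by
    rw [sub_self, Complex.cpow_zero]; push_cast; ring
  simp only [e] at h3
  have h4 := h3.symm.trans (integral_ofReal (𝕜 := ℂ)
    (f := fun t : ℝ => Real.exp (-t) * Real.log t) (μ := volume.restrict (Ioi (0 : ℝ))))
  apply Complex.ofReal_injective
  rw [Complex.ofReal_neg]
  exact h4.symm

lemma abs_log_le {u : ℝ} (hu : 0 < u) : |Real.log u| ≤ 2 * u ^ (-(1 / 2) : ℝ) + u := by
  have h1 : Real.log u ≤ u := (Real.log_le_sub_one_of_pos hu).trans (by linarith)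
  have h2 : -Real.log u ≤ 2 * u ^ (-(1 / 2) : ℝ) := by
    have := Real.log_le_rpow_div (inv_nonneg.2 hu.le) (by norm_num : (0 : ℝ) < 1 / 2)
    rw [Real.log_inv, Real.inv_rpow hu.le, ← Real.rpow_neg hu.le] at this
    linarith
  have h3 := Real.rpow_nonneg hu.le (-(1 / 2) : ℝ)
  exact abs_le.2 ⟨by linarith, by linarith⟩

lemma abs_log_add_le {x u : ℝ} (hx : 0 < x) (hx1 : x ≤ 1) (hu : 0 < u) :
    |Real.log (x + u)| ≤ 2 * u ^ (-(1 / 2) : ℝ) + (1 + 2 * u) := by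
  have h1 := abs_log_le hu
  have h2 : Real.log u ≤ Real.log (x + u) := Real.log_le_log hu (by linarith)
  have h3 : Real.log (x + u) ≤ u := (Real.log_le_sub_one_of_pos (by positivity)).trans (by linarith)
  have h4 := (abs_le.1 h1).1
  have h5 := Real.rpow_nonneg hu.le (-(1 / 2) : ℝ)
  exact abs_le.2 ⟨by linarith, by linarith⟩

lemma integrableOn_log_bound : IntegrableOn
    (fun u : ℝ => Real.exp (-u) * (2 * u ^ (-(1 / 2) : ℝ) + (1 + 2 * u))) (Ioi 0) := by
  have h1 := (integrableOn_exp_neg_mul_rpow (q := 1 / 2) (by norm_num)).const_mul 2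
  have h2 := integrableOn_exp_neg.add (integrableOn_exp_neg_mul_id.const_mul 2)
  refine (h1.add h2).congr (Eventually.of_forall fun u => ?_)
  simp only [Pi.add_apply]
  norm_num
  ring

lemma integrableOn_exp_neg_mul_log {x : ℝ} (hx : 0 < x) (hx1 : x ≤ 1) :
    IntegrableOn (fun u : ℝ => Real.exp (-u) * Real.log (x + u)) (Ioi 0) := by
  refine Integrable.mono' integrableOn_log_bound
    (by fun_prop : Measurable _).aestronglyMeasurable ?_
  filter_upwards [ae_restrict_mem measurableSet_Ioi] with u (hu : 0 < u)
  rw [norm_mul, Real.norm_of_nonneg (Real.exp_pos _).le, Real.norm_eq_abs]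
  exact mul_le_mul_of_nonneg_left (abs_log_add_le hx hx1 hu) (Real.exp_pos _).le

lemma tendsto_integral_exp_neg_mul_log :
    Tendsto (fun x => ∫ u in Ioi (0 : ℝ), Real.exp (-u) * Real.log (x + u)) (𝓝[>] 0)
      (𝓝 (-Real.eulerMascheroniConstant)) := by
  rw [← integral_exp_neg_mul_log]
  refine tendsto_integral_filter_of_dominated_convergence _ (Eventually.of_forall fun x =>
      (by fun_prop : Measurable _).aestronglyMeasurable) ?_ integrableOn_log_bound ?_
  · filter_upwards [Ioc_zero_one_mem] with x hx
    filter_upwards [ae_restrict_mem measurableSet_Ioi] with u (hu : 0 < u)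
    rw [norm_mul, Real.norm_of_nonneg (Real.exp_pos _).le, Real.norm_eq_abs]
    exact mul_le_mul_of_nonneg_left (abs_log_add_le hx.1 hx.2 hu) (Real.exp_pos _).le
  · filter_upwards [ae_restrict_mem measurableSet_Ioi] with u (hu : 0 < u)
    have h : ContinuousAt (fun x : ℝ => Real.exp (-u) * Real.log (x + u)) 0 :=
      continuousAt_const.mul (ContinuousAt.log (by fun_prop) (by simpa using hu.ne'))
    have := h.tendsto.mono_left (nhdsWithin_le_nhds (s := Ioi 0))
    rwa [zero_add] at this

lemma irC_zero_eq {x : ℝ} (hx : 0 < x) (hx1 : x ≤ 1) :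
    IntegrableOn (fun u : ℝ => Real.exp (-u) * (1 / (x + u))) (Ioi 0) ∧
    ∫ u in Ioi (0 : ℝ), Real.exp (-u) * (1 / (x + u))
      = -Real.log x + ∫ u in Ioi (0 : ℝ), Real.exp (-u) * Real.log (x + u) := by
  have i1 : IntegrableOn (fun u : ℝ => Real.exp (-u) * (1 / (x + u))) (Ioi 0) := by
    refine (integrableOn_irC le_rfl hx).congr (Eventually.of_forall fun u => ?_)
    simp only [Real.rpow_zero]
  have i2 := integrableOn_exp_neg_mul_log hx hx1
  have hd : ∀ u ∈ Ici (0 : ℝ), HasDerivAt (fun u : ℝ => Real.exp (-u) * Real.log (x + u))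
      (Real.exp (-u) * (1 / (x + u)) - Real.exp (-u) * Real.log (x + u)) u := by
    intro u (hu : 0 ≤ u)
    have hne : x + u ≠ 0 := by positivity
    have h2 : HasDerivAt (fun u : ℝ => Real.exp (-u)) (-Real.exp (-u)) u := by
      simpa using (hasDerivAt_neg u).exp
    refine (h2.fun_mul (((hasDerivAt_id u).const_add x).log hne)).congr_deriv ?_
    simp only [id]; ring
  have hlim : Tendsto (fun u : ℝ => Real.exp (-u) * Real.log (x + u)) atTop (𝓝 0) := by
    have h1 : Tendsto (fun u : ℝ => x * Real.exp (-u) + u * Real.exp (-u)) atTop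
        (𝓝 (x * 0 + 0)) := by
      refine Tendsto.add ?_ ?_
      · exact (Real.tendsto_exp_neg_atTop_nhds_zero).const_mul x
      · simpa using Real.tendsto_pow_mul_exp_neg_atTop_nhds_zero 1
    rw [mul_zero, add_zero] at h1
    refine squeeze_zero' ?_ ?_ h1
    · filter_upwards [eventually_ge_atTop 1] with u hu
      exact mul_nonneg (Real.exp_pos _).le (Real.log_nonneg (by linarith))
    · filter_upwards [eventually_ge_atTop 1] with u hu
      have : Real.log (x + u) ≤ x + u :=
        (Real.log_le_sub_one_of_pos (by positivity)).trans (by linarith)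
      nlinarith [Real.exp_pos (-u)]
  have h := integral_Ioi_of_hasDerivAt_of_tendsto
    (hd 0 self_mem_Ici).continuousAt.continuousWithinAt
    (fun u hu => hd u (Ioi_subset_Ici_self hu)) (i1.sub i2) hlim
  rw [integral_sub i1 i2] at h
  simp only [neg_zero, Real.exp_zero, one_mul, add_zero, zero_sub] at h
  exact ⟨i1, by linarith⟩

/-! ### Asymptotics of `A`, `B`, `C` at the boundary -/

/-- The constant `κ = 2γ + ψ(p+1)`. -/
def kappa (p : ℝ) : ℝ := Real.eulerMascheroniConstant + psiInt p

lemma tendsto_irC_add_log {p : ℝ} (hp : 0 < p) :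
    Tendsto (fun x => irC p x + Real.log x) (𝓝[>] 0) (𝓝 (-kappa p)) := by
  have h := tendsto_integral_exp_neg_mul_log.sub (tendsto_psiInt hp)
  have e : -Real.eulerMascheroniConstant - psiInt p = -kappa p := by rw [kappa]; ring
  rw [e] at h
  refine h.congr' ?_
  filter_upwards [Ioc_zero_one_mem] with x hx
  obtain ⟨i1, h1⟩ := irC_zero_eq hx.1 hx.2
  have i2 := integrableOn_irC hp.le hx.1
  have h2 : ∫ u in Ioi (0 : ℝ), Real.exp (-u) * ((1 - ratio x u ^ p) / (x + u))
      = (∫ u in Ioi (0 : ℝ), Real.exp (-u) * (1 / (x + u))) - irC p x := by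
    rw [irC, ← integral_sub i1 i2]
    congr 1
    ext u
    ring
  rw [h2, h1]
  ring

lemma tendsto_irA_slope {p : ℝ} (hp : 0 < p) :
    Tendsto (fun x => (irA p x - 1) / x) (𝓝[>] 0) (𝓝 (1 - p)) := by
  refine HasDerivAt.lhopital_zero_nhdsGT (f' := fun x => (1 - p) * irB p x) (g' := fun _ => 1)
    ?_ ?_ ?_ ?_ ?_ ?_
  · filter_upwards [self_mem_nhdsWithin] with x hx
    exact (hasDerivAt_irA hp.le hx).sub_const 1
  · exact Eventually.of_forall fun x => hasDerivAt_id x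
  · exact Eventually.of_forall fun x => one_ne_zero
  · simpa using (tendsto_irA hp.le).sub_const 1
  · exact (continuous_id.tendsto (0 : ℝ)).mono_left nhdsWithin_le_nhds
  · simpa using (tendsto_irB hp.le).const_mul (1 - p)

lemma tendsto_id_nhdsGT : Tendsto (fun x : ℝ => x) (𝓝[>] 0) (𝓝 0) :=
  (continuous_id.tendsto (0 : ℝ)).mono_left nhdsWithin_le_nhds

lemma tendsto_id_mul_log : Tendsto (fun x : ℝ => x * Real.log x) (𝓝[>] 0) (𝓝 0) := by
  have := Real.continuous_mul_log.tendsto 0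
  simp only [zero_mul] at this
  exact this.mono_left nhdsWithin_le_nhds

/-- The expansion `B = 1 + p x (log x + κ - 1) + o(x)`, from the integration by parts relation. -/
lemma tendsto_irB_slope {p : ℝ} (hp : 0 < p) :
    Tendsto (fun x => (irB p x - 1) / x - p * Real.log x) (𝓝[>] 0) (𝓝 (p * (kappa p - 1))) := by
  have h := ((((tendsto_irA_slope hp).sub ((tendsto_irC_add_log hp).const_mul p)).sub_const 1).sub
    (tendsto_id_mul_log.const_mul p)).div (tendsto_id_nhdsGT.const_add 1) (by norm_num)
  have e : (1 - p - p * -kappa p - 1 - p * 0) / (1 + 0) = p * (kappa p - 1) := by ring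
  rw [e] at h
  refine h.congr' ?_
  filter_upwards [self_mem_nhdsWithin] with x (hx : 0 < x)
  have h1 := irA_sub_eq hp hx
  have hne : 1 + x ≠ 0 := by positivity
  simp only [Pi.div_apply]
  rw [div_eq_iff hne]
  field_simp
  linear_combination h1

/-- The expansion `A = 1 + (1-p) x + (1-p) p/2 · x² (log x + κ - 3/2) + o(x²)`, by L'Hôpital's rule
and the expansion of `A' = (1-p) B`. -/
lemma tendsto_irA_second {p : ℝ} (hp : 0 < p) :
    Tendsto (fun x => (irA p x - 1 - (1 - p) * x - (1 - p) * p / 2 * (x ^ 2 * Real.log x)) / x ^ 2)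
      (𝓝[>] 0) (𝓝 ((1 - p) * p / 2 * (kappa p - 3 / 2))) := by
  refine HasDerivAt.lhopital_zero_nhdsGT
    (f' := fun x => (1 - p) * irB p x - (1 - p) - (1 - p) * p / 2 * (2 * x * Real.log x + x))
    (g' := fun x => 2 * x) ?_ ?_ ?_ ?_ ?_ ?_
  · filter_upwards [self_mem_nhdsWithin] with x (hx : 0 < x)
    have h1 : HasDerivAt (fun x : ℝ => x ^ 2 * Real.log x) (2 * x * Real.log x + x) x := by
      refine ((hasDerivAt_pow 2 x).fun_mul (Real.hasDerivAt_log hx.ne')).congr_deriv ?_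
      norm_num
      field_simp
    have h2 : HasDerivAt (fun x : ℝ => (1 - p) * x) (1 - p) x := by
      simpa using (hasDerivAt_id x).const_mul (1 - p)
    exact (((hasDerivAt_irA hp.le hx).sub_const 1).sub h2).sub (h1.const_mul _)
  · filter_upwards with x
    simpa using hasDerivAt_pow 2 x
  · filter_upwards [self_mem_nhdsWithin] with x (hx : 0 < x)
    positivity
  · have h := (((tendsto_irA hp.le).sub_const 1).sub (tendsto_id_nhdsGT.const_mul (1 - p))).sub
      ((tendsto_id_nhdsGT.mul tendsto_id_mul_log).const_mul ((1 - p) * p / 2))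
    have e : (1 : ℝ) - 1 - (1 - p) * 0 - (1 - p) * p / 2 * (0 * 0) = 0 := by ring
    rw [e] at h
    refine h.congr fun x => ?_
    ring
  · simpa using tendsto_id_nhdsGT.pow 2
  · have h := ((tendsto_irB_slope hp).sub_const (p / 2)).const_mul ((1 - p) / 2)
    have e : (1 - p) / 2 * (p * (kappa p - 1) - p / 2) = (1 - p) * p / 2 * (kappa p - 3 / 2) := by
      ring
    rw [e] at h
    refine h.congr' ?_
    filter_upwards [self_mem_nhdsWithin] with x (hx : 0 < x)
    field_simp
    ring

/-! ### The connection formula -/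

lemma hasDerivAt_mbQ_mul_exp {a : ℝ} {s d : ℂ} (h : HasDerivAt (mbQ a) d s) (ζ : ℂ) :
    HasDerivAt (fun s => mbQ a s * Complex.exp (ζ * s))
      ((d + mbQ a s * ζ) * Complex.exp (ζ * s)) s := by
  have h1 : HasDerivAt (fun s : ℂ => ζ * s) ζ s := by
    simpa using (hasDerivAt_id s).const_mul ζ
  exact (h.fun_mul h1.cexp).congr_deriv (by ring)

/-- The Meijer function at the boundary up to `o(x²)`: the residues at `0`, `1`, `2`. -/
lemma tendsto_meijerX {a : ℝ} {D : ℂ} (hD : HasDerivAt (mbQ a) D 2) :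
    Tendsto (fun x : ℝ => (meijerX a x - ((Complex.Gamma (1 - a))⁻¹ + (Complex.Gamma (-a))⁻¹ * x
      - (D + mbQ a 2 * logNeg x) * (x : ℂ) ^ 2)) / (x : ℂ) ^ 2) (𝓝[>] 0) (𝓝 0) := by
  obtain ⟨C, hC⟩ := exists_norm_loopInt_le a
  have hlim : Tendsto (fun x : ℝ => ‖(2 * Real.pi * Complex.I : ℂ)⁻¹‖ * C * x ^ (1 / 2 : ℝ)) (𝓝[>] 0)
      (𝓝 0) := by
    have h1 : Tendsto (fun x : ℝ => x ^ (1 / 2 : ℝ)) (𝓝 0) (𝓝 ((0 : ℝ) ^ (1 / 2 : ℝ))) :=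
      (Real.continuous_rpow_const (by norm_num)).tendsto 0
    rw [Real.zero_rpow (by norm_num)] at h1
    simpa using (h1.mono_left nhdsWithin_le_nhds).const_mul
      (‖(2 * Real.pi * Complex.I : ℂ)⁻¹‖ * C)
  refine squeeze_zero_norm' ?_ hlim
  filter_upwards [Ioc_zero_one_mem] with x hx
  have hx0 : 0 < x := hx.1
  have hpi : (2 * Real.pi * Complex.I : ℂ) ≠ 0 := by simp [Real.pi_ne_zero]
  have e0 := (hasDerivAt_mbQ_mul_exp (mbQ_hasDerivAt_zero a) (logNeg x)).deriv
  have e1 := (hasDerivAt_mbQ_mul_exp (mbQ_hasDerivAt_one a) (logNeg x)).deriv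
  have e2 := (hasDerivAt_mbQ_mul_exp hD (logNeg x)).deriv
  have q0 : mbQ a 0 = 0 := by simp [mbQ]
  have q1 : mbQ a 1 = 0 := by simp [mbQ]
  rw [q0, mul_zero, Complex.exp_zero] at e0
  rw [q1, mul_one, exp_logNeg hx0] at e1
  rw [show logNeg x * 2 = ((2 : ℕ) : ℂ) * logNeg x by push_cast; ring, Complex.exp_nat_mul,
    exp_logNeg hx0] at e2
  have e : meijerX a x - ((Complex.Gamma (1 - a))⁻¹ + (Complex.Gamma (-a))⁻¹ * x
      - (D + mbQ a 2 * logNeg x) * (x : ℂ) ^ 2)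
      = (2 * Real.pi * Complex.I)⁻¹ *
        loopInt (5 / 2) (fun s => mbG a s * Complex.exp (logNeg x * s)) := by
    rw [meijerX_eq a hx0, loopLaplace_mbG_eq]
    simp only [Finset.sum_range_succ, Finset.range_zero, Finset.sum_empty, Nat.cast_zero,
      Nat.cast_one, Nat.cast_ofNat]
    rw [e0, e1, e2, mul_sub, ← mul_assoc, inv_mul_cancel₀ hpi]
    ring
  rw [e, norm_div, norm_mul, norm_pow, Complex.norm_real, Real.norm_of_nonneg hx0.le,
    div_le_iff₀ (by positivity)]
  have e3 : x ^ (1 / 2 : ℝ) * x ^ 2 = x ^ (5 / 2 : ℝ) := by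
    rw [← Real.rpow_natCast x 2, ← Real.rpow_add hx0]; norm_num
  refine (mul_le_mul_of_nonneg_left (hC x hx0 hx.2) (norm_nonneg _)).trans_eq ?_
  rw [← e3]
  ring

lemma tendsto_ofReal_of_tendsto {f : ℝ → ℝ} {l : Filter ℝ} {c : ℝ} (h : Tendsto f l (𝓝 c)) :
    Tendsto (fun x => (f x : ℂ)) l (𝓝 (c : ℂ)) :=
  (Complex.continuous_ofReal.tendsto c).comp h

/-- The connection formula: the Meijer function is `-e^{iπa} Γ(a+2)/2` times the regular solution
plus `1/Γ(1-a)` times the infrared solution. Both sides agree up to `o(x²)` at the origin. -/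
lemma meijerX_eq_solS_add_irA {a : ℝ} (ha : -1 < a) {x : ℝ} (hx : 0 < x) :
    meijerX a x = -(Complex.exp (Complex.I * Real.pi * a) * Complex.Gamma (a + 2) / 2) * solS a x
      + (Complex.Gamma (1 - a))⁻¹ * irA (a + 1) x := by
  have hp : 0 < a + 1 := by linarith
  obtain ⟨hD, hq⟩ := mbQ_hasDerivAt_two (a := a) (by linarith)
  set D : ℂ := ((Real.eulerMascheroniConstant : ℂ) - 3 / 4) *
        (Complex.Gamma (a + 2) * Complex.sin (Real.pi * a) / Real.pi) +
      1 / 2 * (deriv Complex.Gamma (a + 2) * Complex.sin (Real.pi * a) / Real.pi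
        + Complex.Gamma (a + 2) * Complex.cos (Real.pi * a)) with hDdef
  set r : ℂ := (Complex.Gamma (1 - a))⁻¹ with hr
  set c₁ : ℂ := Complex.exp (Complex.I * Real.pi * a) * Complex.Gamma (a + 2) / 2 with hc₁
  have hpi : (Real.pi : ℂ) ≠ 0 := by exact_mod_cast Real.pi_ne_zero
  have hr1 : (Complex.Gamma (-a))⁻¹ = -a * r := by
    rw [Complex.one_div_Gamma_eq_self_mul_one_div_Gamma_add_one, hr]
    congr 3; ring
  have hq2 : mbQ a 2 = (a * (a + 1) / 2 : ℝ) * r := by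
    have h1 := Complex.one_div_Gamma_eq_self_mul_one_div_Gamma_add_one (1 - a - 2)
    have h2 : (1 : ℂ) - a - 2 + 1 = -a := by ring
    have h3 : Complex.Gamma (1 + 2) = 2 := by
      rw [show (1 : ℂ) + 2 = ((2 : ℕ) : ℂ) + 1 by norm_num, Complex.Gamma_nat_eq_factorial]
      norm_num [Nat.factorial]
    rw [h2, hr1] at h1
    rw [mbQ, h1, h3]
    push_cast
    ring
  have hΓ : Complex.Gamma (a + 2) ≠ 0 :=
    Complex.Gamma_ne_zero_of_re_pos (by simp; linarith)
  have hψ : deriv Complex.Gamma (a + 2)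
      = ((psiInt (a + 1) - Real.eulerMascheroniConstant : ℝ) : ℂ) * Complex.Gamma (a + 2) := by
    rw [← digamma_eq_psiInt hp, Complex.digamma_def, logDeriv_apply]
    have : ((a + 1 : ℝ) : ℂ) + 1 = a + 2 := by push_cast; ring
    rw [this, div_mul_cancel₀ _ hΓ]
  have hexp : Complex.exp (Complex.I * Real.pi * a)
      = Complex.cos (Real.pi * a) + Complex.sin (Real.pi * a) * Complex.I := by
    rw [← Complex.exp_mul_I]; congr 1; ring
  -- the difference of the two sides is a solution that is `o(x²)`
  have hsol := ((kummerSol_meijerX a).add ((kummerSol_solS a).const_mul c₁)).add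
    ((kummerSol_irA ha).const_mul (-r))
  have hlim : Tendsto (fun x : ℝ => (meijerX a x + c₁ * solS a x + -r * irA (a + 1) x)
      / (x : ℂ) ^ 2) (𝓝[>] 0) (𝓝 0) := by
    have hM : Tendsto (fun x : ℝ => (kummerR a x : ℂ)) (𝓝[>] 0) (𝓝 1) := by
      have := tendsto_ofReal_of_tendsto ((continuous_kummerR a).tendsto 0)
      rw [kummerR_zero, Complex.ofReal_one] at this
      exact this.mono_left nhdsWithin_le_nhds
    have h := ((tendsto_meijerX hD).add (hM.const_mul c₁)).add
      (((tendsto_ofReal_of_tendsto (tendsto_irA_second hp)).const_mul (-r)).add_const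
        (-(D + mbQ a 2 * (Real.pi * Complex.I))))
    have hval : (0 : ℂ) + c₁ * 1 + (-r * (((1 - (a + 1)) * (a + 1) / 2 *
        (kappa (a + 1) - 3 / 2) : ℝ) : ℂ) + -(D + mbQ a 2 * (Real.pi * Complex.I))) = 0 := by
      have h1 : -r * (((1 - (a + 1)) * (a + 1) / 2 * (kappa (a + 1) - 3 / 2) : ℝ) : ℂ)
          = mbQ a 2 * ((kappa (a + 1) - 3 / 2 : ℝ) : ℂ) := by
        rw [hq2]; push_cast; ring
      rw [h1, hq, hDdef, hψ, hc₁, hexp, kappa]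
      push_cast
      field_simp
      ring
    rw [hval] at h
    refine h.congr' ?_
    filter_upwards [self_mem_nhdsWithin] with y (hy : 0 < y)
    have hy' : (y : ℂ) ≠ 0 := by exact_mod_cast hy.ne'
    rw [hr1, hq2]
    simp only [solS, logNeg]
    push_cast
    field_simp
    ring
  have h0 := hsol.eq_zero_of_isLittleO (by linarith) hlim hx
  linear_combination h0

/-! ### The explicit solutions `j_c` -/

/-- The function `j_c` in the variable `x = 3w²/2`. -/
def jX (a : ℝ) (c : ℂ) (x : ℝ) : ℂ := c * meijerX a x + 4 / 9 * solS a x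

/-- The derivative of `jX a c`. -/
def jX' (a : ℝ) (c : ℂ) (x : ℝ) : ℂ := c * meijerX' a x + 4 / 9 * solS' a x

lemma kummerSol_jX (a : ℝ) (c : ℂ) : KummerSol a (jX a c) (jX' a c) :=
  ((kummerSol_meijerX a).const_mul c).add ((kummerSol_solS a).const_mul (4 / 9))

lemma jFun_eq_jX (Λ psq : ℝ) (c : ℂ) (w : ℝ) :
    jFun Λ psq c w = jX (psq / (6 * Λ ^ 2)) c (3 * w ^ 2 / 2) := by
  unfold jFun jX meijerX solS
  rw [kummer_ofReal]
  push_cast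
  ring

lemma hasDerivAt_three_half_sq (w : ℝ) : HasDerivAt (fun w : ℝ => 3 * w ^ 2 / 2) (3 * w) w := by
  refine (((hasDerivAt_pow 2 w).const_mul 3).div_const 2).congr_deriv ?_
  norm_num
  ring

lemma KummerSol.hasDerivAt_comp {f f' : ℝ → ℂ} {a : ℝ} (hf : KummerSol a f f') {w : ℝ}
    (hw : 0 < w) : HasDerivAt (fun w : ℝ => f (3 * w ^ 2 / 2)) (3 * w * f' (3 * w ^ 2 / 2)) w := by
  have h := (hf.hd (3 * w ^ 2 / 2) (by positivity)).scomp w (hasDerivAt_three_half_sq w)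
  refine h.congr_deriv ?_
  rw [Complex.real_smul]
  push_cast
  ring

lemma KummerSol.hasDerivAt_comp' {f f' : ℝ → ℂ} {a : ℝ} (hf : KummerSol a f f') {w : ℝ}
    (hw : 0 < w) : HasDerivAt (fun w : ℝ => f' (3 * w ^ 2 / 2))
      (3 * w * (((1 + 3 * w ^ 2 / 2) * f' (3 * w ^ 2 / 2) + a * f (3 * w ^ 2 / 2))
        / (3 * w ^ 2 / 2))) w := by
  have h := (hf.hd' (3 * w ^ 2 / 2) (by positivity)).scomp w (hasDerivAt_three_half_sq w)
  refine h.congr_deriv ?_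
  rw [Complex.real_smul]
  push_cast
  ring

lemma hasDerivAt_jFun (Λ psq : ℝ) (c : ℂ) {w : ℝ} (hw : 0 < w) :
    HasDerivAt (jFun Λ psq c) (3 * w * jX' (psq / (6 * Λ ^ 2)) c (3 * w ^ 2 / 2)) w := by
  have e : jFun Λ psq c = fun w : ℝ => jX (psq / (6 * Λ ^ 2)) c (3 * w ^ 2 / 2) :=
    funext fun w => jFun_eq_jX Λ psq c w
  rw [e]
  exact (kummerSol_jX _ c).hasDerivAt_comp hw

lemma explicitE_eq (Λ psq : ℝ) (c : ℂ) {w : ℝ} (hw : 0 < w) :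
    explicitE Λ psq c w = -(3 * (w : ℂ) ^ 2 * jX' (psq / (6 * Λ ^ 2)) c (3 * w ^ 2 / 2)
      / jX (psq / (6 * Λ ^ 2)) c (3 * w ^ 2 / 2)) := by
  rw [explicitE, (hasDerivAt_jFun Λ psq c hw).deriv, jFun_eq_jX]
  ring

/-- `𝐄_c = -w j_c'/j_c` turns the linear equation into the Riccati equation. -/
lemma explicitE_riccati {Λ : ℝ} (hΛ : 0 < Λ) (psq : ℝ) (c : ℂ) {w : ℝ} (hw : 0 < w)
    (hj : jFun Λ psq c w ≠ 0) :
    DifferentiableAt ℝ (jFun Λ psq c) w ∧ DifferentiableAt ℝ (explicitE Λ psq c) w ∧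
      (w : ℂ) * deriv (explicitE Λ psq c) w - explicitE Λ psq c w ^ 2
        - (4 + 3 * (w : ℂ) ^ 2) * explicitE Λ psq c w
        + ((psq / Λ ^ 2 : ℝ) : ℂ) * (w : ℂ) ^ 2 = 0 := by
  set a := psq / (6 * Λ ^ 2) with ha
  have hpsq : psq / Λ ^ 2 = 6 * a := by rw [ha]; field_simp
  rw [jFun_eq_jX] at hj
  have hsol := kummerSol_jX a c
  have h1 : HasDerivAt (fun w : ℝ => (3 : ℂ) * (w : ℂ) ^ 2) (6 * (w : ℂ)) w := by
    have : HasDerivAt (fun w : ℝ => (w : ℂ)) 1 w := by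
      simpa using (hasDerivAt_id w).ofReal_comp
    refine ((this.fun_pow 2).const_mul 3).congr_deriv ?_
    norm_num
    ring
  have h2 := ((h1.fun_mul (hsol.hasDerivAt_comp' hw)).fun_div (hsol.hasDerivAt_comp hw) hj).neg
  have h3 := h2.congr_of_eventuallyEq (f₁ := explicitE Λ psq c) (by
    filter_upwards [lt_mem_nhds hw] with y hy
    exact explicitE_eq Λ psq c hy)
  refine ⟨(hasDerivAt_jFun Λ psq c hw).differentiableAt, h3.differentiableAt, ?_⟩
  have hw' : (w : ℂ) ≠ 0 := by exact_mod_cast hw.ne'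
  rw [h3.deriv, explicitE_eq Λ psq c hw, hpsq, ← ha]
  push_cast
  generalize jX a c (3 * w ^ 2 / 2) = J at hj ⊢
  field_simp
  ring

/-! ### The infrared-regular member of the family -/

/-- `𝐄 = -2x J'/J = 2 a x B/A`, the response attached to the infrared solution `J = A`. -/
def irE (a x : ℝ) : ℝ := 2 * a * x * irB (a + 1) x / irA (a + 1) x

lemma jX_cIR (Λ psq : ℝ) {a : ℝ} (ha : a = psq / (6 * Λ ^ 2)) (ha1 : -1 < a) {x : ℝ} (hx : 0 < x) :
    jX a (cIR Λ psq) x = cIR Λ psq * (Complex.Gamma (1 - a))⁻¹ * irA (a + 1) x := by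
  have hΓ : Complex.Gamma (a + 2) ≠ 0 :=
    Complex.Gamma_ne_zero_of_re_pos (by simp; linarith)
  have he : Complex.exp (-(Complex.I * Real.pi * a)) * Complex.exp (Complex.I * Real.pi * a) = 1 := by
    rw [← Complex.exp_add]; simp
  have hc : cIR Λ psq * (Complex.exp (Complex.I * Real.pi * a) * Complex.Gamma (a + 2) / 2)
      = 4 / 9 := by
    rw [cIR, ← ha, add_comm (2 : ℂ)]
    generalize Complex.exp (-(Complex.I * Real.pi * a)) = e₁ at he ⊢
    generalize Complex.exp (Complex.I * Real.pi * a) = e₂ at he ⊢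
    field_simp
    linear_combination 8 * he
  rw [jX, meijerX_eq_solS_add_irA ha1 hx]
  linear_combination (-(solS a x : ℂ)) * hc

lemma jX'_cIR (Λ psq : ℝ) {a : ℝ} (ha : a = psq / (6 * Λ ^ 2)) (ha1 : -1 < a) {x : ℝ} (hx : 0 < x) :
    jX' a (cIR Λ psq) x
      = cIR Λ psq * (Complex.Gamma (1 - a))⁻¹ * ((-a * irB (a + 1) x : ℝ) : ℂ) := by
  have h1 := (kummerSol_jX a (cIR Λ psq)).hd x hx
  have h2 := ((kummerSol_irA ha1).hd x hx).const_mul (cIR Λ psq * (Complex.Gamma (1 - a))⁻¹)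
  refine h1.unique (h2.congr_of_eventuallyEq ?_)
  filter_upwards [lt_mem_nhds hx] with y hy
  exact jX_cIR Λ psq ha ha1 hy

lemma cIR_ne_zero (Λ psq : ℝ) {a : ℝ} (ha : a = psq / (6 * Λ ^ 2)) (ha1 : -1 < a) :
    cIR Λ psq ≠ 0 := by
  have hΓ : Complex.Gamma (2 + a) ≠ 0 :=
    Complex.Gamma_ne_zero_of_re_pos (by simp; linarith)
  rw [cIR, ← ha]
  exact mul_ne_zero (div_ne_zero (by norm_num) (mul_ne_zero (by norm_num) hΓ)) (Complex.exp_ne_zero _)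

lemma inv_Gamma_one_sub_ne_zero {a : ℝ} (h : ∀ m : ℕ, 1 ≤ m → a ≠ m) :
    (Complex.Gamma (1 - a))⁻¹ ≠ 0 := by
  refine inv_ne_zero (Complex.Gamma_ne_zero fun m hm => h (m + 1) (by omega) ?_)
  have : (a : ℂ) = ((m + 1 : ℕ) : ℝ) := by push_cast; linear_combination -hm
  exact_mod_cast this

lemma jX_cIR_ne_zero (Λ psq : ℝ) {a : ℝ} (ha : a = psq / (6 * Λ ^ 2)) (ha1 : -1 < a)
    (h : ∀ m : ℕ, 1 ≤ m → a ≠ m) {x : ℝ} (hx : 0 < x) : jX a (cIR Λ psq) x ≠ 0 := by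
  rw [jX_cIR Λ psq ha ha1 hx]
  refine mul_ne_zero (mul_ne_zero (cIR_ne_zero Λ psq ha ha1) (inv_Gamma_one_sub_ne_zero h)) ?_
  exact_mod_cast (irA_pos (by linarith) hx.le).ne'

lemma explicitE_cIR (Λ psq : ℝ) {a : ℝ} (ha : a = psq / (6 * Λ ^ 2)) (ha1 : -1 < a)
    (h : ∀ m : ℕ, 1 ≤ m → a ≠ m) {w : ℝ} (hw : 0 < w) :
    explicitE Λ psq (cIR Λ psq) w = irE a (3 * w ^ 2 / 2) := by
  have hx : 0 < 3 * w ^ 2 / 2 := by positivity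
  have hA : (irA (a + 1) (3 * w ^ 2 / 2) : ℂ) ≠ 0 := by
    exact_mod_cast (irA_pos (by linarith) hx.le).ne'
  rw [explicitE_eq Λ psq _ hw, ← ha, jX_cIR Λ psq ha ha1 hx, jX'_cIR Λ psq ha ha1 hx, irE]
  have h1 := mul_ne_zero (cIR_ne_zero Λ psq ha ha1) (inv_Gamma_one_sub_ne_zero h)
  rw [mul_left_comm, mul_div_mul_left _ _ h1]
  push_cast
  field_simp

/-- Any other constant gives a different response: otherwise `j_c / J` would be constant, and so
would be `S / J`, although `S(0) = 0` and `J(0) = 1`. -/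
lemma eq_cIR_of_explicitE_eq (Λ psq : ℝ) {a : ℝ} (ha : a = psq / (6 * Λ ^ 2)) (ha1 : -1 < a)
    {c : ℂ} (hc0 : ∀ w : ℝ, 0 < w → jFun Λ psq c w ≠ 0)
    (hc : ∀ w : ℝ, 0 < w → explicitE Λ psq c w = irE a (3 * w ^ 2 / 2)) : c = cIR Λ psq := by
  by_contra hne
  have hp : 0 ≤ a + 1 := by linarith
  have hA : ∀ {x : ℝ}, 0 < x → (irA (a + 1) x : ℂ) ≠ 0 := fun hx => by
    exact_mod_cast (irA_pos hp hx.le).ne'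
  -- the logarithmic derivatives agree
  have hW : ∀ x : ℝ, 0 < x →
      jX' a c x * irA (a + 1) x = jX a c x * ((-a * irB (a + 1) x : ℝ) : ℂ) := by
    intro x hx
    set w := Real.sqrt (2 * x / 3) with hw
    have hw0 : 0 < w := Real.sqrt_pos.2 (by positivity)
    have hxw : 3 * w ^ 2 / 2 = x := by
      rw [hw, Real.sq_sqrt (by positivity)]; ring
    have h1 := hc w hw0
    have h2 := hc0 w hw0
    rw [jFun_eq_jX, ← ha, hxw] at h2
    rw [explicitE_eq Λ psq c hw0, ← ha, hxw, irE] at h1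
    have h3 : 3 * (w : ℂ) ^ 2 = 2 * x := by rw [← hxw]; push_cast; ring
    have hx' : (x : ℂ) ≠ 0 := by exact_mod_cast hx.ne'
    have hA' := hA hx
    rw [h3] at h1
    push_cast at h1 ⊢
    field_simp at h1
    linear_combination -h1
  obtain ⟨k, hk⟩ := exists_eq_const_of_hasDerivAt_zero
    (f := fun x => jX a c x / irA (a + 1) x) fun x hx => by
      refine (((kummerSol_jX a c).hd x hx).fun_div ((kummerSol_irA ha1).hd x hx)
        (hA hx)).congr_deriv ?_
      rw [hW x hx, sub_self, zero_div]
  have hk' : ∀ x : ℝ, 0 < x → jX a c x = k * irA (a + 1) x := fun x hx =>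
    (div_eq_iff (hA hx)).1 (hk x hx)
  set r := (Complex.Gamma (1 - a))⁻¹ with hr
  set α : ℂ := Complex.exp (Complex.I * Real.pi * a) * Complex.Gamma (a + 2) / 2 with hα
  have hα0 : α ≠ 0 := by
    refine div_ne_zero (mul_ne_zero (Complex.exp_ne_zero _) ?_) two_ne_zero
    exact Complex.Gamma_ne_zero_of_re_pos (by simp; linarith)
  -- subtracting the two members of the family leaves a relation between `S` and `A`
  have hrel : ∀ x : ℝ, 0 < x → (c - cIR Λ psq) * α * solS a x
      = ((c - cIR Λ psq) * r - k + cIR Λ psq * r) * irA (a + 1) x := by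
    intro x hx
    have h1 := hk' x hx
    have h2 := jX_cIR Λ psq ha ha1 hx
    have h3 := meijerX_eq_solS_add_irA ha1 hx
    rw [jX] at h1 h2
    rw [h3] at h1 h2
    linear_combination h2 - h1
  have hS0 : Tendsto (fun x => (solS a x : ℂ)) (𝓝[>] 0) (𝓝 0) := by
    have h1 : Continuous (solS a) := (continuous_pow 2).mul (continuous_kummerR a)
    have h2 := tendsto_ofReal_of_tendsto (h1.tendsto 0)
    have h3 : solS a 0 = 0 := by simp [solS]
    rw [h3, Complex.ofReal_zero] at h2
    exact h2.mono_left nhdsWithin_le_nhds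
  have hA1 := tendsto_ofReal_of_tendsto (tendsto_irA hp)
  set K := (c - cIR Λ psq) * r - k + cIR Λ psq * r with hK
  have hK0 : K = 0 := by
    have h1 := hS0.const_mul ((c - cIR Λ psq) * α)
    have h2 := hA1.const_mul K
    have h3 := tendsto_nhds_unique (h1.congr' (by
      filter_upwards [self_mem_nhdsWithin] with x hx
      exact hrel x hx)) h2
    simpa using h3.symm
  have h4 := hrel 1 one_pos
  rw [hK0, zero_mul] at h4
  have h5 : (solS a 1 : ℂ) ≠ 0 := by exact_mod_cast (solS_pos (by linarith) one_pos).ne'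
  exact (mul_ne_zero (mul_ne_zero (sub_ne_zero.2 hne) hα0) h5) h4

/-! ### The warp factor and the background scalar -/

lemma hasDerivAt_warpFactor {L : ℝ} (hL : 0 < L) (Λ : ℝ) {z : ℝ} (hz : 0 < z) :
    HasDerivAt (warpFactor L Λ) (-Λ ^ 2 * z - 1 / z) z := by
  have h1 : HasDerivAt (fun z : ℝ => -(1 / 2) * Λ ^ 2 * z ^ 2 + (Real.log L - Real.log z))
      (-(1 / 2) * Λ ^ 2 * (2 * z) + (0 - z⁻¹)) z := by
    refine HasDerivAt.add ?_ ((hasDerivAt_const z _).sub (Real.hasDerivAt_log hz.ne'))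
    exact ((hasDerivAt_pow 2 z).const_mul (-(1 / 2) * Λ ^ 2)).congr_deriv (by norm_num)
  refine (h1.congr_of_eventuallyEq ?_).congr_deriv (by rw [one_div]; ring)
  filter_upwards [lt_mem_nhds hz] with y hy
  rw [warpFactor, Real.log_div hL.ne' hy.ne']

lemma exp_warpFactor {L : ℝ} (hL : 0 < L) (Λ : ℝ) {z : ℝ} (hz : 0 < z) :
    Real.exp (warpFactor L Λ z) = (Real.exp (Λ ^ 2 * z ^ 2 / 2))⁻¹ * (L / z) := by
  rw [warpFactor, Real.exp_add, Real.exp_log (by positivity), ← Real.exp_neg]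
  congr 2
  ring

lemma deriv_deriv_warpFactor {L : ℝ} (hL : 0 < L) (Λ : ℝ) {z : ℝ} (hz : 0 < z) :
    deriv (deriv (warpFactor L Λ)) z = -Λ ^ 2 + 1 / z ^ 2 := by
  have h : HasDerivAt (fun z : ℝ => -Λ ^ 2 * z - 1 / z) (-Λ ^ 2 + 1 / z ^ 2) z := by
    refine (((hasDerivAt_id z).const_mul (-Λ ^ 2)).sub
      ((hasDerivAt_const z (1 : ℝ)).fun_div (hasDerivAt_id z) hz.ne')).congr_deriv ?_
    simp only [id]
    ring
  refine (h.congr_of_eventuallyEq ?_).deriv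
  filter_upwards [lt_mem_nhds hz] with y hy
  exact (hasDerivAt_warpFactor hL Λ hy).deriv

lemma backgroundScalar_eq {L : ℝ} (hL : 0 < L) (Λ : ℝ) {z : ℝ} (hz : 0 < z) :
    backgroundScalar 4 (warpFactor L Λ) z
      = ∫ t in (0 : ℝ)..z, Real.sqrt (18 * Λ ^ 2 + 6 * Λ ^ 4 * t ^ 2) := by
  refine intervalIntegral.integral_congr_ae (Eventually.of_forall fun t ht => ?_)
  rw [uIoc_of_le hz.le] at ht
  rw [deriv_deriv_warpFactor hL Λ ht.1, (hasDerivAt_warpFactor hL Λ ht.1).deriv]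
  have := ht.1.ne'
  congr 1
  push_cast
  field_simp
  ring

/-- Near the boundary `φ_B² = 18 Λ² z² + O(z⁴)`. -/
lemma backgroundScalar_sq_mem_Icc {L Λ : ℝ} (hL : 0 < L) {z : ℝ} (hz : 0 < z) :
    backgroundScalar 4 (warpFactor L Λ) z ^ 2
      ∈ Icc (18 * Λ ^ 2 * z ^ 2) ((18 * Λ ^ 2 + 6 * Λ ^ 4 * z ^ 2) * z ^ 2) := by
  rw [backgroundScalar_eq hL Λ hz]
  have hc : Continuous fun t : ℝ => Real.sqrt (18 * Λ ^ 2 + 6 * Λ ^ 4 * t ^ 2) := by fun_prop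
  have h1 : Real.sqrt (18 * Λ ^ 2) * z
      ≤ ∫ t in (0 : ℝ)..z, Real.sqrt (18 * Λ ^ 2 + 6 * Λ ^ 4 * t ^ 2) := by
    have := intervalIntegral.integral_mono_on (μ := volume) (f := fun _ => Real.sqrt (18 * Λ ^ 2))
      hz.le (by simp) (hc.intervalIntegrable 0 z) fun t ht =>
        Real.sqrt_le_sqrt (le_add_of_nonneg_right (by positivity))
    rwa [intervalIntegral.integral_const, sub_zero, smul_eq_mul, mul_comm] at this
  have h2 : ∫ t in (0 : ℝ)..z, Real.sqrt (18 * Λ ^ 2 + 6 * Λ ^ 4 * t ^ 2)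
      ≤ Real.sqrt (18 * Λ ^ 2 + 6 * Λ ^ 4 * z ^ 2) * z := by
    have := intervalIntegral.integral_mono_on (μ := volume)
      (g := fun _ => Real.sqrt (18 * Λ ^ 2 + 6 * Λ ^ 4 * z ^ 2))
      hz.le (hc.intervalIntegrable 0 z) (by simp) fun t ht =>
        Real.sqrt_le_sqrt (by
          have := ht.1
          have := ht.2
          gcongr)
    rwa [intervalIntegral.integral_const, sub_zero, smul_eq_mul, mul_comm z] at this
  have h0 : 0 ≤ Real.sqrt (18 * Λ ^ 2) * z := by positivity
  constructor
  · have := pow_le_pow_left₀ h0 h1 2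
    rwa [mul_pow, Real.sq_sqrt (by positivity)] at this
  · have := pow_le_pow_left₀ (h0.trans h1) h2 2
    rwa [mul_pow, Real.sq_sqrt (by positivity)] at this

/-! ### Existence of the infrared-regular response -/

lemma irE_nonneg {a x : ℝ} (ha : 0 ≤ a) (hx : 0 ≤ x) : 0 ≤ irE a x := by
  have h1 := irB_nonneg (p := a + 1) hx
  have h2 := irA_pos (p := a + 1) (by linarith) hx
  unfold irE
  positivity

/-- The Riccati equation `2x e' = e² + (4 + 2x) e - 4ax` in the variable `x`. -/
lemma hasDerivAt_irE {a x : ℝ} (ha : -1 < a) (hx : 0 < x) :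
    HasDerivAt (irE a) ((irE a x ^ 2 + (4 + 2 * x) * irE a x - 4 * a * x) / (2 * x)) x := by
  have hp : 0 < a + 1 := by linarith
  have hA := (irA_pos hp.le hx.le).ne'
  have h := (((hasDerivAt_id x).const_mul (2 * a)).fun_mul (hasDerivAt_irB hp.le hx)).fun_div
    (hasDerivAt_irA hp.le hx) hA
  refine h.congr_deriv ?_
  have e := irA_sub_eq hp hx
  have hC : irC (a + 1) x = (irA (a + 1) x - x * irB (a + 1) x - irB (a + 1) x) / ((a + 1) * x) := by
    rw [eq_div_iff (by positivity)]
    linear_combination -e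
  rw [hC, irE]
  simp only [id]
  field_simp
  ring

/-- The infrared-regular response in the variable `z`. -/
def irResponse (L Λ psq z : ℝ) : ℝ :=
  Real.exp (Λ ^ 2 * z ^ 2 / 2) / L * irE (psq / (6 * Λ ^ 2)) (3 * (Λ * z) ^ 2 / 2)

lemma solvesTensorRiccati_irResponse {L Λ psq : ℝ} (hL : 0 < L) (hΛ : 0 < Λ)
    (ha : -1 < psq / (6 * Λ ^ 2)) :
    SolvesTensorRiccati 4 (warpFactor L Λ) psq (irResponse L Λ psq) := by
  intro z hz
  set a := psq / (6 * Λ ^ 2) with ha'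
  have hx : 0 < 3 * (Λ * z) ^ 2 / 2 := by positivity
  have h1 : HasDerivAt (fun z : ℝ => Real.exp (Λ ^ 2 * z ^ 2 / 2) / L)
      (Real.exp (Λ ^ 2 * z ^ 2 / 2) * (Λ ^ 2 * z) / L) z := by
    have : HasDerivAt (fun z : ℝ => Λ ^ 2 * z ^ 2 / 2) (Λ ^ 2 * z) z := by
      refine (((hasDerivAt_pow 2 z).const_mul (Λ ^ 2)).div_const 2).congr_deriv ?_
      norm_num
      ring
    exact this.exp.div_const L
  have h2 : HasDerivAt (fun z : ℝ => 3 * (Λ * z) ^ 2 / 2) (3 * Λ ^ 2 * z) z := by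
    refine ((((hasDerivAt_id z).const_mul Λ).fun_pow 2).const_mul 3 |>.div_const 2).congr_deriv ?_
    norm_num
    ring
  have h3 := h1.fun_mul ((hasDerivAt_irE ha hx).comp z h2)
  refine ⟨h3.differentiableAt, ?_⟩
  have hpsq : psq = 6 * Λ ^ 2 * a := by rw [ha']; field_simp
  rw [HasDerivAt.deriv (f := irResponse L Λ psq) h3, Real.exp_neg, exp_warpFactor hL Λ hz,
    (hasDerivAt_warpFactor hL Λ hz).deriv, irResponse, ← ha', hpsq]
  have he := (Real.exp_pos (Λ ^ 2 * z ^ 2 / 2)).ne'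
  simp only [Function.comp_apply]
  generalize irE a (3 * (Λ * z) ^ 2 / 2) = e
  generalize Real.exp (Λ ^ 2 * z ^ 2 / 2) = t at he ⊢
  push_cast
  field_simp
  ring

lemma isIRRegularResponse_irResponse {L Λ psq : ℝ} (hL : 0 < L) (hΛ : 0 < Λ) (hpsq : 0 ≤ psq) :
    IsIRRegularResponse 4 (warpFactor L Λ) psq (irResponse L Λ psq) := by
  have ha : 0 ≤ psq / (6 * Λ ^ 2) := by positivity
  refine ⟨solvesTensorRiccati_irResponse hL hΛ (by linarith), 1, one_pos, 0, fun z hz => ?_⟩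
  rw [Left.neg_nonpos_iff]
  refine intervalIntegral.integral_nonneg hz fun t ht => ?_
  have h := irE_nonneg ha (x := 3 * (Λ * t) ^ 2 / 2) (by positivity)
  unfold irResponse
  positivity

/-! ### Uniqueness of the infrared-regular response -/

/-- An infrared-regular solution lies above every other solution. Writing `Fᵢ = -∫ e^A Eᵢ`, the
difference is `E₁ - E₂ = K e^{-4A - F₁ - F₂}`, so that `(e^{F₁ - F₂})' = -K e^{-3A - 2F₂}`. If `K > 0`
and `F₂` is bounded above, this is bounded away from zero in the infrared, and the positive function
`e^{F₁ - F₂}` would become negative. -/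
lemma le_of_irRegular {A A' E₁ E₂ : ℝ → ℝ} {psq z₁ : ℝ}
    (hA : ∀ z, 0 < z → HasDerivAt A (A' z) z) (hA0 : ∀ z, z₁ ≤ z → A z ≤ 0)
    (h₁ : SolvesTensorRiccati 4 A psq E₁) (h₂ : SolvesTensorRiccati 4 A psq E₂)
    (hreg : IRRegular A E₂) {ζ : ℝ} (hζ : 0 < ζ) : E₁ ζ ≤ E₂ ζ := by
  by_contra! hlt
  obtain ⟨b, hb, C, hC⟩ := hreg
  have hF : ∀ {E : ℝ → ℝ}, SolvesTensorRiccati 4 A psq E → ∀ z, 0 < z →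
      HasDerivAt (fun z => -∫ t in b..z, Real.exp (A t) * E t) (-(Real.exp (A z) * E z)) z := by
    intro E hE z hz
    have hc : ContinuousOn (fun t => Real.exp (A t) * E t) (Ioi 0) := fun t ht =>
      ((hA t ht).continuousAt.rexp.mul (hE t ht).1.continuousAt).continuousWithinAt
    refine (intervalIntegral.integral_hasDerivAt_right ?_
      (hc.stronglyMeasurableAtFilter isOpen_Ioi z hz) (hc.continuousAt (Ioi_mem_nhds hz))).neg
    exact (hc.mono fun t ht => (lt_min hb hz).trans_le ht.1).intervalIntegrable
  set F₁ : ℝ → ℝ := fun z => -∫ t in b..z, Real.exp (A t) * E₁ t with hF₁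
  set F₂ : ℝ → ℝ := fun z => -∫ t in b..z, Real.exp (A t) * E₂ t with hF₂
  have hd₁ : ∀ z, 0 < z → HasDerivAt F₁ (-(Real.exp (A z) * E₁ z)) z := hF h₁
  have hd₂ : ∀ z, 0 < z → HasDerivAt F₂ (-(Real.exp (A z) * E₂ z)) z := hF h₂
  have hconst : ∀ z, 0 < z →
      HasDerivAt (fun z => (E₁ z - E₂ z) * Real.exp (4 * A z + F₁ z + F₂ z)) 0 z := by
    intro z hz
    have h := ((h₁ z hz).1.hasDerivAt.fun_sub (h₂ z hz).1.hasDerivAt).fun_mul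
      ((((hA z hz).const_mul 4).fun_add (hd₁ z hz)).fun_add (hd₂ z hz)).exp
    refine h.congr_deriv ?_
    have e₁ := (h₁ z hz).2
    have e₂ := (h₂ z hz).2
    rw [(hA z hz).deriv] at e₁ e₂
    push_cast at e₁ e₂
    linear_combination (e₁ - e₂) * Real.exp (4 * A z + F₁ z + F₂ z)
  obtain ⟨K, hK⟩ := isOpen_Ioi.exists_is_const_of_deriv_eq_zero (isPreconnected_Ioi (a := (0 : ℝ)))
    (fun z hz => (hconst z hz).differentiableAt.differentiableWithinAt)
    fun z hz => (hconst z hz).deriv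
  have hK0 : 0 < K := by
    rw [← hK ζ hζ]
    exact mul_pos (sub_pos.2 hlt) (Real.exp_pos _)
  have hdu : ∀ z, 0 < z → HasDerivAt (fun z => Real.exp (F₁ z - F₂ z))
      (-(K * Real.exp (-3 * A z - 2 * F₂ z))) z := by
    intro z hz
    refine ((hd₁ z hz).fun_sub (hd₂ z hz)).exp.congr_deriv ?_
    rw [← hK z hz, mul_assoc, ← Real.exp_add]
    have e : 4 * A z + F₁ z + F₂ z + (-3 * A z - 2 * F₂ z) = A z + (F₁ z - F₂ z) := by ring
    rw [e, Real.exp_add]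
    ring
  set K' := K * Real.exp (-2 * C) with hK'
  have hK'0 : 0 < K' := mul_pos hK0 (Real.exp_pos _)
  set m := max b z₁ with hm
  have hpos : ∀ z, m ≤ z → 0 < z := fun z hz => hb.trans_le ((le_max_left _ _).trans hz)
  have hg : ∀ z, m ≤ z → HasDerivAt (fun z => Real.exp (F₁ z - F₂ z) + K' * z)
      (-(K * Real.exp (-3 * A z - 2 * F₂ z)) + K') z := by
    intro z hz
    refine (hdu z (hpos z hz)).fun_add ?_
    simpa using (hasDerivAt_id z).const_mul K'
  have hanti : AntitoneOn (fun z => Real.exp (F₁ z - F₂ z) + K' * z) (Ici m) := by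
    refine antitoneOn_of_deriv_nonpos (convex_Ici m)
      (fun z hz => (hg z hz).continuousAt.continuousWithinAt)
      (fun z hz => (hg z (interior_subset hz)).differentiableAt.differentiableWithinAt) ?_
    intro z hz
    have hz' : m ≤ z := interior_subset hz
    rw [(hg z hz').deriv]
    have h1 := hC z ((le_max_left _ _).trans hz')
    have h2 := hA0 z ((le_max_right _ _).trans hz')
    have h3 : K' ≤ K * Real.exp (-3 * A z - 2 * F₂ z) :=
      mul_le_mul_of_nonneg_left (Real.exp_le_exp.2 (by simp only [hF₂]; linarith)) hK0.le
    linarith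
  -- by this point the decreasing function has used up its value at `m`
  set n := m + Real.exp (F₁ m - F₂ m) / K' with hn
  have hmn : m ≤ n := le_add_of_nonneg_right (by positivity)
  have h := hanti (mem_Ici.2 le_rfl) (mem_Ici.2 hmn) hmn
  have hKn : K' * n = K' * m + Real.exp (F₁ m - F₂ m) := by rw [hn]; field_simp
  have := Real.exp_pos (F₁ n - F₂ n)
  simp only [hKn] at h
  linarith

lemma warpFactor_nonpos {L : ℝ} (hL : 0 < L) (Λ : ℝ) {z : ℝ} (hz : L ≤ z) :
    warpFactor L Λ z ≤ 0 := by
  have h1 : Real.log (L / z) ≤ 0 :=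
    Real.log_nonpos (by have := hL.trans_le hz; positivity) ((div_le_one (hL.trans_le hz)).2 hz)
  have h2 : 0 ≤ 1 / 2 * Λ ^ 2 * z ^ 2 := by positivity
  unfold warpFactor
  linarith

lemma IsIRRegularResponse.eqOn {L Λ psq : ℝ} (hL : 0 < L) {E₁ E₂ : ℝ → ℝ}
    (h₁ : IsIRRegularResponse 4 (warpFactor L Λ) psq E₁)
    (h₂ : IsIRRegularResponse 4 (warpFactor L Λ) psq E₂) : EqOn E₁ E₂ (Ioi 0) := by
  have hA := fun (z : ℝ) (hz : 0 < z) => hasDerivAt_warpFactor hL Λ hz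
  have hA0 := fun (z : ℝ) (hz : L ≤ z) => warpFactor_nonpos hL Λ hz
  exact fun z hz => le_antisymm (le_of_irRegular hA hA0 h₁.1 h₂.1 h₂.2 hz)
    (le_of_irRegular hA hA0 h₂.1 h₁.1 h₁.2 hz)

/-! ### The explicit form of the infrared-regular response -/

lemma irResponse_rescaled {L Λ : ℝ} (hL : 0 < L) (psq z : ℝ) :
    L * irResponse L Λ psq z * Real.exp (-(Λ ^ 2 * z ^ 2 / 2))
      = irE (psq / (6 * Λ ^ 2)) (3 * (Λ * z) ^ 2 / 2) := by
  rw [irResponse, Real.exp_neg]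
  field_simp

lemma forall_explicitE_iff {L Λ psq : ℝ} (hL : 0 < L) (hΛ : 0 < Λ) (hpsq : 0 ≤ psq)
    (hm : ∀ m : ℕ, 1 ≤ m → psq / (6 * Λ ^ 2) ≠ (m : ℝ)) (c : ℂ) :
    (∀ z : ℝ, 0 < z → jFun Λ psq c (Λ * z) ≠ 0 ∧
      ((L * irResponse L Λ psq z * Real.exp (-(Λ ^ 2 * z ^ 2 / 2)) : ℝ) : ℂ)
        = explicitE Λ psq c (Λ * z)) ↔ c = cIR Λ psq := by
  have ha : -1 < psq / (6 * Λ ^ 2) := by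
    have : 0 ≤ psq / (6 * Λ ^ 2) := by positivity
    linarith
  simp only [irResponse_rescaled hL]
  constructor
  · intro h
    have h' : ∀ w : ℝ, 0 < w → jFun Λ psq c w ≠ 0 ∧
        ((irE (psq / (6 * Λ ^ 2)) (3 * w ^ 2 / 2) : ℝ) : ℂ) = explicitE Λ psq c w := by
      intro w hw
      have := h (w / Λ) (by positivity)
      rwa [mul_div_cancel₀ w hΛ.ne'] at this
    exact eq_cIR_of_explicitE_eq Λ psq rfl ha (fun w hw => (h' w hw).1)
      fun w hw => (h' w hw).2.symm
  · rintro rfl z hz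
    have hw : 0 < Λ * z := by positivity
    refine ⟨?_, (explicitE_cIR Λ psq rfl ha hm hw).symm⟩
    rw [jFun_eq_jX]
    exact jX_cIR_ne_zero Λ psq rfl ha hm (by positivity)

lemma continuousAt_irE {a x : ℝ} (ha : -1 < a) (hx : 0 < x) : ContinuousAt (fun a => irE a x) a := by
  have hp : 0 < a + 1 := by linarith
  have hc : ContinuousAt (fun a : ℝ => a + 1) a := by fun_prop
  have hA : ContinuousAt (fun a => irA (a + 1) x) a :=
    ContinuousAt.comp (f := fun a : ℝ => a + 1) (g := fun p => irA p x) (continuousAt_irA hp hx) hc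
  have hB : ContinuousAt (fun a => irB (a + 1) x) a :=
    ContinuousAt.comp (f := fun a : ℝ => a + 1) (g := fun p => irB p x) (continuousAt_irB hp hx) hc
  unfold irE
  exact ((by fun_prop : ContinuousAt (fun a : ℝ => 2 * a * x) a).mul hB).div hA
    (irA_pos hp.le hx.le).ne'

lemma tendsto_explicitE_cIR {L Λ psq : ℝ} (hL : 0 < L) (hΛ : 0 < Λ) (hpsq : 0 ≤ psq) {z : ℝ}
    (hz : 0 < z) : Tendsto (fun q : ℝ => explicitE Λ q (cIR Λ q) (Λ * z)) (𝓝[≠] psq)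
      (𝓝 ((L * irResponse L Λ psq z * Real.exp (-(Λ ^ 2 * z ^ 2 / 2)) : ℝ) : ℂ)) := by
  rw [irResponse_rescaled hL]
  have ha : -1 < psq / (6 * Λ ^ 2) := by
    have : 0 ≤ psq / (6 * Λ ^ 2) := by positivity
    linarith
  have hw : 0 < Λ * z := by positivity
  have hdiv : Continuous fun q : ℝ => q / (6 * Λ ^ 2) := by fun_prop
  have h1 : ContinuousAt (fun q : ℝ => irE (q / (6 * Λ ^ 2)) (3 * (Λ * z) ^ 2 / 2)) psq :=
    ContinuousAt.comp (f := fun q : ℝ => q / (6 * Λ ^ 2))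
      (g := fun a => irE a (3 * (Λ * z) ^ 2 / 2)) (continuousAt_irE ha (by positivity))
      hdiv.continuousAt
  refine (tendsto_ofReal_of_tendsto (h1.tendsto.mono_left nhdsWithin_le_nhds)).congr' ?_
  -- the excluded values of `p²` are isolated
  have hmap : Tendsto ((↑) : ℝ → ℂ) (𝓝[≠] psq) (𝓝[≠] (psq : ℂ)) := by
    refine tendsto_nhdsWithin_iff.2
      ⟨(Complex.continuous_ofReal.tendsto psq).mono_left nhdsWithin_le_nhds, ?_⟩
    filter_upwards [self_mem_nhdsWithin] with q hq h
    exact hq (Complex.ofReal_injective h)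
  filter_upwards [hmap.eventually (eventually_div_ne_intCast hΛ psq),
    (hdiv.continuousAt.tendsto.mono_left nhdsWithin_le_nhds).eventually (lt_mem_nhds ha)]
    with q hq1 hq2
  have hq3 : ∀ m : ℕ, 1 ≤ m → q / (6 * Λ ^ 2) ≠ m := fun m _ h => hq1 m (by exact_mod_cast h)
  exact (explicitE_cIR Λ q rfl hq2 hq3 hw).symm

/-! ### Holographic renormalization -/

/-- A function with a one-sided slope at the boundary beats a logarithm. -/
lemma tendsto_sub_mul_log {f : ℝ → ℝ} {c l : ℝ}
    (h : Tendsto (fun x => (f x - c) / x) (𝓝[>] 0) (𝓝 l)) :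
    Tendsto (fun x => (f x - c) * Real.log x) (𝓝[>] 0) (𝓝 0) := by
  have h1 := h.mul tendsto_id_mul_log
  rw [mul_zero] at h1
  refine h1.congr' ?_
  filter_upwards [self_mem_nhdsWithin] with x (hx : 0 < x)
  field_simp

lemma tendsto_exp_slope (k : ℝ) :
    Tendsto (fun x => (Real.exp (k * x) - 1) / x) (𝓝[>] 0) (𝓝 k) := by
  have h : HasDerivAt (fun x : ℝ => Real.exp (k * x)) k 0 := by
    simpa using ((hasDerivAt_id (0 : ℝ)).const_mul k).exp
  have h1 := (hasDerivAt_iff_tendsto_slope.1 h).mono_left (nhdsGT_le_nhdsNE 0)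
  refine h1.congr fun x => ?_
  simp [slope_def_field]

lemma tendsto_exp_mul (k : ℝ) : Tendsto (fun x => Real.exp (k * x)) (𝓝[>] 0) (𝓝 1) := by
  have h : Continuous fun x : ℝ => Real.exp (k * x) := by fun_prop
  have h1 := h.tendsto 0
  simp only [mul_zero, Real.exp_zero] at h1
  exact h1.mono_left nhdsWithin_le_nhds

/-- The boundary expansion of the response at the order of the vacuum expectation value. -/
lemma tendsto_irB_div_irA {p : ℝ} (hp : 0 < p) :
    Tendsto (fun x => (Real.exp (1 / 3 * x) * (irB p x / irA p x) - Real.exp (2 / 3 * x)) / x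
      - p * Real.log x) (𝓝[>] 0) (𝓝 (p * kappa p - 4 / 3)) := by
  have hA := tendsto_irA hp.le
  have hAs := tendsto_irA_slope hp
  -- the quotient without the exponentials
  have h1 : Tendsto (fun x => (irB p x / irA p x - 1) / x - p * Real.log x) (𝓝[>] 0)
      (𝓝 (p * kappa p - 1)) := by
    have h := (((tendsto_irB_slope hp).sub hAs).sub ((tendsto_sub_mul_log hAs).const_mul p)).div hA
      one_ne_zero
    have e : (p * (kappa p - 1) - (1 - p) - p * 0) / 1 = p * kappa p - 1 := by ring
    rw [e] at h
    refine h.congr' ?_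
    filter_upwards [self_mem_nhdsWithin] with x (hx : 0 < x)
    have hne := (irA_pos hp.le hx.le).ne'
    simp only [Pi.div_apply]
    field_simp
    ring
  have h2 := ((((tendsto_exp_mul (1 / 3)).mul h1).add
    ((tendsto_sub_mul_log (tendsto_exp_slope (1 / 3))).const_mul p)).add
      (tendsto_exp_slope (1 / 3))).sub (tendsto_exp_slope (2 / 3))
  have e : 1 * (p * kappa p - 1) + p * 0 + 1 / 3 - 2 / 3 = p * kappa p - 4 / 3 := by ring
  rw [e] at h2
  refine h2.congr' ?_
  filter_upwards [self_mem_nhdsWithin] with x (hx : 0 < x)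
  field_simp
  ring

/-- The value of the renormalized response function. The prefactor `9Λ⁴/4` is `x²/z⁴`, and the rest
is the coefficient of `x²` left after the subtraction of the local terms. -/
def renormalizedValue (Λ μ psq : ℝ) : ℝ :=
  9 * Λ ^ 4 / 4 * (2 * (psq / (6 * Λ ^ 2)) * ((psq / (6 * Λ ^ 2) + 1)
    * (kappa (psq / (6 * Λ ^ 2) + 1) + Real.log (3 * Λ ^ 2 / (2 * μ ^ 2))) - 4 / 3))

lemma isRenormalizedResponse_irResponse {L Λ μ psq : ℝ} (hL : 0 < L) (hΛ : 0 < Λ) (hμ : 0 < μ)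
    (hpsq : 0 ≤ psq) :
    IsRenormalizedResponse L μ psq (warpFactor L Λ) (backgroundScalar 4 (warpFactor L Λ))
      (irResponse L Λ psq) (renormalizedValue Λ μ psq) := by
  set a := psq / (6 * Λ ^ 2) with ha
  have hpa : psq = 6 * Λ ^ 2 * a := by rw [ha]; field_simp
  have hp : 0 < a + 1 := by positivity
  set l := Real.log (3 * Λ ^ 2 / (2 * μ ^ 2)) with hl
  set X : ℝ → ℝ := fun z => 3 * (Λ * z) ^ 2 / 2 with hX
  have hXpos : ∀ z, 0 < z → 0 < X z := fun z hz => by simp only [hX]; positivity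
  have hX0 : Tendsto X (𝓝[>] 0) (𝓝[>] 0) := by
    refine tendsto_nhdsWithin_of_tendsto_nhds_of_eventually_within _ ?_ ?_
    · have hc : Continuous X := by simp only [hX]; fun_prop
      have h := hc.tendsto 0
      have h0 : X 0 = 0 := by simp [hX]
      rw [h0] at h
      exact h.mono_left nhdsWithin_le_nhds
    · filter_upwards [self_mem_nhdsWithin] with z hz
      exact hXpos z hz
  -- `ρ = φ²/(6x)` tends to `2`, faster than a logarithm diverges
  set ρ : ℝ → ℝ := fun z => backgroundScalar 4 (warpFactor L Λ) z ^ 2 / (6 * X z) with hρ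
  have hρbd : ∀ z, 0 < z → |ρ z - 2| ≤ 4 / 9 * X z := by
    intro z hz
    obtain ⟨h1, h2⟩ := backgroundScalar_sq_mem_Icc (L := L) (Λ := Λ) hL hz
    have hx := hXpos z hz
    have h3 : 2 ≤ ρ z := by
      rw [hρ]
      refine (le_div_iff₀ (by positivity)).2 (le_trans (le_of_eq ?_) h1)
      simp only [hX]; ring
    have h4 : ρ z ≤ 2 + 4 / 9 * X z := by
      rw [hρ]
      refine (div_le_iff₀ (by positivity)).2 (h2.trans (le_of_eq ?_))
      simp only [hX]; ring
    rw [abs_le]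
    constructor <;> linarith
  have hρ2 : Tendsto ρ (𝓝[>] 0) (𝓝 2) := by
    have h1 : Tendsto (fun z => 4 / 9 * X z) (𝓝[>] 0) (𝓝 0) := by
      simpa using (hX0.mono_right nhdsWithin_le_nhds).const_mul (4 / 9)
    rw [tendsto_iff_norm_sub_tendsto_zero]
    refine squeeze_zero' (Eventually.of_forall fun _ => norm_nonneg _) ?_ h1
    filter_upwards [self_mem_nhdsWithin] with z hz
    exact hρbd z hz
  have hρlog : Tendsto (fun z => (ρ z - 2) * Real.log (X z)) (𝓝[>] 0) (𝓝 0) := by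
    have h1 : Tendsto (fun z => 4 / 9 * |X z * Real.log (X z)|) (𝓝[>] 0) (𝓝 0) := by
      simpa using (tendsto_id_mul_log.comp hX0).abs.const_mul (4 / 9)
    refine squeeze_zero_norm' ?_ h1
    filter_upwards [self_mem_nhdsWithin] with z hz
    rw [Real.norm_eq_abs, abs_mul, abs_mul, abs_of_pos (hXpos z hz), ← mul_assoc]
    exact mul_le_mul_of_nonneg_right (hρbd z hz) (abs_nonneg _)
  have hlead := ((tendsto_irB_div_irA hp).comp hX0).const_mul (2 * a)
  have hlog43 := (tendsto_sub_mul_log (tendsto_exp_slope (4 / 3))).comp hX0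
  have hlog23 := (tendsto_sub_mul_log (tendsto_exp_slope (2 / 3))).comp hX0
  have he43 := (tendsto_exp_mul (4 / 3)).comp hX0
  have he23 := (tendsto_exp_mul (2 / 3)).comp hX0
  -- the logarithms of the local terms, apart from the leading one that the response cancels
  have hcoef := ((((hlog43.const_mul (2 * a)).add (hlog23.mul hρ2)).add hρlog).const_mul a)
  -- the change of scale from `z² μ²` to `x`
  have hconst := ((((he43.const_mul (2 * a)).add (he23.mul hρ2)).const_mul (a * l)))
  have h := ((hlead.sub hcoef).add hconst).const_mul (9 * Λ ^ 4 / 4)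
  have hval : 9 * Λ ^ 4 / 4 * (2 * a * ((a + 1) * kappa (a + 1) - 4 / 3)
      - a * (2 * a * 0 + 0 * 2 + 0) + a * l * (2 * a * 1 + 1 * 2)) = renormalizedValue Λ μ psq := by
    rw [renormalizedValue]; ring
  rw [hval] at h
  refine h.congr' ?_
  filter_upwards [self_mem_nhdsWithin] with z (hz : 0 < z)
  have hx := hXpos z hz
  have hlogz : Real.log (z ^ 2 * μ ^ 2) = Real.log (X z) - l := by
    rw [hl, ← Real.log_div hx.ne' (by positivity)]
    congr 1
    simp only [hX]
    field_simp
  have hexpA : Real.exp (-2 * warpFactor L Λ z) = Real.exp (2 / 3 * X z) * z ^ 2 / L ^ 2 := by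
    have h1 := exp_warpFactor hL Λ hz
    have h2 : Real.exp (2 / 3 * X z) = Real.exp (Λ ^ 2 * z ^ 2 / 2) ^ 2 := by
      rw [← Real.exp_nat_mul]
      congr 1
      simp only [hX]; push_cast; ring
    rw [h2, show -2 * warpFactor L Λ z = -((2 : ℕ) * warpFactor L Λ z) by push_cast; ring,
      Real.exp_neg, Real.exp_nat_mul, h1]
    field_simp
  have hexp13 : Real.exp (Λ ^ 2 * z ^ 2 / 2) = Real.exp (1 / 3 * X z) := by
    congr 1
    simp only [hX]; ring
  have hexp43 : Real.exp (4 / 3 * X z) = Real.exp (2 / 3 * X z) ^ 2 := by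
    rw [← Real.exp_nat_mul]; congr 1; push_cast; ring
  have hφ : backgroundScalar 4 (warpFactor L Λ) z ^ 2 = 6 * X z * ρ z := by
    simp only [hρ]; field_simp
  have hz2 : z ^ 2 = 2 * X z / (3 * Λ ^ 2) := by simp only [hX]; field_simp
  have hz4 : z ^ 4 = 4 * X z ^ 2 / (9 * Λ ^ 4) := by simp only [hX]; field_simp; ring
  have hE : irResponse L Λ psq z = Real.exp (1 / 3 * X z) / L *
      (2 * a * X z * irB (a + 1) (X z) / irA (a + 1) (X z)) := by
    rw [irResponse, hexp13, irE]
  simp only [Function.comp_apply]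
  rw [uvLocalPart, hlogz, hexpA, hφ, hz4, hz2, hE, hpa, hexp43]
  have hAne := (irA_pos hp.le hx.le).ne'
  generalize Real.exp (1 / 3 * X z) = e₁
  generalize Real.exp (2 / 3 * X z) = e₂
  field_simp
  ring

/-! ### The renormalized response function in closed form -/

lemma ofReal_renormalizedValue {Λ psq : ℝ} (hΛ : 0 < Λ) (hpsq : 0 ≤ psq) (μ : ℝ) :
    (renormalizedValue Λ μ psq : ℂ) = digammaResponse Λ psq + contactTerms Λ μ psq := by
  have hΛ' : (Λ : ℂ) ≠ 0 := by exact_mod_cast hΛ.ne'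
  have h := digamma_eq_psiInt (p := psq / (6 * Λ ^ 2) + 1) (by positivity)
  have e : (((psq / (6 * Λ ^ 2) + 1 : ℝ) : ℂ) + 1) = 2 + (psq : ℂ) / (6 * (Λ : ℂ) ^ 2) := by
    push_cast; ring
  rw [e] at h
  rw [renormalizedValue, digammaResponse, contactTerms, h, kappa]
  push_cast
  field_simp
  ring

/-- The pole positions are negative. -/
lemma two_add_div_ne_neg_natCast {Λ psq : ℝ} (hpsq : 0 ≤ psq) (m : ℕ) :
    (2 : ℂ) + psq / (6 * (Λ : ℂ) ^ 2) ≠ -m := by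
  intro h
  have h1 : (2 : ℝ) + psq / (6 * Λ ^ 2) = -m := by exact_mod_cast h
  have h2 : 0 ≤ psq / (6 * Λ ^ 2) := by positivity
  have h3 : (0 : ℝ) ≤ m := Nat.cast_nonneg m
  linarith

lemma div_ne_intCast_of_ne_natCast {Λ psq : ℝ} (hpsq : 0 ≤ psq)
    (hm : ∀ m : ℕ, psq / (6 * Λ ^ 2) ≠ m) (k : ℤ) : (psq : ℂ) / (6 * (Λ : ℂ) ^ 2) ≠ k := by
  intro h
  have h1 : psq / (6 * Λ ^ 2) = k := by exact_mod_cast h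
  have h2 : (0 : ℝ) ≤ k := by rw [← h1]; positivity
  obtain ⟨m, rfl⟩ := Int.eq_ofNat_of_zero_le (by exact_mod_cast h2)
  exact hm m (by simpa using h1)

lemma tendsto_boxedResponse_add_contactTerms {Λ psq : ℝ} (hΛ : 0 < Λ) (hpsq : 0 ≤ psq) (μ : ℝ) :
    Tendsto (fun s : ℂ => boxedResponse Λ s + contactTerms Λ μ s) (𝓝[≠] (psq : ℂ))
      (𝓝 (renormalizedValue Λ μ psq : ℂ)) := by
  rw [ofReal_renormalizedValue hΛ hpsq]
  refine Tendsto.add ?_ ?_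
  · refine (((analyticAt_digammaResponse (two_add_div_ne_neg_natCast hpsq)).continuousAt).tendsto.mono_left
      nhdsWithin_le_nhds).congr' ?_
    exact (boxedResponse_eventuallyEq hΛ psq).symm
  · have hc : Continuous (contactTerms Λ μ) := by unfold contactTerms; fun_prop
    exact (hc.tendsto _).mono_left nhdsWithin_le_nhds

end IHQCD

end

theorem mainTheorem2 (L Λ : ℝ) (hL : 0 < L) (hΛ : 0 < Λ) :
    -- each `j_c` gives a solution of the Riccati equation in the variable `w = Λ z`
    (∀ (psq : ℝ) (c : ℂ) (w : ℝ), 0 < w → IHQCD.jFun Λ psq c w ≠ 0 →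
      DifferentiableAt ℝ (IHQCD.jFun Λ psq c) w ∧
      DifferentiableAt ℝ (IHQCD.explicitE Λ psq c) w ∧
      (w : ℂ) * deriv (IHQCD.explicitE Λ psq c) w - IHQCD.explicitE Λ psq c w ^ 2
        - (4 + 3 * (w : ℂ) ^ 2) * IHQCD.explicitE Λ psq c w
        + ((psq / Λ ^ 2 : ℝ) : ℂ) * (w : ℂ) ^ 2 = 0) ∧
    (∀ psq : ℝ, 0 ≤ psq →
      -- the infrared-regular response function exists
      (∃ E : ℝ → ℝ, IHQCD.IsIRRegularResponse 4 (IHQCD.warpFactor L Λ) psq E) ∧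
      ∀ E : ℝ → ℝ, IHQCD.IsIRRegularResponse 4 (IHQCD.warpFactor L Λ) psq E →
        -- it is unique
        (∀ E' : ℝ → ℝ, IHQCD.IsIRRegularResponse 4 (IHQCD.warpFactor L Λ) psq E' →
          EqOn E' E (Ioi 0)) ∧
        -- it is the explicit solution with `c = cIR`, and with no other `c`
        ((∀ m : ℕ, 1 ≤ m → psq / (6 * Λ ^ 2) ≠ (m : ℝ)) → ∀ c : ℂ,
          ((∀ z : ℝ, 0 < z → IHQCD.jFun Λ psq c (Λ * z) ≠ 0 ∧
            ((L * E z * Real.exp (-(Λ ^ 2 * z ^ 2 / 2)) : ℝ) : ℂ)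
              = IHQCD.explicitE Λ psq c (Λ * z)) ↔ c = IHQCD.cIR Λ psq)) ∧
        -- for every `p² ≥ 0`, also the excluded ones, it is the limit of the explicit solution
        (∀ z : ℝ, 0 < z →
          Tendsto (fun q : ℝ => IHQCD.explicitE Λ q (IHQCD.cIR Λ q) (Λ * z)) (𝓝[≠] psq)
            (𝓝 ((L * E z * Real.exp (-(Λ ^ 2 * z ^ 2 / 2)) : ℝ) : ℂ))) ∧
        -- the renormalized response function
        (∀ μ : ℝ, 0 < μ → ∃ Ehat : ℝ,
          IHQCD.IsRenormalizedResponse L μ psq (IHQCD.warpFactor L Λ)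
            (IHQCD.backgroundScalar 4 (IHQCD.warpFactor L Λ)) E Ehat ∧
          ((∀ m : ℕ, psq / (6 * Λ ^ 2) ≠ (m : ℝ)) →
            (Ehat : ℂ) = IHQCD.boxedResponse Λ psq + IHQCD.contactTerms Λ μ psq) ∧
          Tendsto (fun s : ℂ => IHQCD.boxedResponse Λ s + IHQCD.contactTerms Λ μ s)
            (𝓝[≠] (psq : ℂ)) (𝓝 (Ehat : ℂ)) ∧
          HasSum (fun n : ℕ => IHQCD.poleTerm Λ n psq + IHQCD.poleContact Λ n psq)
            ((Ehat : ℂ) - IHQCD.contactTerms Λ μ psq - IHQCD.gammaContact Λ psq))) ∧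
    -- pole expansion, up to contact terms, for complex `s = p²`
    (∀ s : ℂ, (∀ k : ℤ, s / (6 * (Λ : ℂ) ^ 2) ≠ (k : ℂ)) →
      HasSum (fun n : ℕ => IHQCD.poleTerm Λ n s + IHQCD.poleContact Λ n s)
        (IHQCD.boxedResponse Λ s - IHQCD.gammaContact Λ s)) ∧
    -- the spin-2 spectrum: whatever the contact terms, there are simple poles exactly at
    -- `s = -6 Λ² m` with `m ≥ 2`
    (∀ Q : Polynomial ℂ,
      Meromorphic (fun s : ℂ => IHQCD.boxedResponse Λ s + Q.eval s) ∧
      ∀ s : ℂ,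
        ((∃ m : ℕ, 2 ≤ m ∧ s = -(6 * (Λ : ℂ) ^ 2 * (m : ℂ))) →
          meromorphicOrderAt (fun s : ℂ => IHQCD.boxedResponse Λ s + Q.eval s) s = -1) ∧
        ((¬ ∃ m : ℕ, 2 ≤ m ∧ s = -(6 * (Λ : ℂ) ^ 2 * (m : ℂ))) →
          0 ≤ meromorphicOrderAt (fun s : ℂ => IHQCD.boxedResponse Λ s + Q.eval s) s)) := by
  refine ⟨fun psq c w hw hj => IHQCD.explicitE_riccati hΛ psq c hw hj, fun psq hpsq => ?_,
    fun s hs => ?_, fun Q => ⟨fun s => (IHQCD.meromorphicAt_boxedResponse_add hΛ Q s).1,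
      fun s => (IHQCD.meromorphicAt_boxedResponse_add hΛ Q s).2⟩⟩
  · have hreg := IHQCD.isIRRegularResponse_irResponse hL hΛ hpsq
    refine ⟨⟨_, hreg⟩, fun E hE => ?_⟩
    have heq : EqOn E (IHQCD.irResponse L Λ psq) (Ioi 0) := hE.eqOn hL hreg
    refine ⟨fun E' hE' => hE'.eqOn hL hE, fun hm c => ?_, fun z hz => ?_, fun μ hμ =>
      ⟨IHQCD.renormalizedValue Λ μ psq, ?_, fun hm => ?_, ?_, ?_⟩⟩
    · rw [← IHQCD.forall_explicitE_iff hL hΛ hpsq hm c]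
      refine forall₂_congr fun z hz => ?_
      rw [heq hz]
    · rw [heq hz]
      exact IHQCD.tendsto_explicitE_cIR hL hΛ hpsq hz
    · refine (IHQCD.isRenormalizedResponse_irResponse hL hΛ hμ hpsq).congr' ?_
      filter_upwards [self_mem_nhdsWithin] with z hz
      rw [heq hz]
    · rw [IHQCD.ofReal_renormalizedValue hΛ hpsq, IHQCD.boxedResponse_eq_digammaResponse]
      exact IHQCD.div_ne_intCast_of_ne_natCast hpsq hm
    · exact IHQCD.tendsto_boxedResponse_add_contactTerms hΛ hpsq μ
    · have h := IHQCD.hasSum_poleTerm_add_poleContact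
        (IHQCD.two_add_div_ne_neg_natCast (Λ := Λ) hpsq)
      rwa [IHQCD.ofReal_renormalizedValue hΛ hpsq, add_sub_cancel_right]
  · rw [IHQCD.boxedResponse_eq_digammaResponse hs]
    refine IHQCD.hasSum_poleTerm_add_poleContact fun m h => hs (-2 - m) ?_
    push_cast
    linear_combination h
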